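/- **Setting.** Fix two disjoint sets of variables: program variables $x_1,x_2,\dots$ and an infinite set of standard variables. Terms are built from functors and standard variables only. Standard substitutions $\sigma$ act on terms and have finite domain; a renaming is a standard substitution that permutes the standard variables. A program substitution is a map $\theta=\{x_1/t_1,\dots,x_n/t_n\}$, with $\theta\sigma=\{x_1/t_1\sigma,\dots,x_n/t_n\sigma\}$; $\mathrm{codom}(\theta)$ is the set of variables of $t_1,\dots,t_n$. Program substitutions $\theta,\theta'$ are equivalent if $\theta\rho=\theta'$ for a renaming $\rho$, and $[\![\theta]\!]$ is a chosen canonical representative of the equivalence class of $\theta$ (the choice is arbitrary, but fixed). A sequence is finite $\langle a_1,\dots,a_n\rangle$, incomplete $\langle a_1,\dots,a_n,\bot\rangle$, or infinite. Put $S_1\sqsubseteq S_2$ iff $S_1=S_2$, or $S_1=S::\langle\bot\rangle$ and $S_2=S::S'$ for some finite $S$ and some $S'$. Put $S_1\Box S_2=S_1::S_2$ if $S_1$ is finite and $S_1\Box S_2=S_1$ otherwise; $\Box_{k=1}^nS_k=S_1\Box\cdots\Box S_n$ (it is $\langle\,\rangle$ for $n=0$) and $\Box_{k=1}^\infty S_k=\bigsqcup_i\big((\Box_{k=1}^iS_k)\Box\langle\bot\rangle\big)$.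 For a sequence $S$ and a function $F$ with sequences as values, $S\triangleright F$ denotes $\Box_kF(\theta_k)$, over the elements $\theta_k$ of $S$ in order, with a last operand $\langle\bot\rangle$ if $S$ is incomplete. The map $[\![\cdot]\!]$ acts elementwise on sequences. **Programs.** A program $P$ consists of procedures, each of which is a nonempty list of clauses with the same head $p(x_1,\dots,x_n)$. The body of a clause with variables $x_1,\dots,x_m$ ($m\ge n$) is a list of literals, each of the form $q(x_{i_1},\dots,x_{i_r})$ (with $q$ a procedure of $P$), $x_{i_1}=x_{i_2}$, $x_{i_1}=f(x_{i_2},\dots,x_{i_r})$, or $!$ (cut), the variables in a literal being distinct. **Concrete semantics.** A concrete behavior $\longmapsto$ maps every pair $\langle\theta,p\rangle$, with $p$ a procedure of $P$ with head $p(x_1,\dots,x_n)$ and $\theta$ a canonical program substitution on $x_1,\dots,x_n$, to a sequence of canonical program substitutions of the form $\theta\sigma$; concrete behaviors are ordered pointwise by $\sqsubseteq$. Given $\longmapsto$, a clause $c$ and $\theta$, the prefixes $g$ of the body of $c$ get values $\langle S,\mathit{cf}\rangle$ with $\mathit{cf}\in\{\mathit{cut},\mathit{nocut}\}$ as follows.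 The empty prefix gets $\langle\langle[\![\theta']\!]\rangle,\mathit{nocut}\rangle$, where $\theta'$ extends $\theta$ to the variables of $c$ by distinct standard variables not in $\mathrm{codom}(\theta)$. Let $g'$ have the value $\langle S,\mathit{cf}\rangle$. Then $(g',!)$ has the value $\langle S,\mathit{cf}\rangle$ if $S\in\{\langle\,\rangle,\langle\bot\rangle\}$, and $\langle\langle\theta_1\rangle,\mathit{cut}\rangle$ if $S$ begins with a program substitution $\theta_1$. For a literal $l$ with variables $x_{i_1},\dots,x_{i_r}$ other than a cut, $(g',l)$ has the value $\langle S\triangleright F,\mathit{cf}\rangle$, where $F(\eta)$ is obtained as follows. Let $\eta'=\{x_1/x_{i_1}\eta,\dots,x_r/x_{i_r}\eta\}$. If $l$ is a call of $q$, let $S'$ be the value of $\longmapsto$ at $\langle[\![\eta']\!],q\rangle$. If $l$ is an equation, let $S'=[\![\langle[\![\eta']\!]\mu\rangle]\!]$ for a most general unifier $\mu$ of the instances under $[\![\eta']\!]$ of the two sides of $l$ expressed in $x_1,\dots,x_r$, and $S'=\langle\,\rangle$ if they are not unifiable. Then $F(\eta)$ results from $S'$ by replacing each element $\eta'\sigma$,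 where $\mathrm{dom}(\sigma)\subseteq\mathrm{codom}(\eta')$, by $[\![\eta\rho\sigma]\!]$, where $\rho$ is a renaming that exchanges the variables in $\mathrm{codom}(\eta)\setminus\mathrm{codom}(\eta')$ with distinct standard variables not in $\mathrm{codom}(\eta)\cup\mathrm{codom}(\sigma)$ and fixes all other variables. The value of a clause is the value $\langle S,\mathit{cf}\rangle$ of its whole body, with the elements of $S$ restricted to the head variables and made canonical. The value of a procedure with the clause $c$ only is the first component of the value $\langle S,\mathit{cf}\rangle$ of $c$; the value of a procedure with first clause $c$ and remaining clauses $\mathit{pr}'$ is $S\Box S'$ if $\mathit{cf}=\mathit{nocut}$, and $S$ if $\mathit{cf}=\mathit{cut}$, where $S'$ is the value of $\mathit{pr}'$. The transformation $\mathit{TCB}$ maps $\longmapsto$ to the behavior that sends $\langle\theta,p\rangle$ to the value so obtained for the procedure $p$ and $\theta$. The concrete semantics of $P$ is the least concrete behavior that is a fixpoint of $\mathit{TCB}$. **OLD-resolution with cut.** The nodes of an OLD-tree for a query $p(t_1,\dots,t_n)$, with standard variables only, are goals (lists of literals over terms); the root is the query and the leftmost literal is selected. A selected call has one child for each clause of its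 procedure, in program order: the variables of the clause are replaced by distinct standard variables that do not appear in the derivation so far, the call is unified with the head by a most general unifier, and the call is replaced by the body. A selected equation has one child, obtained with a most general unifier of its sides, or none if they are not unifiable. A selected cut is removed. The unifier, if any, is applied to the whole new goal. The choices of most general unifiers and of the renamed clauses are arbitrary. The tree is traversed depth-first from left to right; when a selected cut is reached, all unvisited branches to the right of the cut that descend from its parent goal (the goal whose selected call introduced the cut) are pruned. At each empty goal that is reached, the composition of the unifiers on its branch, restricted to the variables of the query, is a computed answer substitution. The sequence of computed answer substitutions lists them in the order of the traversal. It is finite if the traversal terminates, and otherwise infinite if there are infinitely many of them, and incomplete if there are finitely many. **Theorem.** Let $P$ be a program. The concrete semantics $\longmapsto$ of $P$ exists. For every query $p(t_1,\dots,t_n)$, where $p$ is a procedure of $P$ with head $p(x_1,\dots,x_n)$, put $\theta=\{x_1/t_1,\dots,x_n/t_n\}$. Then for every (finite, incomplete or infinite) sequence $\langle\sigma_1,\dots,\sigma_i,\_\rangle$ of standard substitutions whose domains are contained in the set of variables of $t_1,\dots,t_n$, this sequence is a sequence of computed answer substitutions of $p(t_1,\dots,t_n)$ according to OLD-resolution with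 cut (i.e. for some OLD-tree of the query) if and only if $$\langle[\![\theta]\!],p\rangle\longmapsto[\![\langle\theta\sigma_1,\dots,\theta\sigma_i,\_\rangle]\!].$$ Moreover, all computed answer sequences consist of substitutions with domains contained in the set of variables of the query. In particular, computed answer sequences exist and, after application to $\theta$, are unique up to renaming of each element. -/

import Mathlib

universe u v w x

namespace PrologCut

section Substitutions

variable {L : FirstOrder.Language.{u, v}} {SV : Type w}

/-- The set of standard variables occurring in a term.  Terms are first-order terms built from the
functors (function symbols) of `L` and the standard variables `SV`. -/
noncomputable def tvars (t : L.Term SV) : Set SV :=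
  letI := Classical.decEq SV
  (t.varFinset : Set SV)

/-- Standard substitutions: maps from standard variables to terms that move only finitely many
variables. -/
structure StdSubst (L : FirstOrder.Language.{u, v}) (SV : Type w) where
  toFun : SV → L.Term SV
  finite_dom : {y | toFun y ≠ .var y}.Finite

namespace StdSubst

/-- `dom σ`. -/
def dom (σ : StdSubst L SV) : Set SV := {y | σ.toFun y ≠ .var y}

/-- `codom σ`: the variables occurring in the terms `yσ`, for `y ∈ dom σ`. -/
def codom (σ : StdSubst L SV) : Set SV := ⋃ y ∈ σ.dom, tvars (σ.toFun y)

/-- The identity (empty) substitution. -/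
protected def id : StdSubst L SV where
  toFun := .var
  finite_dom := by simp

/-- Composition in the order of application: `t(στ) = (tσ)τ`. -/
def comp (σ τ : StdSubst L SV) : StdSubst L SV where
  toFun y := (σ.toFun y).subst τ.toFun
  finite_dom := by
    refine (σ.finite_dom.union τ.finite_dom).subset fun y hy => ?_
    by_contra h
    simp only [Set.mem_union, Set.mem_ofPred_eq, not_or, not_not] at h
    exact hy (by rw [h.1]; exact h.2)

open Classical in
/-- The restriction of a standard substitution to a set of variables. -/
noncomputable def restrict (σ : StdSubst L SV) (V : Set SV) : StdSubst L SV where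
  toFun y := if y ∈ V then σ.toFun y else .var y
  finite_dom := by
    refine σ.finite_dom.subset fun y hy h => hy ?_
    simp [h]

/-- Renamings: standard substitutions that define a permutation of the standard variables. -/
def IsRenaming (ρ : StdSubst L SV) : Prop :=
  ∃ e : Equiv.Perm SV, ∀ y, ρ.toFun y = .var (e y)

/-- `σ` unifies `s i` with `t i` for every `i`. -/
def IsUnifier {ι : Type*} (σ : StdSubst L SV) (s t : ι → L.Term SV) : Prop :=
  ∀ i, (s i).subst σ.toFun = (t i).subst σ.toFun

/-- `σ` is a most general unifier of the tuples `s` and `t`. -/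
def IsMGU {ι : Type*} (σ : StdSubst L SV) (s t : ι → L.Term SV) : Prop :=
  σ.IsUnifier s t ∧ ∀ τ : StdSubst L SV, τ.IsUnifier s t → ∃ δ : StdSubst L SV, τ = σ.comp δ

end StdSubst

/-- Program substitutions with domain `{x₁, …, xₙ}`.  The program variable `x_{i+1}` is
represented by the index `i : Fin n`. -/
abbrev PS (L : FirstOrder.Language.{u, v}) (SV : Type w) (n : ℕ) : Type (max u w) :=
  Fin n → L.Term SV

namespace PS

/-- The application `θσ` of a standard substitution to a program substitution. -/
def app {n : ℕ} (θ : PS L SV n) (σ : StdSubst L SV) : PS L SV n :=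
  fun i => (θ i).subst σ.toFun

/-- `codom θ`: the standard variables occurring in the terms bound by `θ`. -/
def codom {n : ℕ} (θ : PS L SV n) : Set SV := ⋃ i, tvars (θ i)

/-- Two program substitutions are equivalent if some renaming maps the first to the second. -/
def Equivalent {n : ℕ} (θ θ' : PS L SV n) : Prop :=
  ∃ ρ : StdSubst L SV, ρ.IsRenaming ∧ θ.app ρ = θ'

end PS

/-- A choice of canonical representatives: `rep θ` is the given representative `⟦θ⟧` of the set of
all program substitutions that are equivalent to `θ`. -/
structure Canon (L : FirstOrder.Language.{u, v}) (SV : Type w) where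
  rep : ∀ {n : ℕ}, PS L SV n → PS L SV n
  equiv : ∀ {n : ℕ} (θ : PS L SV n), θ.Equivalent (rep θ)
  eq_of_equiv : ∀ {n : ℕ} {θ θ' : PS L SV n}, θ.Equivalent θ' → rep θ = rep θ'

instance : Nonempty (StdSubst L SV) := ⟨StdSubst.id⟩

instance [Nonempty SV] : Nonempty (L.Term SV) := ⟨.var (Classical.arbitrary SV)⟩

theorem subst_var (t : L.Term SV) : t.subst FirstOrder.Language.Term.var = t := by
  induction t with
  | var _ => rfl
  | func f ts ih => simp only [FirstOrder.Language.Term.subst, ih]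

theorem subst_subst (t : L.Term SV) (f g : SV → L.Term SV) :
    (t.subst f).subst g = t.subst fun y => (f y).subst g := by
  induction t with
  | var _ => rfl
  | func F ts ih => simp only [FirstOrder.Language.Term.subst, ih]

theorem PS.Equivalent.refl {n : ℕ} (θ : PS L SV n) : θ.Equivalent θ :=
  ⟨StdSubst.id, ⟨Equiv.refl _, fun _ => rfl⟩, funext fun i => subst_var (θ i)⟩

theorem PS.Equivalent.symm {n : ℕ} {θ θ' : PS L SV n} (h : θ.Equivalent θ') :
    θ'.Equivalent θ := by
  obtain ⟨ρ, ⟨e, he⟩, rfl⟩ := h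
  refine ⟨⟨fun y => .var (e.symm y), ?_⟩, ⟨e.symm, fun _ => rfl⟩, ?_⟩
  · refine ρ.finite_dom.subset fun y hy h => hy ?_
    rw [he] at h
    simp only [FirstOrder.Language.Term.var.injEq] at h ⊢
    rw [Equiv.symm_apply_eq, h]
  · funext i
    simpa [PS.app, subst_subst, he, FirstOrder.Language.Term.subst] using subst_var (θ i)

theorem PS.Equivalent.trans {n : ℕ} {θ θ' θ'' : PS L SV n} (h : θ.Equivalent θ')
    (h' : θ'.Equivalent θ'') : θ.Equivalent θ'' := by
  obtain ⟨ρ, ⟨e, he⟩, rfl⟩ := h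
  obtain ⟨ρ', ⟨e', he'⟩, rfl⟩ := h'
  refine ⟨ρ.comp ρ', ⟨e.trans e', fun y => ?_⟩, ?_⟩
  · simp [StdSubst.comp, he, he', FirstOrder.Language.Term.subst]
  · funext i
    simp [PS.app, subst_subst, StdSubst.comp]

/-- Systems of canonical representatives exist. -/
instance : Nonempty (Canon L SV) := by
  have key : ∀ n : ℕ, ∃ r : PS L SV n → PS L SV n, (∀ θ, PS.Equivalent θ (r θ)) ∧
      ∀ θ θ', PS.Equivalent θ θ' → r θ = r θ' := fun n => by
    let s : Setoid (PS L SV n) := ⟨PS.Equivalent, PS.Equivalent.refl, .symm, .trans⟩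
    refine ⟨fun θ => (Quotient.mk s θ).out, fun θ => ?_, fun θ θ' h => ?_⟩
    · exact PS.Equivalent.symm (Quotient.exact (Quotient.out_eq (Quotient.mk s θ)))
    · exact congrArg Quotient.out (Quotient.sound (s := s) h)
  choose r h₁ h₂ using key
  exact ⟨⟨fun {n} => r n, fun {n} => h₁ n, fun {n} => h₂ n _ _⟩⟩

/-- Canonical program substitutions with domain `{x₁, …, xₙ}`. -/
abbrev CPS (C : Canon L SV) (n : ℕ) : Type (max u w) := {θ : PS L SV n // C.rep θ = θ}

/-- `⟦θ⟧`. -/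
def Canon.canon (C : Canon L SV) {n : ℕ} (θ : PS L SV n) : CPS C n :=
  ⟨C.rep θ, (C.eq_of_equiv (C.equiv θ)).symm⟩

end Substitutions

section Sequences

/-- Sequences: finite `<a₁, …, aₙ>`, incomplete `<a₁, …, aₙ, ⊥>`, or infinite. -/
inductive PSeq (α : Type x) : Type x
  | fin (l : List α)
  | inc (l : List α)
  | inf (s : Stream' α)

namespace PSeq

variable {α β : Type*}

/-- The set of proper elements (other than `⊥`) of a sequence. -/
def elems : PSeq α → Set α
  | fin l => {a | a ∈ l}
  | inc l => {a | a ∈ l}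
  | inf s => Set.range s.get

/-- Elementwise image of a sequence. -/
def map (f : α → β) : PSeq α → PSeq β
  | fin l => fin (l.map f)
  | inc l => inc (l.map f)
  | inf s => inf (s.map f)

/-- Concatenation `S :: S'` with a finite sequence `S` on the left. -/
def concat (l : List α) : PSeq α → PSeq α
  | fin l' => fin (l ++ l')
  | inc l' => inc (l ++ l')
  | inf s => inf (Stream'.appendStream' l s)

theorem concat_concat (l l' : List α) (S : PSeq α) :
    concat l (concat l' S) = concat (l ++ l') S := by
  cases S <;> simp [concat, Stream'.append_append_stream]

/-- `S₁ ⊑ S₂` iff `S₁ = S₂`, or `S₁ = S :: <⊥>` and `S₂ = S :: S'` with `S` finite. -/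
instance : PartialOrder (PSeq α) where
  le S₁ S₂ := S₁ = S₂ ∨ ∃ (l : List α) (S' : PSeq α), S₁ = concat l (inc []) ∧ S₂ = concat l S'
  le_refl _ := Or.inl rfl
  le_trans := by
    rintro S₁ S₂ S₃ (rfl | ⟨l, S', rfl, rfl⟩) h
    · exact h
    · rcases h with rfl | ⟨l', S'', h', rfl⟩
      · exact Or.inr ⟨l, S', rfl, rfl⟩
      · cases S' with
        | fin _ => simp [concat] at h'
        | inf _ => simp [concat] at h'
        | inc l'' =>
          simp only [concat, List.append_nil, inc.injEq] at h'
          exact Or.inr ⟨l, concat l'' S'', rfl, by rw [concat_concat, h']⟩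
  le_antisymm := by
    rintro S₁ S₂ (rfl | ⟨l, S', rfl, rfl⟩) h
    · rfl
    · rcases h with h | ⟨l', S'', h', h''⟩
      · exact h.symm
      · cases S' with
        | fin _ => simp [concat] at h'
        | inf _ => simp [concat] at h'
        | inc m =>
          cases S'' with
          | fin _ => simp [concat] at h''
          | inf _ => simp [concat] at h''
          | inc m' =>
            simp only [concat, List.append_nil, inc.injEq] at h' h'' ⊢
            subst h'
            have : m = [] := by
              have := congrArg List.length h''
              simp only [List.length_append] at this
              exact List.length_eq_zero_iff.1 (by omega)
            simp [this]

/-- Lazy concatenation `S₁ □ S₂`. -/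
def box : PSeq α → PSeq α → PSeq α
  | fin l, S => concat l S
  | inc l, _ => inc l
  | inf s, _ => inf s

/-- `□_{k=1}^n S_k`; the family is indexed from `0`. -/
def boxN (S : ℕ → PSeq α) : ℕ → PSeq α
  | 0 => fin []
  | n + 1 => box (boxN S n) (S n)

open Classical in
/-- The least upper bound of a sequence of elements of `PSeq α` (meaningful for chains only). -/
noncomputable def lub (c : ℕ → PSeq α) : PSeq α :=
  if h : ∃ S, IsLUB (Set.range c) S then h.choose else inc []

/-- `□_{k=1}^∞ S_k = ⊔_i ((□_{k=1}^i S_k) □ <⊥>)`. -/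
noncomputable def boxInf (S : ℕ → PSeq α) : PSeq α := lub fun i => box (boxN S i) (inc [])

/-- `□_{k=1}^{Ne(S)} F(θ_k)` for `S = <θ₁, …, θ_i, _>`.  If `S` is incomplete, the last operand,
which corresponds to the element `⊥` of `S`, is `<⊥>`. -/
noncomputable def bind (S : PSeq α) (F : α → PSeq β) : PSeq β :=
  match S with
  | fin l => (l.map F).foldl box (fin [])
  | inc l => box ((l.map F).foldl box (fin [])) (inc [])
  | inf s => boxInf fun k => F (s.get k)

end PSeq

/-- Cut flags. -/
inductive CutFlag
  | cut
  | nocut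

/-- `⟨S₁, cf⟩ □ S₂`. -/
def boxCut {α : Type*} : PSeq α × CutFlag → PSeq α → PSeq α
  | (S₁, .nocut), S₂ => S₁.box S₂
  | (S₁, .cut), _ => S₁

end Sequences

section Programs

variable (L : FirstOrder.Language.{u, v}) {N : Type x} (ar : N → ℕ)

/-- Literals over the program variables `x₁, …, x_m`.  The variables occurring in a literal are
distinct.  `N` is the set of procedure names and `ar` gives their arities.
* `call p a` is `p(x_{a 0}, …, x_{a (n-1)})`;
* `eqVar a` is `x_{a 0} = x_{a 1}`;
* `eqFun f a` is `x_{a 0} = f(x_{a 1}, …, x_{a k})`;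
* `cut` is `!`. -/
inductive Literal (m : ℕ) : Type (max u x)
  | call (p : N) (a : Fin (ar p) ↪ Fin m)
  | eqVar (a : Fin 2 ↪ Fin m)
  | eqFun {k : ℕ} (f : L.Functions k) (a : Fin (k + 1) ↪ Fin m)
  | cut

/-- A clause `p(x₁, …, xₙ) :- body`, whose variables are `x₁, …, x_{n+extra}`. -/
structure Clause (n : ℕ) : Type (max u x) where
  extra : ℕ
  body : List (Literal L ar (n + extra))

/-- Procedures with head `p(x₁, …, xₙ)`: nonempty sequences of clauses. -/
inductive Procedure (n : ℕ) : Type (max u x)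
  | last (c : Clause L ar n)
  | cons (c : Clause L ar n) (pr : Procedure n)

variable {L ar} in
/-- The list of clauses of a procedure. -/
def Procedure.clauses {n : ℕ} : Procedure L ar n → List (Clause L ar n)
  | .last c => [c]
  | .cons c pr => c :: pr.clauses

/-- A normalized program: one procedure for each procedure name. -/
abbrev Program : Type (max u x) := ∀ p : N, Procedure L ar (ar p)

end Programs

section ConcreteSemantics

variable {L : FirstOrder.Language.{u, v}} {SV : Type w} {N : Type x} {ar : N → ℕ}

/-- Functions from the concrete underlying domain of pairs `⟨θ, p⟩` to canonical sequences, with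
the pointwise order. -/
abbrev Behavior (C : Canon L SV) (ar : N → ℕ) : Type (max u w x) :=
  ∀ p : N, CPS C (ar p) → PSeq (CPS C (ar p))

/-- Concrete behaviors: all elements of the output for `⟨θ, p⟩` are instances of `θ`. -/
def IsConcreteBehavior {C : Canon L SV} (b : Behavior C ar) : Prop :=
  ∀ p θ, ∀ θ' ∈ (b p θ).elems, ∃ σ : StdSubst L SV, θ'.1 = θ.1.app σ

variable (C : Canon L SV)

/-- `θ'` extends `θ` by distinct standard variables not belonging to `codom θ`. -/
def IsExtC {n : ℕ} (e : ℕ) (θ : PS L SV n) (θ' : PS L SV (n + e)) : Prop :=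
  ∃ y : Fin e ↪ SV, (∀ j, y j ∉ θ.codom) ∧ θ' = Fin.append θ fun j => .var (y j)

/-- `EXTC`: extension at clause entry. -/
noncomputable def extC [Nonempty SV] {n : ℕ} (e : ℕ) (θ : CPS C n) :
    PSeq (CPS C (n + e)) × CutFlag :=
  (.fin [C.canon (Classical.epsilon (IsExtC e θ.1))], .nocut)

/-- `RESTRC`: restriction at clause exit. -/
noncomputable def restrC {n e : ℕ} :
    PSeq (CPS C (n + e)) × CutFlag → PSeq (CPS C n) × CutFlag
  | (S, cf) => (S.map fun θ => C.canon fun i => θ.1 (Fin.castAdd e i), cf)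

/-- `RESTRG`: restriction before a call, for a literal with variables `x_{a 0}, …, x_{a (r-1)}`. -/
noncomputable def restrG {m r : ℕ} (a : Fin r ↪ Fin m) (θ : CPS C m) : CPS C r :=
  C.canon fun j => θ.1 (a j)

/-- One element of the extension of the result of a call.  Let `θ'` be `{x_j / x_{a j}θ}`.  Then
`res` is `θρσ`, where `dom σ ⊆ codom θ'`, the given element `θi` of the result of the call is
`θ'σ`, and `ρ` is a renaming that exchanges the elements `z` of `codom θ \ codom θ'` with distinct
standard variables `y z` not belonging to `codom θ ∪ codom σ`. -/
def IsExtG {m r : ℕ} (a : Fin r ↪ Fin m) (θ : PS L SV m) (θi : PS L SV r)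
    (res : PS L SV m) : Prop :=
  ∃ (θ' : PS L SV r) (Z : Set SV) (σ ρ : StdSubst L SV) (y : SV → SV),
    θ' = (fun j => θ (a j)) ∧ Z = θ.codom \ θ'.codom ∧
    σ.dom ⊆ θ'.codom ∧ θi = θ'.app σ ∧
    Set.InjOn y Z ∧ (∀ z ∈ Z, y z ∉ θ.codom ∪ σ.codom) ∧
    (∀ z ∈ Z, ρ.toFun z = .var (y z) ∧ ρ.toFun (y z) = .var z) ∧
    (∀ z, z ∉ Z → z ∉ y '' Z → ρ.toFun z = .var z) ∧
    res = (θ.app ρ).app σ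

/-- `EXTG`: extension of the result of a call.  This is a partial operation, which is meaningful
only if all elements of `S` are instances of `{x_j / x_{a j}θ}`. -/
noncomputable def extG [Nonempty SV] {m r : ℕ} (a : Fin r ↪ Fin m) (θ : CPS C m)
    (S : PSeq (CPS C r)) : PSeq (CPS C m) :=
  S.map fun θi => C.canon (Classical.epsilon (IsExtG a θ.1 θi.1))

open Classical in
/-- The sequence `<>` if `s` and `t` are not unifiable, and `⟦<θσ>⟧` with `σ ∈ mgu(s, t)`
otherwise. -/
noncomputable def unif {n : ℕ} (θ : CPS C n) (s t : L.Term SV) : PSeq (CPS C n) :=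
  if ∃ σ : StdSubst L SV, σ.IsUnifier (fun _ : Unit => s) (fun _ : Unit => t) then
    .fin [C.canon (θ.1.app (Classical.epsilon fun σ =>
      σ.IsMGU (fun _ : Unit => s) (fun _ : Unit => t)))]
  else .fin []

/-- `UNIF-VAR`. -/
noncomputable def unifVar (θ : CPS C 2) : PSeq (CPS C 2) := unif C θ (θ.1 0) (θ.1 1)

/-- `UNIF-FUNC`. -/
noncomputable def unifFunc {k : ℕ} (f : L.Functions k) (θ : CPS C (k + 1)) :
    PSeq (CPS C (k + 1)) :=
  unif C θ (θ.1 0) (.func f fun j => θ.1 j.succ)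

variable {C} in
/-- The effect of appending a literal to a prefix of a clause body (rules for `!`, for the two
kinds of equations and for procedure calls), for the concrete behavior `b`. -/
noncomputable def semLiteral [Nonempty SV] (b : Behavior C ar) {m : ℕ} :
    PSeq (CPS C m) × CutFlag → Literal L ar m → PSeq (CPS C m) × CutFlag
  | (.fin [], cf), .cut => (.fin [], cf)
  | (.inc [], cf), .cut => (.inc [], cf)
  | (.fin (θ' :: _), _), .cut => (.fin [θ'], .cut)
  | (.inc (θ' :: _), _), .cut => (.fin [θ'], .cut)
  | (.inf s, _), .cut => (.fin [s.head], .cut)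
  | (S, cf), .eqVar a => (S.bind fun θ => extG C a θ (unifVar C (restrG C a θ)), cf)
  | (S, cf), .eqFun f a => (S.bind fun θ => extG C a θ (unifFunc C f (restrG C a θ)), cf)
  | (S, cf), .call p a => (S.bind fun θ => extG C a θ (b p (restrG C a θ)), cf)

variable {C} in
/-- The output for `⟨θ, g, c⟩`, where the prefix `g` of the body of `c` is given as a list of
literals. -/
noncomputable def semPrefix [Nonempty SV] (b : Behavior C ar) {n : ℕ} (c : Clause L ar n)
    (g : List (Literal L ar (n + c.extra))) (θ : CPS C n) :
    PSeq (CPS C (n + c.extra)) × CutFlag :=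
  g.foldl (semLiteral b) (extC C c.extra θ)

variable {C} in
/-- The output for `⟨θ, c⟩`. -/
noncomputable def semClause [Nonempty SV] (b : Behavior C ar) {n : ℕ} (c : Clause L ar n)
    (θ : CPS C n) : PSeq (CPS C n) × CutFlag :=
  restrC C (semPrefix b c c.body θ)

variable {C} in
/-- The output for `⟨θ, pr⟩`, for a (suffix of a) procedure `pr`. -/
noncomputable def semProcedure [Nonempty SV] (b : Behavior C ar) {n : ℕ} :
    Procedure L ar n → CPS C n → PSeq (CPS C n)
  | .last c, θ => (semClause b c θ).1
  | .cons c pr, θ => boxCut (semClause b c θ) (semProcedure b pr θ)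

variable {C} in
/-- The concrete transformation `TCB`. -/
noncomputable def tcb [Nonempty SV] (P : Program L ar) (b : Behavior C ar) : Behavior C ar :=
  fun p θ => semProcedure b (P p) θ

variable {C} in
/-- `b` is the concrete semantics of `P`: the least concrete behavior that is a fixpoint of the
concrete transformation. -/
def IsConcreteSemantics [Nonempty SV] (P : Program L ar) (b : Behavior C ar) : Prop :=
  IsLeast {b' | IsConcreteBehavior b' ∧ b' = tcb P b'} b

end ConcreteSemantics

section OLDResolution

variable {L : FirstOrder.Language.{u, v}} {SV : Type w} {N : Type x} {ar : N → ℕ}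

/-- Addresses of the nodes of a tree: the root is `[]` and the `i`-th child of `a` is
`a ++ [i]`. -/
abbrev Addr := List ℕ

variable (L SV ar) in
/-- Literals of goals.  Each cut carries the address of its parent goal, i.e. of the node whose
selected literal was resolved with the clause in which the cut occurs. -/
inductive GoalLit : Type (max u w x)
  | call (p : N) (t : Fin (ar p) → L.Term SV)
  | eq (s t : L.Term SV)
  | cut (parent : Addr)

/-- Application of a substitution to a literal of a goal. -/
def GoalLit.app (σ : StdSubst L SV) : GoalLit L SV ar → GoalLit L SV ar
  | .call p t => .call p fun j => (t j).subst σ.toFun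
  | .eq s t => .eq (s.subst σ.toFun) (t.subst σ.toFun)
  | .cut a => .cut a

/-- The instance of a literal of a clause that is obtained by replacing the program variables with
the standard variables `y`. -/
def Literal.inst {m : ℕ} (y : Fin m ↪ SV) (parent : Addr) : Literal L ar m → GoalLit L SV ar
  | .call p a => .call p fun j => .var (y (a j))
  | .eqVar a => .eq (.var (y (a 0))) (.var (y (a 1)))
  | .eqFun f a => .eq (.var (y (a 0))) (.func f fun j => .var (y (a j.succ)))
  | .cut => .cut parent

variable (L SV ar) in
/-- Labels of the nodes of an OLD-tree: the goal, the composition of the most general unifiers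
used so far, and the set of the standard variables that appear in the derivation so far (in
goals, renamed clauses, and unifiers). -/
structure Node : Type (max u w x) where
  goal : List (GoalLit L SV ar)
  subst : StdSubst L SV
  used : Set SV

/-- `Child P a ν i ν'`: the node `ν` at address `a` may have `ν'` as its `i`-th child.
The selected literal is the leftmost one.
* A cut succeeds.
* An equation is resolved by a most general unifier of its two sides.
* A procedure call is resolved with the `i`-th clause of the procedure, the variables of which are
  replaced with distinct standard variables that do not appear in the derivation so far. -/
inductive Child (P : Program L ar) (a : Addr) :
    Node L SV ar → ℕ → Node L SV ar → Prop
  | cut (b : Addr) (G : List (GoalLit L SV ar)) (σ : StdSubst L SV) (U : Set SV) :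
      Child P a ⟨.cut b :: G, σ, U⟩ 0 ⟨G, σ, U⟩
  | eq (s t : L.Term SV) (G : List (GoalLit L SV ar)) (σ μ : StdSubst L SV) (U : Set SV)
      (hμ : μ.IsMGU (fun _ : Unit => s) (fun _ : Unit => t)) :
      Child P a ⟨.eq s t :: G, σ, U⟩ 0
        ⟨G.map (GoalLit.app μ), σ.comp μ, U ∪ μ.dom ∪ μ.codom⟩
  | call (p : N) (t : Fin (ar p) → L.Term SV) (G : List (GoalLit L SV ar))
      (σ μ : StdSubst L SV) (U : Set SV) (i : ℕ) (c : Clause L ar (ar p))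
      (hc : (P p).clauses[i]? = some c) (y : Fin (ar p + c.extra) ↪ SV) (hy : ∀ j, y j ∉ U)
      (hμ : μ.IsMGU t fun j => .var (y (Fin.castAdd c.extra j))) :
      Child P a ⟨.call p t :: G, σ, U⟩ i
        ⟨(c.body.map (Literal.inst y a) ++ G).map (GoalLit.app μ), σ.comp μ,
          U ∪ Set.range y ∪ μ.dom ∪ μ.codom⟩

/-- `T`, which maps each address to the label of the node at this address, if there is one, is an
OLD-tree of the program `P` for the query `p(t₁, …, tₙ)`: every node has an `i`-th child whenever
its selected literal can be resolved in the `i`-th way.  The choices of most general unifiers and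
of renamed clauses are arbitrary. -/
structure IsOLDTree (P : Program L ar) (p : N) (t : PS L SV (ar p))
    (T : Addr → Option (Node L SV ar)) : Prop where
  root : T [] = some ⟨[.call p t], .id, t.codom⟩
  outside : ∀ a i, T a = none → T (a ++ [i]) = none
  child : ∀ a i ν ν', T a = some ν → T (a ++ [i]) = some ν' → Child P a ν i ν'
  complete : ∀ a i ν ν', T a = some ν → Child P a ν i ν' → (T (a ++ [i])).isSome

/-- The number of ways in which the selected literal of a goal may possibly be resolved. -/
def degree (P : Program L ar) : List (GoalLit L SV ar) → ℕ
  | [] => 0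
  | .call p _ :: _ => (P p).clauses.length
  | .eq _ _ :: _ => 1
  | .cut _ :: _ => 1

/-- The addresses of the children of the node at `a` with the goal `G`, from left to right. -/
def children (P : Program L ar) (T : Addr → Option (Node L SV ar)) (a : Addr)
    (G : List (GoalLit L SV ar)) : List Addr :=
  ((List.range (degree P G)).map fun i => a ++ [i]).filter fun a' => (T a').isSome

/-- One step of the depth-first left-to-right traversal of the tree `T`.  The state consists of the
addresses of the nodes that remain to be visited (those which are the roots of the unvisited
subtrees, from left to right), and of the computed answer substitutions (restricted to the set
`V` of the variables of the query) found so far.  When a cut is reached, all unvisited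
subtrees below its parent goal, except the one below the cut itself, are pruned. -/
noncomputable def visit (P : Program L ar) (T : Addr → Option (Node L SV ar)) (V : Set SV) :
    List Addr × List (StdSubst L SV) → List Addr × List (StdSubst L SV)
  | ([], out) => ([], out)
  | (a :: rest, out) =>
    match T a with
    | none => (rest, out)
    | some ν =>
      match ν.goal with
      | [] => (rest, out ++ [ν.subst.restrict V])
      | .cut b :: _ => (children P T a ν.goal ++ rest.filter fun a' => ¬ b <+: a', out)
      | _ => (children P T a ν.goal ++ rest, out)

/-- The state of the traversal of `T` after `k` steps. -/
noncomputable def traversal (P : Program L ar) (T : Addr → Option (Node L SV ar)) (V : Set SV)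
    (k : ℕ) : List Addr × List (StdSubst L SV) :=
  (visit P T V)^[k] ([[]], [])

/-- The sequence of the computed answer substitutions found by the traversal of `T` is `S`.  It is
finite if the traversal terminates.  If the traversal does not terminate, it is infinite or
incomplete, according to whether the number of answers is infinite or finite. -/
def IsAnswerSeq (P : Program L ar) (T : Addr → Option (Node L SV ar)) (V : Set SV) :
    PSeq (StdSubst L SV) → Prop
  | .fin l => ∃ k, traversal P T V k = ([], l)
  | .inc l => (∀ k, (traversal P T V k).1 ≠ []) ∧ ∃ k₀, ∀ k ≥ k₀, (traversal P T V k).2 = l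
  | .inf s => ∀ n, ∃ k, (traversal P T V k).2 = s.take n

/-- `S` is a sequence of computed answer substitutions of the query `p(t₁, …, tₙ)` according to
OLD-resolution with cut. -/
def IsOLDAnswerSeq (P : Program L ar) (p : N) (t : PS L SV (ar p)) (S : PSeq (StdSubst L SV)) :
    Prop :=
  ∃ T, IsOLDTree P p t T ∧ IsAnswerSeq P T t.codom S

end OLDResolution

end PrologCut

/-! The proof compares the Kleene approximations of the concrete semantics with the stages of the
traversal of an arbitrary OLD-tree.

Existence. Every increasing sequence of lazy sequences has a limit in a strong sense (`Lim`: each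
compact part of the limit is eventually reached), and all ingredients of `tcb` preserve such limits.
Hence the limit `semantics P` of the iterates `approx P n` of `tcb P` from the everywhere-⊥ behavior
is the least fixpoint. All values of `approx P n` are finite or incomplete.

Independence of choices. Canonical program substitutions are partially ordered by "is an instance
of"; antisymmetry holds because mutual instances are variants. Clause entry, extension after a call
and unification are least elements of suitable sets in this order (`CPS.IsUp`, `CPS.IsExt`,
`CPS.IsSol`), so they do not depend on fresh variables, renamings or unifiers. It also follows that
running a clause body on the restricted substitution and then extending the result amounts to
running the body in the context of the caller (`extG_semClause`). OLD-resolution does the latter.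

Soundness for every tree. A node is represented by a program substitution and a list of literals
with the addresses of their cut parents (`Rep`). The work that remains after a literal is a
continuation `K` from program substitutions to outcomes: finished with given answers and possibly a
pruning signal, or still running after at least `n` steps. Induction on `n`, and on clause bodies
inside it, shows that the subtree of a node behaves as `approx P n` followed by `K` predicts
(`Sat.body`, `Sat.call`). For the query, `approx P n` is therefore the image of the answers found at
some stage `j ≥ n` of the traversal. The two limits coincide (`IsOLDTree.semantics_eq`).

Completeness. Let `S` have the right image and the right domains. In any tree, the answers differ
from the elements of `S` by one renaming each, up to variables outside the query. A most general
unifier followed by a renaming is again most general, and only cuts are selected after the last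
unifier of a successful branch, so that unifier can absorb the renaming without changing any goal
(`exists_modified_tree`). No node is visited twice, so the renaming wanted at a leaf is well
defined. The traversal of the modified tree runs in parallel and yields `S` itself
(`isOLDAnswerSeq_of_map_eq`). -/

namespace PrologCut

/-! ### Order, limits and continuity of the operations on lazy sequences. -/

namespace PSeq

variable {α β : Type*}

theorem concat_nil (S : PSeq α) : concat [] S = S := by
  cases S <;> simp [concat]

theorem inc_le_iff {l : List α} {S : PSeq α} : inc l ≤ S ↔ ∃ S', S = concat l S' := by
  constructor
  · rintro (rfl | ⟨l', S', h, rfl⟩)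
    · exact ⟨inc [], by simp [concat]⟩
    · simp only [concat, List.append_nil, inc.injEq] at h
      exact ⟨S', by rw [h]⟩
  · rintro ⟨S', rfl⟩
    exact Or.inr ⟨l, S', by simp [concat], rfl⟩

theorem eq_of_fin_le {l : List α} {S : PSeq α} (h : fin l ≤ S) : S = fin l := by
  rcases h with rfl | ⟨l', S', h, rfl⟩
  · rfl
  · simp [concat] at h

theorem eq_of_inf_le {s : Stream' α} {S : PSeq α} (h : inf s ≤ S) : S = inf s := by
  rcases h with rfl | ⟨l', S', h, rfl⟩
  · rfl
  · simp [concat] at h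

theorem inc_le_fin {l l' : List α} : inc l ≤ fin l' ↔ l <+: l' := by
  rw [inc_le_iff]
  constructor
  · rintro ⟨S', h⟩
    cases S' <;> simp only [concat, fin.injEq, reduceCtorEq] at h
    exact ⟨_, h.symm⟩
  · rintro ⟨m, rfl⟩
    exact ⟨fin m, rfl⟩

theorem inc_le_inc {l l' : List α} : inc l ≤ inc l' ↔ l <+: l' := by
  rw [inc_le_iff]
  constructor
  · rintro ⟨S', h⟩
    cases S' <;> simp only [concat, inc.injEq, reduceCtorEq] at h
    exact ⟨_, h.symm⟩
  · rintro ⟨m, rfl⟩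
    exact ⟨inc m, rfl⟩

theorem take_appendStream (l : List α) (s : Stream' α) :
    (Stream'.appendStream' l s).take l.length = l := by
  induction l with
  | nil => rfl
  | cons a l ih => simp [Stream'.cons_append_stream, ih]

theorem inc_le_inf {l : List α} {s : Stream' α} : inc l ≤ inf s ↔ s.take l.length = l := by
  rw [inc_le_iff]
  constructor
  · rintro ⟨S', h⟩
    cases S' <;> simp only [concat, inf.injEq, reduceCtorEq] at h
    rw [h, take_appendStream]
  · intro h
    refine ⟨inf (s.drop l.length), ?_⟩
    rw [concat, ← h, Stream'.length_take, Stream'.append_take_drop]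

theorem inc_take_le (s : Stream' α) (n : ℕ) : inc (s.take n) ≤ inf s := by
  rw [inc_le_inf, Stream'.length_take]

theorem inc_nil_le (S : PSeq α) : inc [] ≤ S := inc_le_iff.2 ⟨S, (concat_nil S).symm⟩

theorem take_prefix_take (s : Stream' α) {m n : ℕ} (h : m ≤ n) : s.take m <+: s.take n := by
  have : s.take m = (s.take n).take m := by rw [Stream'.take_take, min_eq_right h]
  rw [this]
  exact List.take_prefix _ _

/-- The finite and the incomplete sequences. -/
def IsCompact : PSeq α → Prop
  | inf _ => False
  | _ => True

/-- An infinite sequence is determined by its incomplete prefixes, and their unbounded lengths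
exclude any finite or incomplete upper bound. -/
theorem le_of_compact_le {S S' : PSeq α} (h : ∀ X : PSeq α, X.IsCompact → X ≤ S → X ≤ S') :
    S ≤ S' := by
  cases S with
  | fin l => exact h _ trivial le_rfl
  | inc l => exact h _ trivial le_rfl
  | inf s =>
    have h' : ∀ n, inc (s.take n) ≤ S' := fun n => h _ trivial (inc_take_le s n)
    cases S' with
    | fin l =>
      have := (inc_le_fin.1 (h' (l.length + 1))).length_le
      simp at this
    | inc l =>
      have := (inc_le_inc.1 (h' (l.length + 1))).length_le
      simp at this
    | inf s' =>
      have : s = s' := Stream'.take_theorem _ _ fun n => by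
        simpa using (inc_le_inf.1 (h' n)).symm
      rw [this]

/-- `S` is the limit of `c`: an upper bound, the compact approximations of which are eventually
below `c`. -/
def Lim (c : ℕ → PSeq α) (S : PSeq α) : Prop :=
  (∀ n, c n ≤ S) ∧ ∀ X : PSeq α, X.IsCompact → X ≤ S → ∃ n₀, ∀ n ≥ n₀, X ≤ c n

theorem Lim.isLUB {c : ℕ → PSeq α} {S : PSeq α} (h : Lim c S) : IsLUB (Set.range c) S := by
  refine ⟨by rintro _ ⟨n, rfl⟩; exact h.1 n, fun S' hS' => le_of_compact_le fun X hX hXS => ?_⟩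
  obtain ⟨n, hn⟩ := h.2 X hX hXS
  exact (hn n le_rfl).trans (hS' ⟨n, rfl⟩)

theorem Lim.unique {c : ℕ → PSeq α} {S S' : PSeq α} (h : Lim c S) (h' : Lim c S') : S = S' :=
  h.isLUB.unique h'.isLUB

theorem Lim.const (S : PSeq α) : Lim (fun _ => S) S :=
  ⟨fun _ => le_rfl, fun _ _ h => ⟨0, fun _ _ => h⟩⟩

theorem Lim.succ {c : ℕ → PSeq α} {S : PSeq α} (h : Lim c S) : Lim (fun n => c (n + 1)) S :=
  ⟨fun n => h.1 _, fun X hX hXS => (h.2 X hX hXS).imp fun _ hn n hn' => hn _ (by omega)⟩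

/-- A chain that never stabilises contains neither finite nor infinite sequences, since these are
maximal. So it consists of incomplete sequences of unbounded length, which glue to a stream. -/
theorem exists_lim {c : ℕ → PSeq α} (hc : Monotone c) : ∃ S, Lim c S := by
  have of_mem : ∀ n, (∀ m, c m ≤ c n) → ∃ S, Lim c S := fun n h =>
    ⟨c n, h, fun X _ hXS => ⟨n, fun m hm => hXS.trans (hc hm)⟩⟩
  by_cases h : ∃ n, ∀ m ≥ n, c m = c n
  · obtain ⟨n, hn⟩ := h
    refine of_mem n fun m => ?_
    rcases le_total m n with h | h
    · exact hc h
    · exact (hn m h).le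
  · push Not at h
    have hinc : ∀ n, ∃ l, c n = inc l := fun n => by
      obtain ⟨m, hm, hne⟩ := h n
      have := hc hm
      cases hcn : c n with
      | inc l => exact ⟨l, rfl⟩
      | fin l => rw [hcn] at this hne; exact absurd (eq_of_fin_le this) hne
      | inf l => rw [hcn] at this hne; exact absurd (eq_of_inf_le this) hne
    choose l hl using hinc
    have hpre : ∀ {m n}, m ≤ n → l m <+: l n := fun {m n} hmn => by
      have := hc hmn
      rwa [hl, hl, inc_le_inc] at this
    have hunb : ∀ k, ∃ n, k ≤ (l n).length := fun k => by
      induction k with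
      | zero => exact ⟨0, Nat.zero_le _⟩
      | succ k ih =>
        obtain ⟨n, hn⟩ := ih
        obtain ⟨m, hm, hne⟩ := h n
        refine ⟨m, lt_of_le_of_lt hn ?_⟩
        refine lt_of_le_of_ne (hpre hm).length_le fun he => hne ?_
        rw [hl, hl, (hpre hm).eq_of_length he]
    choose k hk using hunb
    have hne : ∀ i, i < (l (k (i + 1))).length := fun i => hk (i + 1)
    -- Entry `i` is read from `l (k (i + 1))`, which has at least `i + 1` elements; by the prefix
    -- relation any other long enough list has the same entry.
    let s : Stream' α := fun i => (l (k (i + 1)))[i]'(hne i)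
    have hs : ∀ n i (hi : i < (l n).length), (l n)[i] = s.get i := fun n i hi => by
      rcases le_total n (k (i + 1)) with h | h
      · exact (hpre h).getElem hi
      · exact ((hpre h).getElem (hne i)).symm
    have htake : ∀ n, s.take (l n).length = l n := fun n => by
      refine List.ext_getElem? fun i => ?_
      rcases lt_or_ge i (l n).length with hi | hi
      · rw [Stream'.getElem?_take hi, List.getElem?_eq_getElem hi, hs]
      · rw [List.getElem?_eq_none (by simpa using hi), List.getElem?_eq_none hi]
    refine ⟨inf s, fun n => by rw [hl, inc_le_inf, htake], fun X hX hXS => ?_⟩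
    cases X with
    | fin m => cases eq_of_fin_le hXS
    | inf m => exact hX.elim
    | inc m =>
      refine ⟨k m.length, fun n hn => ?_⟩
      rw [hl, inc_le_inc, ← inc_le_inf.1 hXS, ← htake n]
      exact take_prefix_take s ((hk _).trans (hpre hn).length_le)

/-- On chains, the default branch of `lub` is never taken. -/
theorem lim_lub {c : ℕ → PSeq α} (hc : Monotone c) : Lim c (lub c) := by
  obtain ⟨S, hS⟩ := exists_lim hc
  have h : ∃ S, IsLUB (Set.range c) S := ⟨S, hS.isLUB⟩
  have : lub c = S := by
    rw [lub, dif_pos h]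
    exact h.choose_spec.unique hS.isLUB
  rwa [this]

theorem concat_mono (l : List α) {S S' : PSeq α} (h : S ≤ S') : concat l S ≤ concat l S' := by
  rcases h with rfl | ⟨m, T, rfl, rfl⟩
  · exact le_rfl
  · exact Or.inr ⟨l ++ m, T, concat_concat _ _ _, concat_concat _ _ _⟩

theorem box_mono {A A' B B' : PSeq α} (hA : A ≤ A') (hB : B ≤ B') : A.box B ≤ A'.box B' := by
  cases A with
  | fin l => rw [eq_of_fin_le hA]; exact concat_mono l hB
  | inf s => rw [eq_of_inf_le hA]; exact le_rfl
  | inc l =>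
    obtain ⟨S', rfl⟩ := inc_le_iff.1 hA
    cases S' with
    | fin m =>
      change inc l ≤ concat (l ++ m) B'
      rw [← concat_concat]
      exact inc_le_iff.2 ⟨_, rfl⟩
    | inc m => exact hA
    | inf m => exact hA

theorem box_assoc (A B D : PSeq α) : (A.box B).box D = A.box (B.box D) := by
  cases A with
  | fin l =>
    cases B with
    | fin m => exact (concat_concat l m D).symm
    | inc m => rfl
    | inf m => rfl
  | inc l => rfl
  | inf s => rfl

theorem fin_nil_box (A : PSeq α) : (fin []).box A = A := concat_nil A

theorem box_fin_nil (A : PSeq α) : A.box (fin []) = A := by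
  cases A <;> simp [box, concat]

theorem foldl_box (A : PSeq α) (Ss : List (PSeq α)) :
    Ss.foldl box A = A.box (Ss.foldl box (fin [])) := by
  induction Ss generalizing A with
  | nil => exact (box_fin_nil A).symm
  | cons S Ss ih =>
    rw [List.foldl_cons, List.foldl_cons, ih, fin_nil_box, ih S, box_assoc]

theorem fin_nil_bind (F : α → PSeq β) : (fin []).bind F = fin [] := rfl

theorem fin_cons_bind (a : α) (l : List α) (F : α → PSeq β) :
    (fin (a :: l)).bind F = (F a).box ((fin l).bind F) := by
  change (l.map F).foldl box ((fin []).box (F a)) = _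
  rw [foldl_box, fin_nil_box]
  rfl

theorem inc_bind (l : List α) (F : α → PSeq β) :
    (inc l).bind F = ((fin l).bind F).box (inc []) := rfl

theorem concat_bind (l : List α) (S : PSeq α) (hS : S.IsCompact) (F : α → PSeq β) :
    (concat l S).bind F = ((fin l).bind F).box (S.bind F) := by
  have key : ∀ l', (fin (l ++ l')).bind F = ((fin l).bind F).box ((fin l').bind F) := fun l' => by
    induction l with
    | nil => exact (fin_nil_box _).symm
    | cons a l ih => rw [List.cons_append, fin_cons_bind, fin_cons_bind, ih, box_assoc]
  cases S with
  | fin m => exact key m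
  | inc m => exact (congrArg (box · (inc [])) (key m)).trans (box_assoc _ _ _)
  | inf _ => exact hS.elim

theorem boxN_eq (s : Stream' α) (F : α → PSeq β) (n : ℕ) :
    boxN (fun k => F (s.get k)) n = (fin (s.take n)).bind F := by
  induction n with
  | zero => rfl
  | succ n ih =>
    rw [Stream'.take_succ']
    change (boxN (fun k => F (s.get k)) n).box (F (s.get n)) = _
    rw [ih]
    change _ = (concat (s.take n) (fin [s.get n])).bind F
    rw [concat_bind _ (fin _) trivial, fin_cons_bind, fin_nil_bind, box_fin_nil]

theorem inc_bind_mono_left {l l' : List α} (h : l <+: l') (F : α → PSeq β) :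
    (inc l).bind F ≤ (inc l').bind F := by
  obtain ⟨m, rfl⟩ := h
  change _ ≤ (concat l (inc m)).bind F
  rw [concat_bind _ (inc m) trivial]
  exact box_mono le_rfl (inc_nil_le _)

/-- The partial products in `boxInf` are the binds of the incomplete prefixes of `s`, so questions
about infinite arguments reduce to incomplete ones. -/
theorem inf_bind (s : Stream' α) (F : α → PSeq β) :
    Lim (fun n => (inc (s.take n)).bind F) ((inf s).bind F) := by
  have h : (fun i => box (boxN (fun k => F (s.get k)) i) (inc [])) =
      fun n => (inc (s.take n)).bind F := funext fun n => by rw [boxN_eq, inc_bind]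
  have hb : (inf s).bind F = lub fun n => (inc (s.take n)).bind F := by
    rw [← h]; rfl
  rw [hb]
  exact lim_lub fun m n hmn => inc_bind_mono_left (take_prefix_take s hmn) F

theorem bind_mono_left {S S' : PSeq α} (h : S ≤ S') (F : α → PSeq β) :
    S.bind F ≤ S'.bind F := by
  cases S with
  | fin l => rw [eq_of_fin_le h]
  | inf s => rw [eq_of_inf_le h]
  | inc l =>
    cases S' with
    | fin l' =>
      obtain ⟨m, rfl⟩ := inc_le_fin.1 h
      change _ ≤ (concat l (fin m)).bind F
      rw [concat_bind _ (fin m) trivial]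
      exact box_mono le_rfl (inc_nil_le _)
    | inc l' => exact inc_bind_mono_left (inc_le_inc.1 h) F
    | inf s =>
      rw [← inc_le_inf.1 h]
      exact (inf_bind s F).1 l.length

theorem fin_bind_mono (l : List α) {F F' : α → PSeq β} (h : ∀ a, F a ≤ F' a) :
    (fin l).bind F ≤ (fin l).bind F' := by
  induction l with
  | nil => exact le_rfl
  | cons a l ih => rw [fin_cons_bind, fin_cons_bind]; exact box_mono (h a) ih

theorem bind_mono {S S' : PSeq α} (hS : S ≤ S') {F F' : α → PSeq β} (h : ∀ a, F a ≤ F' a) :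
    S.bind F ≤ S'.bind F' := by
  refine (bind_mono_left hS F).trans ?_
  have hinc : ∀ l, (inc l).bind F ≤ (inc l).bind F' := fun l =>
    box_mono (fin_bind_mono l h) le_rfl
  cases S' with
  | fin l => exact fin_bind_mono l h
  | inc l => exact hinc l
  | inf s =>
    refine (inf_bind s F).isLUB.2 ?_
    rintro _ ⟨n, rfl⟩
    exact (hinc _).trans ((inf_bind s F').1 n)

theorem map_mono {S S' : PSeq α} (hS : S ≤ S') (f : α → β) : S.map f ≤ S'.map f := by
  cases S with
  | fin l => rw [eq_of_fin_le hS]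
  | inf s => rw [eq_of_inf_le hS]
  | inc l =>
    cases S' with
    | fin l' => exact inc_le_fin.2 ((inc_le_fin.1 hS).map f)
    | inc l' => exact inc_le_inc.2 ((inc_le_inc.1 hS).map f)
    | inf s =>
      rw [← inc_le_inf.1 hS]
      refine inc_le_inf.2 ?_
      rw [List.length_map, Stream'.length_take]
      refine List.ext_getElem? fun i => ?_
      rcases lt_or_ge i l.length with hi | hi
      · rw [Stream'.getElem?_take hi, List.getElem?_map, Stream'.getElem?_take hi]; rfl
      · rw [List.getElem?_eq_none (by simpa using hi), List.getElem?_eq_none (by simpa using hi)]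

/-- A compact part of the output needs only a compact part of the input. This is the form of
continuity used for `concat`, `map` and `bind`. -/
theorem exists_compact_le_concat {l : List α} {S X : PSeq α} (hX : X.IsCompact)
    (h : X ≤ concat l S) : ∃ Y : PSeq α, Y.IsCompact ∧ Y ≤ S ∧ X ≤ concat l Y := by
  cases S with
  | fin m => exact ⟨fin m, trivial, le_rfl, h⟩
  | inc m => exact ⟨inc m, trivial, le_rfl, h⟩
  | inf s =>
    cases X with
    | fin m => cases eq_of_fin_le h
    | inf m => exact hX.elim
    | inc m =>
      refine ⟨inc (s.take m.length), trivial, inc_take_le _ _, ?_⟩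
      have h₁ : inc (l ++ s.take m.length) ≤ inf (Stream'.appendStream' l s) :=
        concat_mono l (inc_take_le s m.length)
      rw [inc_le_inf] at h₁
      change inc m ≤ inc (l ++ s.take m.length)
      rw [inc_le_inc, ← h₁]
      have h₂ := inc_le_inf.1 h
      rw [← h₂]
      exact take_prefix_take _ (by simp)

theorem exists_compact_le_map {f : α → β} {S : PSeq α} {X : PSeq β} (hX : X.IsCompact)
    (h : X ≤ S.map f) : ∃ Y : PSeq α, Y.IsCompact ∧ Y ≤ S ∧ X ≤ Y.map f := by
  cases S with
  | fin m => exact ⟨fin m, trivial, le_rfl, h⟩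
  | inc m => exact ⟨inc m, trivial, le_rfl, h⟩
  | inf s =>
    cases X with
    | fin m => cases eq_of_fin_le h
    | inf m => exact hX.elim
    | inc m =>
      refine ⟨inc (s.take m.length), trivial, inc_take_le _ _, ?_⟩
      have h₁ := map_mono (inc_take_le s m.length) f
      rw [map, map, inc_le_inf, List.length_map, Stream'.length_take] at h₁
      rw [map, inc_le_inc, ← h₁, inc_le_inf.1 h]

theorem exists_compact_le_bind {F : α → PSeq β} {S : PSeq α} {X : PSeq β} (hX : X.IsCompact)
    (h : X ≤ S.bind F) : ∃ Y : PSeq α, Y.IsCompact ∧ Y ≤ S ∧ X ≤ Y.bind F := by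
  cases S with
  | fin m => exact ⟨fin m, trivial, le_rfl, h⟩
  | inc m => exact ⟨inc m, trivial, le_rfl, h⟩
  | inf s =>
    obtain ⟨n, hn⟩ := (inf_bind s F).2 X hX h
    exact ⟨inc (s.take n), trivial, inc_take_le _ _, hn n le_rfl⟩

/-- If the first limit is not finite, then no approximation of it is finite, and all second operands
are ignored. If it is finite, the approximations eventually equal it, being maximal. -/
theorem Lim.box {A : ℕ → PSeq α} {A' : PSeq α} {B : ℕ → PSeq α} {B' : PSeq α} (hA : Lim A A')
    (hB : Lim B B') : Lim (fun n => (A n).box (B n)) (A'.box B') := by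
  refine ⟨fun n => box_mono (hA.1 n) (hB.1 n), fun X hX hXS => ?_⟩
  have key : (∀ l, A' ≠ fin l) → ∃ n₀, ∀ n ≥ n₀, X ≤ (A n).box (B n) := fun hA' => by
    have h₁ : A'.box B' = A' := by
      cases A' with
      | fin l => exact (hA' l rfl).elim
      | inc l => rfl
      | inf l => rfl
    rw [h₁] at hXS
    refine (hA.2 X hX hXS).imp fun n₀ h n hn => ?_
    have h₂ : (A n).box (B n) = A n := by
      cases hAn : A n with
      | fin l => exact (hA' l (eq_of_fin_le (hAn ▸ hA.1 n))).elim
      | inc l => rfl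
      | inf l => rfl
    rw [h₂]
    exact h n hn
  cases A' with
  | inc l => exact key (by simp)
  | inf s => exact key (by simp)
  | fin l =>
    obtain ⟨Y, hY, hYB, hXY⟩ := exists_compact_le_concat hX hXS
    obtain ⟨n₁, h₁⟩ := hA.2 (fin l) trivial le_rfl
    obtain ⟨n₂, h₂⟩ := hB.2 Y hY hYB
    refine ⟨max n₁ n₂, fun n hn => ?_⟩
    change X ≤ (A n).box (B n)
    rw [eq_of_fin_le (h₁ n (by omega))]
    exact hXY.trans (concat_mono l (h₂ n (by omega)))

theorem Lim.map {A : ℕ → PSeq α} {A' : PSeq α} (hA : Lim A A') (f : α → β) :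
    Lim (fun n => (A n).map f) (A'.map f) := by
  refine ⟨fun n => map_mono (hA.1 n) f, fun X hX hXS => ?_⟩
  obtain ⟨Y, hY, hYA, hXY⟩ := exists_compact_le_map hX hXS
  exact (hA.2 Y hY hYA).imp fun n₀ h n hn => hXY.trans (map_mono (h n hn) f)

/-- A compact part of the result comes from a compact `Y ≤ S'`; over `Y` the bind is a finite
product, and `Lim.box` applies. -/
theorem Lim.bind {S : ℕ → PSeq α} {S' : PSeq α} (hS : Lim S S') {F : ℕ → α → PSeq β}
    {F' : α → PSeq β} (hF : ∀ a, Lim (fun n => F n a) (F' a)) :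
    Lim (fun n => (S n).bind (F n)) (S'.bind F') := by
  refine ⟨fun n => bind_mono (hS.1 n) fun a => (hF a).1 n, fun X hX hXS => ?_⟩
  obtain ⟨Y, hY, hYS, hXY⟩ := exists_compact_le_bind hX hXS
  obtain ⟨n₁, h₁⟩ := hS.2 Y hY hYS
  have hfin : ∀ l : List α, Lim (fun n => (fin l).bind (F n)) ((fin l).bind F') := fun l => by
    induction l with
    | nil => exact Lim.const _
    | cons a l ih => simp only [fin_cons_bind]; exact (hF a).box ih
  have hlim : Lim (fun n => Y.bind (F n)) (Y.bind F') := by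
    cases Y with
    | fin l => exact hfin l
    | inc l => exact (hfin l).box (Lim.const (inc []))
    | inf s => exact hY.elim
  obtain ⟨n₂, h₂⟩ := hlim.2 X hX hXY
  exact ⟨max n₁ n₂, fun n hn => (h₂ n (by omega)).trans (bind_mono_left (h₁ n (by omega)) _)⟩

end PSeq

end PrologCut

namespace PrologCut

/-! ### Substitutions, finite supports and variants. -/

section Terms

variable {L : FirstOrder.Language.{u, v}} {SV : Type w}

open FirstOrder.Language (Term)

@[simp]
theorem mem_tvars_var {x y : SV} : y ∈ tvars (L := L) (.var x) ↔ y = x := by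
  simp [tvars, Term.varFinset]

@[simp]
theorem mem_tvars_func {k : ℕ} {f : L.Functions k} {ts : Fin k → L.Term SV} {y : SV} :
    y ∈ tvars (.func f ts) ↔ ∃ i, y ∈ tvars (ts i) := by
  simp [tvars, Term.varFinset]

theorem finite_tvars (t : L.Term SV) : (tvars t).Finite := by
  let := Classical.decEq SV
  exact t.varFinset.finite_toSet

theorem subst_eq_subst_iff {t : L.Term SV} {f g : SV → L.Term SV} :
    t.subst f = t.subst g ↔ ∀ y ∈ tvars t, f y = g y := by
  induction t with
  | var x => simp [Term.subst]
  | func F ts ih =>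
    simp only [Term.subst, Term.func.injEq, heq_eq_eq, true_and, mem_tvars_func]
    constructor
    · rintro h y ⟨i, hi⟩
      exact (ih i).1 (congrFun h i) y hi
    · exact fun h => funext fun i => (ih i).2 fun y hy => h y ⟨i, hy⟩

theorem mem_tvars_subst {t : L.Term SV} {f : SV → L.Term SV} {y : SV} :
    y ∈ tvars (t.subst f) ↔ ∃ x ∈ tvars t, y ∈ tvars (f x) := by
  induction t with
  | var x => simp [Term.subst]
  | func F ts ih =>
    simp only [Term.subst, mem_tvars_func, ih]
    constructor
    · rintro ⟨i, x, hx, h⟩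
      exact ⟨x, ⟨i, hx⟩, h⟩
    · rintro ⟨x, ⟨i, hx⟩, h⟩
      exact ⟨i, x, hx, h⟩

namespace PS

variable {n m : ℕ}

theorem mem_codom {θ : PS L SV n} {y : SV} : y ∈ θ.codom ↔ ∃ i, y ∈ tvars (θ i) := by
  simp [codom]

theorem finite_codom (θ : PS L SV n) : θ.codom.Finite :=
  Set.finite_iUnion fun i => finite_tvars (θ i)

/-- The application of an arbitrary map from variables to terms. -/
def sub (θ : PS L SV n) (f : SV → L.Term SV) : PS L SV n := fun i => (θ i).subst f

theorem app_eq_sub (θ : PS L SV n) (σ : StdSubst L SV) : θ.app σ = θ.sub σ.toFun := rfl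

theorem sub_sub (θ : PS L SV n) (f g : SV → L.Term SV) :
    (θ.sub f).sub g = θ.sub fun y => (f y).subst g :=
  funext fun i => subst_subst (θ i) f g

theorem sub_var (θ : PS L SV n) : θ.sub .var = θ := funext fun i => subst_var (θ i)

theorem sub_eq_sub_iff {θ : PS L SV n} {f g : SV → L.Term SV} :
    θ.sub f = θ.sub g ↔ ∀ y ∈ θ.codom, f y = g y := by
  constructor
  · intro h y hy
    obtain ⟨i, hi⟩ := mem_codom.1 hy
    exact subst_eq_subst_iff.1 (congrFun h i) y hi
  · exact fun h => funext fun i => subst_eq_subst_iff.2 fun y hy => h y (mem_codom.2 ⟨i, hy⟩)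

theorem mem_codom_sub {θ : PS L SV n} {f : SV → L.Term SV} {y : SV} :
    y ∈ (θ.sub f).codom ↔ ∃ x ∈ θ.codom, y ∈ tvars (f x) := by
  simp only [mem_codom, sub, mem_tvars_subst]
  constructor
  · rintro ⟨i, x, hx, h⟩
    exact ⟨x, ⟨i, hx⟩, h⟩
  · rintro ⟨x, ⟨i, hx⟩, h⟩
    exact ⟨i, x, hx, h⟩

theorem codom_comp_subset (θ : PS L SV n) (e : Fin m → Fin n) :
    PS.codom (fun j => θ (e j)) ⊆ θ.codom := fun y hy => by
  obtain ⟨j, hj⟩ := mem_codom.1 hy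
  exact mem_codom.2 ⟨e j, hj⟩

end PS

open Classical in
/-- The standard substitution that agrees with `f` on a finite set. -/
noncomputable def StdSubst.ofFun (f : SV → L.Term SV) {V : Set SV} (hV : V.Finite) :
    StdSubst L SV where
  toFun y := if y ∈ V then f y else .var y
  finite_dom := hV.subset fun y hy => by
    by_contra h
    exact hy (if_neg h)

theorem StdSubst.ofFun_apply {f : SV → L.Term SV} {V : Set SV} (hV : V.Finite) {y : SV}
    (hy : y ∈ V) : (StdSubst.ofFun f hV).toFun y = f y := if_pos hy

theorem StdSubst.dom_ofFun (f : SV → L.Term SV) {V : Set SV} (hV : V.Finite) :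
    (StdSubst.ofFun f hV).dom ⊆ V := fun y hy => by
  by_contra h
  exact hy (if_neg h)

theorem StdSubst.ext {σ τ : StdSubst L SV} (h : ∀ y, σ.toFun y = τ.toFun y) : σ = τ := by
  cases σ; cases τ
  congr
  exact funext h

namespace PS

variable {n m : ℕ}

theorem app_ofFun (θ : PS L SV n) (f : SV → L.Term SV) {V : Set SV} (hV : V.Finite)
    (h : θ.codom ⊆ V) : θ.app (StdSubst.ofFun f hV) = θ.sub f :=
  sub_eq_sub_iff.2 fun _ hy => StdSubst.ofFun_apply hV (h hy)

/-- Since `θ` contains finitely many variables, arbitrary maps to terms can replace standard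
substitutions when instances are discussed. -/
theorem exists_app_eq (θ : PS L SV n) (f : SV → L.Term SV) :
    ∃ σ : StdSubst L SV, θ.app σ = θ.sub f :=
  ⟨_, app_ofFun θ f θ.finite_codom subset_rfl⟩

end PS

/-- Inside the finite set `V ∪ r '' V`, the bijection from `V` onto its image extends to a
permutation; outside that set the identity is used. -/
theorem exists_perm_of_injOn {r : SV → SV} {V : Set SV} (hV : V.Finite) (hr : Set.InjOn r V) :
    ∃ e : Equiv.Perm SV, (∀ y ∈ V, e y = r y) ∧ {y | e y ≠ y}.Finite := by
  classical
  let W : Set SV := V ∪ r '' V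
  have hW : W.Finite := hV.union (hV.image r)
  have : Finite W := hW
  let p : W → Prop := fun y => y.1 ∈ V
  let q : W → Prop := fun y => y.1 ∈ r '' V
  let e₀ : {y : W // p y} ≃ {y : W // q y} := Equiv.ofBijective
    (fun y => ⟨⟨r y.1.1, Or.inr ⟨_, y.2, rfl⟩⟩, ⟨_, y.2, rfl⟩⟩) (by
      constructor
      · rintro ⟨⟨y, hy⟩, hy'⟩ ⟨⟨z, hz⟩, hz'⟩ h
        have h' : r y = r z := congrArg (fun w => w.1.1) h
        simp only [Subtype.mk.injEq]
        exact hr hy' hz' h'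
      · rintro ⟨⟨y, hy⟩, hy'⟩
        obtain ⟨x, hx, h⟩ := hy'
        exact ⟨⟨⟨x, Or.inl hx⟩, hx⟩, Subtype.ext (Subtype.ext h)⟩)
  refine ⟨Equiv.Perm.ofSubtype e₀.extendSubtype, fun y hy => ?_, hW.subset fun y hy => ?_⟩
  · have hyW : y ∈ W := Or.inl hy
    rw [Equiv.Perm.ofSubtype_apply_of_mem _ hyW, Equiv.extendSubtype_apply_of_mem e₀ ⟨y, hyW⟩ hy]
    rfl
  · by_contra h
    exact hy (Equiv.Perm.ofSubtype_apply_of_not_mem _ h)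

/-- As `f` followed by `g` fixes the variables of `θ`, the map `f` sends them injectively to
variables, and so agrees on them with a renaming. -/
theorem PS.equivalent_of_sub {n : ℕ} {θ θ' : PS L SV n} {f g : SV → L.Term SV}
    (hf : θ.sub f = θ') (hg : θ'.sub g = θ) : θ.Equivalent θ' := by
  have h : ∀ y ∈ θ.codom, (f y).subst g = .var y := by
    rw [← sub_eq_sub_iff (g := FirstOrder.Language.Term.var), sub_var, ← sub_sub, hf, hg]
  have h' : ∀ y, ∃ x, y ∈ θ.codom → f y = .var x ∧ g x = .var y := fun y => by
    by_cases hy : y ∈ θ.codom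
    · have := h y hy
      cases hfy : f y with
      | var x => rw [hfy] at this; exact ⟨x, fun _ => ⟨rfl, this⟩⟩
      | func F ts => rw [hfy] at this; simp [Term.subst] at this
    · exact ⟨y, fun h => (hy h).elim⟩
  choose r hr using h'
  have hinj : Set.InjOn r θ.codom := fun y hy z hz hyz => by
    have h₁ := (hr y hy).2
    rw [hyz, (hr z hz).2] at h₁
    simpa using h₁.symm
  obtain ⟨e, he, hfin⟩ := exists_perm_of_injOn θ.finite_codom hinj
  refine ⟨⟨fun y => .var (e y), by simpa using hfin⟩, ⟨e, fun _ => rfl⟩, ?_⟩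
  rw [app_eq_sub, ← hf, sub_eq_sub_iff]
  intro y hy
  change Term.var (e y) = f y
  rw [(hr y hy).1, he y hy]

end Terms

/-! ### The instance order on canonical program substitutions. -/

section Order

variable {L : FirstOrder.Language.{u, v}} {SV : Type w} {C : Canon L SV}

theorem Canon.canon_eq_iff {n : ℕ} {θ θ' : PS L SV n} :
    C.canon θ = C.canon θ' ↔ θ.Equivalent θ' := by
  constructor
  · intro h
    have h' : C.rep θ = C.rep θ' := congrArg Subtype.val h
    exact (C.equiv θ).trans (h' ▸ (C.equiv θ').symm)
  · exact fun h => Subtype.ext (C.eq_of_equiv h)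

theorem Canon.canon_val {n : ℕ} (θ : CPS C n) : C.canon θ.1 = θ := Subtype.ext θ.2

/-- The instance order on canonical program substitutions. -/
instance {n : ℕ} : PartialOrder (CPS C n) where
  le θ θ' := ∃ f : SV → L.Term SV, θ.1.sub f = θ'.1
  le_refl θ := ⟨.var, PS.sub_var _⟩
  le_trans := by
    rintro θ θ' θ'' ⟨f, hf⟩ ⟨g, hg⟩
    exact ⟨_, by rw [← PS.sub_sub, hf, hg]⟩
  le_antisymm := by
    rintro θ θ' ⟨f, hf⟩ ⟨g, hg⟩
    rw [← C.canon_val θ, ← C.canon_val θ', C.canon_eq_iff]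
    exact PS.equivalent_of_sub hf hg

theorem CPS.le_def {n : ℕ} {θ θ' : CPS C n} :
    θ ≤ θ' ↔ ∃ f : SV → L.Term SV, θ.1.sub f = θ'.1 := Iff.rfl

theorem Canon.exists_sub_eq_canon {n : ℕ} (θ : PS L SV n) :
    ∃ f : SV → L.Term SV, θ.sub f = (C.canon θ).1 := by
  obtain ⟨ρ, _, h⟩ := C.equiv θ
  exact ⟨ρ.toFun, h⟩

theorem Canon.exists_canon_sub_eq {n : ℕ} (θ : PS L SV n) :
    ∃ f : SV → L.Term SV, (C.canon θ).1.sub f = θ := by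
  obtain ⟨ρ, _, h⟩ := (C.equiv θ).symm
  exact ⟨ρ.toFun, h⟩

theorem Canon.canon_le_canon_iff {n : ℕ} {θ θ' : PS L SV n} :
    C.canon θ ≤ C.canon θ' ↔ ∃ f : SV → L.Term SV, θ.sub f = θ' := by
  obtain ⟨a, ha⟩ := C.exists_sub_eq_canon θ
  obtain ⟨b, hb⟩ := C.exists_canon_sub_eq θ
  obtain ⟨a', ha'⟩ := C.exists_sub_eq_canon θ'
  obtain ⟨b', hb'⟩ := C.exists_canon_sub_eq θ'
  constructor
  · rintro ⟨f, hf⟩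
    rw [← hb', ← hf, ← ha, PS.sub_sub, PS.sub_sub]
    exact ⟨_, rfl⟩
  · rintro ⟨f, hf⟩
    refine ⟨fun y => ((b y).subst f).subst a', ?_⟩
    rw [← PS.sub_sub _ (fun y => (b y).subst f), ← PS.sub_sub, hb, hf, ha']

theorem isConcreteBehavior_iff {N : Type x} {ar : N → ℕ} {b : Behavior C ar} :
    IsConcreteBehavior b ↔ ∀ p θ, ∀ θ' ∈ (b p θ).elems, θ ≤ θ' := by
  refine forall₄_congr fun p θ θ' _ => ?_
  constructor
  · rintro ⟨σ, h⟩
    exact ⟨σ.toFun, h.symm⟩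
  · rintro ⟨f, h⟩
    obtain ⟨σ, hσ⟩ := θ.1.exists_app_eq f
    exact ⟨σ, by rw [hσ, h]⟩

/-- The restriction of a canonical program substitution along a map of indices. -/
noncomputable def CPS.restr {n m : ℕ} (e : Fin m → Fin n) (θ : CPS C n) : CPS C m :=
  C.canon fun j => θ.1 (e j)

theorem restrG_eq {n m : ℕ} (e : Fin m ↪ Fin n) (θ : CPS C n) : restrG C e θ = θ.restr e := rfl

theorem CPS.restr_canon {n m : ℕ} (e : Fin m → Fin n) (θ : PS L SV n) :
    (C.canon θ).restr e = C.canon fun j => θ (e j) := by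
  rw [restr, C.canon_eq_iff]
  obtain ⟨ρ, hρ, h⟩ := (C.equiv θ).symm
  exact ⟨ρ, hρ, funext fun j => congrFun h (e j)⟩

theorem CPS.restr_restr {n m k : ℕ} (e : Fin m → Fin n) (a : Fin k → Fin m) (θ : CPS C n) :
    (θ.restr e).restr a = θ.restr (e ∘ a) := restr_canon a _

theorem CPS.restr_id {n : ℕ} (θ : CPS C n) : θ.restr id = θ := C.canon_val θ

theorem CPS.restr_mono {n m : ℕ} (e : Fin m → Fin n) {θ θ' : CPS C n} (h : θ ≤ θ') :
    θ.restr e ≤ θ'.restr e := by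
  obtain ⟨f, hf⟩ := h
  exact C.canon_le_canon_iff.2 ⟨f, funext fun j => congrFun hf (e j)⟩

/-- A lifting property: the map that instantiates the restriction is applied to all components of
`θ`. -/
theorem CPS.restr_le_iff {n m : ℕ} {e : Fin m → Fin n} {θ : CPS C n} {x : CPS C m} :
    θ.restr e ≤ x ↔ ∃ X, θ ≤ X ∧ X.restr e = x := by
  constructor
  · intro h
    rw [← C.canon_val x, restr, C.canon_le_canon_iff] at h
    obtain ⟨f, hf⟩ := h
    refine ⟨C.canon (θ.1.sub f), ?_, ?_⟩
    · rw [← C.canon_val θ, C.canon_le_canon_iff]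
      exact ⟨f, by rw [C.canon_val]⟩
    · rw [restr_canon, ← C.canon_val x, ← hf]
      rfl
  · rintro ⟨X, hX, rfl⟩
    exact restr_mono e hX

end Order

end PrologCut

namespace PrologCut

/-! ### Existence of most general unifiers. -/

section Unification

variable {L : FirstOrder.Language.{u, v}} {SV : Type w}

open FirstOrder.Language (Term)

/-- The size of a term. -/
def tsize : L.Term SV → ℕ
  | .var _ => 1
  | .func _ ts => 1 + ∑ i, tsize (ts i)

theorem tsize_pos (t : L.Term SV) : 0 < tsize t := by
  cases t <;> simp [tsize]

theorem tsize_le_of_mem {t : L.Term SV} {f : SV → L.Term SV} {y : SV} (h : y ∈ tvars t) :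
    tsize (f y) ≤ tsize (t.subst f) := by
  induction t with
  | var x => rw [mem_tvars_var] at h; rw [h]; rfl
  | func F ts ih =>
    obtain ⟨i, hi⟩ := mem_tvars_func.1 h
    refine (ih i hi).trans ?_
    simp only [Term.subst, tsize]
    exact (Finset.single_le_sum (f := fun i => tsize ((ts i).subst f)) (fun _ _ => Nat.zero_le _)
      (Finset.mem_univ i)).trans (Nat.le_add_left _ _)

/-- The occurs check: otherwise the value of `y` would be a proper subterm of itself, contradicting
its size. -/
theorem not_mem_tvars_of_subst_eq {k : ℕ} {F : L.Functions k} {ts : Fin k → L.Term SV}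
    {f : SV → L.Term SV} {y : SV} (h : f y = (Term.func F ts).subst f) :
    y ∉ tvars (.func F ts) := fun hy => by
  obtain ⟨i, hi⟩ := mem_tvars_func.1 hy
  have h₁ := tsize_le_of_mem (f := f) hi
  rw [h] at h₁
  have h₂ : tsize ((ts i).subst f) ≤ ∑ i, tsize ((ts i).subst f) :=
    Finset.single_le_sum (f := fun i => tsize ((ts i).subst f)) (fun _ _ => Nat.zero_le _)
      (Finset.mem_univ i)
  simp only [Term.subst, tsize] at h₁
  omega

/-- `f` solves a list of equations. -/
def Solves (f : SV → L.Term SV) (E : List (L.Term SV × L.Term SV)) : Prop :=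
  ∀ p ∈ E, p.1.subst f = p.2.subst f

/-- The elementary substitution `{x/t}`. -/
noncomputable def single (x : SV) (t : L.Term SV) : StdSubst L SV :=
  .ofFun (fun _ => t) (Set.finite_singleton x)

theorem single_self (x : SV) (t : L.Term SV) : (single x t).toFun x = t :=
  StdSubst.ofFun_apply _ rfl

theorem single_of_ne {x y : SV} (t : L.Term SV) (h : y ≠ x) : (single x t).toFun y = .var y :=
  if_neg h

theorem subst_single {x : SV} {t : L.Term SV} {f : SV → L.Term SV} (h : f x = t.subst f)
    (s : L.Term SV) : (s.subst (single x t).toFun).subst f = s.subst f := by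
  rw [subst_subst, subst_eq_subst_iff]
  intro y _
  by_cases hy : y = x
  · rw [hy, single_self, h]
  · rw [single_of_ne t hy]; rfl

theorem subst_single_self {x : SV} {t : L.Term SV} (h : x ∉ tvars t) :
    t.subst (single x t).toFun = t := by
  refine Eq.trans (subst_eq_subst_iff.2 fun y hy => single_of_ne t ?_) (subst_var t)
  rintro rfl
  exact h hy

/-- The measure of a list of equations with respect to a given solution. -/
def eqSize (f : SV → L.Term SV) (E : List (L.Term SV × L.Term SV)) : ℕ :=
  (E.map fun p => tsize (p.1.subst f)).sum

/-- The unification algorithm, with termination measured by the size of the left-hand sides under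
one known solution `f`. Discarding, eliminating and decomposing an equation all decrease this size,
since eliminating `x` does not change the values under a solution. The conclusion says that any
solution `g` factors through `μ` with `g` itself as the second factor, a form that passes through
the elimination steps. -/
theorem exists_strong_mgu (f : SV → L.Term SV) (N : ℕ) : ∀ E : List (L.Term SV × L.Term SV),
    eqSize f E ≤ N → Solves f E → ∃ μ : StdSubst L SV, Solves μ.toFun E ∧
      ∀ g, Solves g E → ∀ y, g y = (μ.toFun y).subst g := by
  induction N with
  | zero =>
    intro E hE _
    cases E with
    | nil => exact ⟨.id, by simp [Solves], fun _ _ _ => rfl⟩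
    | cons p E =>
      simp only [eqSize, List.map_cons, List.sum_cons] at hE
      have := tsize_pos (p.1.subst f)
      omega
  | succ N ih =>
    -- Elimination of `x = t`: the remaining equations are solved after the replacement of `x` by
    -- `t`, and `single x t` is composed in front.
    have elim : ∀ (x : SV) (t : L.Term SV) (E : List (L.Term SV × L.Term SV)), x ∉ tvars t →
        eqSize f E ≤ N → Solves f E → f x = t.subst f →
        ∃ μ : StdSubst L SV, ((μ.toFun x) = t.subst μ.toFun ∧ Solves μ.toFun E) ∧
          ∀ g, g x = t.subst g → Solves g E → ∀ y, g y = (μ.toFun y).subst g := by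
      intro x t E hx hN hf hfx
      obtain ⟨μ, hμ, hμ'⟩ := ih (E.map fun p => (p.1.subst (single x t).toFun,
        p.2.subst (single x t).toFun)) (by
            simpa [eqSize, Function.comp_def, subst_single hfx] using hN) (by
            intro p hp
            obtain ⟨q, hq, rfl⟩ := List.mem_map.1 hp
            simpa only [subst_single hfx] using hf q hq)
      refine ⟨(single x t).comp μ, ⟨?_, fun p hp => ?_⟩, fun g hgx hg y => ?_⟩
      · simp only [StdSubst.comp, single_self]
        rw [← subst_subst, subst_single_self hx]
      · simp only [StdSubst.comp]
        rw [← subst_subst, ← subst_subst]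
        exact hμ _ (List.mem_map.2 ⟨p, hp, rfl⟩)
      · have h := hμ' g (by
          intro p hp
          obtain ⟨q, hq, rfl⟩ := List.mem_map.1 hp
          simpa only [subst_single hgx] using hg q hq)
        simp only [StdSubst.comp]
        rw [subst_subst]
        have h' : (fun y => (μ.toFun y).subst g) = g := funext fun y => (h y).symm
        rw [h']
        exact (subst_single hgx (.var y)).symm
    intro E hE hf
    cases E with
    | nil => exact ⟨.id, by simp [Solves], fun _ _ _ => rfl⟩
    | cons p E =>
      have hp : p.1.subst f = p.2.subst f := hf p (by simp)
      have hfE : Solves f E := fun q hq => hf q (by simp [hq])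
      have hN : eqSize f E ≤ N := by
        simp only [eqSize, List.map_cons, List.sum_cons] at hE ⊢
        have := tsize_pos (p.1.subst f)
        omega
      obtain ⟨s, t⟩ := p
      simp only [Solves, List.mem_cons, forall_eq_or_imp]
      cases s with
      | var x =>
        by_cases hxt : t = .var x
        · subst hxt
          obtain ⟨μ, hμ, hμ'⟩ := ih E hN hfE
          exact ⟨μ, ⟨rfl, hμ⟩, fun g hg => hμ' g hg.2⟩
        · have hx : x ∉ tvars t := by
            cases t with
            | var y => simpa [eq_comm] using hxt
            | func F ts => exact not_mem_tvars_of_subst_eq hp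
          obtain ⟨μ, hμ, hμ'⟩ := elim x t E hx hN hfE hp
          exact ⟨μ, hμ, fun g hg => hμ' g hg.1 hg.2⟩
      | func F ts =>
        cases t with
        | var x =>
          obtain ⟨μ, hμ, hμ'⟩ := elim x _ E (not_mem_tvars_of_subst_eq hp.symm) hN hfE hp.symm
          exact ⟨μ, ⟨hμ.1.symm, hμ.2⟩, fun g hg => hμ' g hg.1.symm hg.2⟩
        | func G us =>
          simp only [Term.subst, Term.func.injEq] at hp
          obtain ⟨rfl, hFG, hp⟩ := hp
          obtain rfl := eq_of_heq hFG
          have hp := eq_of_heq hp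
          have key : ∀ g : SV → L.Term SV,
              Solves g (List.ofFn (fun i => (ts i, us i)) ++ E) ↔
                (Term.func F ts).subst g = (Term.func F us).subst g ∧ Solves g E := fun g => by
            simp only [Solves, List.mem_append, or_imp, forall_and, List.mem_ofFn,
              forall_exists_index, forall_apply_eq_imp_iff, Term.subst, Term.func.injEq,
              heq_eq_eq, true_and, funext_iff]
          obtain ⟨μ, hμ, hμ'⟩ := ih (List.ofFn (fun i => (ts i, us i)) ++ E) (by
            simp only [eqSize, List.map_append, List.sum_append, List.map_ofFn, List.sum_ofFn,
              Function.comp_def, List.map_cons, List.sum_cons, Term.subst, tsize] at hE ⊢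
            omega) ((key f).2 ⟨by simp [Term.subst, hp], hfE⟩)
          exact ⟨μ, (key _).1 hμ, fun g hg => hμ' g ((key g).2 hg)⟩

theorem exists_isMGU {k : ℕ} {s t : Fin k → L.Term SV} {f : SV → L.Term SV}
    (h : ∀ i, (s i).subst f = (t i).subst f) : ∃ μ : StdSubst L SV, μ.IsMGU s t := by
  have key : ∀ g : SV → L.Term SV, Solves g (List.ofFn fun i => (s i, t i)) ↔
      ∀ i, (s i).subst g = (t i).subst g := fun g => by
    simp [Solves, List.mem_ofFn]
  obtain ⟨μ, hμ, hμ'⟩ := exists_strong_mgu f _ _ le_rfl ((key f).2 h)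
  exact ⟨μ, (key _).1 hμ, fun τ hτ => ⟨τ, StdSubst.ext (hμ' _ ((key _).2 hτ))⟩⟩

theorem isMGU_unit_iff {μ : StdSubst L SV} {s t : L.Term SV} :
    μ.IsMGU (fun _ : Unit => s) (fun _ : Unit => t) ↔
      μ.IsMGU (fun _ : Fin 1 => s) (fun _ : Fin 1 => t) := by
  simp [StdSubst.IsMGU, StdSubst.IsUnifier]

/-- The most general unifier is most general also with respect to arbitrary maps from variables
to terms, as far as finitely many variables are concerned. -/
theorem StdSubst.IsMGU.exists_sub_eq {ι : Type*} [Finite ι] {μ : StdSubst L SV}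
    {s t : ι → L.Term SV} (h : μ.IsMGU s t) {f : SV → L.Term SV}
    (hf : ∀ i, (s i).subst f = (t i).subst f) {n : ℕ} (θ : PS L SV n) :
    ∃ g : SV → L.Term SV, (θ.app μ).sub g = θ.sub f := by
  let V : Set SV := θ.codom ∪ ((⋃ i, tvars (s i)) ∪ ⋃ i, tvars (t i))
  have hV : V.Finite := θ.finite_codom.union
    ((Set.finite_iUnion fun i => finite_tvars _).union (Set.finite_iUnion fun i => finite_tvars _))
  have hsub : ∀ r : L.Term SV, tvars r ⊆ V → r.subst (StdSubst.ofFun f hV).toFun = r.subst f :=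
    fun r hr => subst_eq_subst_iff.2 fun y hy => StdSubst.ofFun_apply hV (hr hy)
  obtain ⟨δ, hδ⟩ := h.2 (.ofFun f hV) fun i => by
    rw [hsub, hsub, hf]
    · exact (Set.subset_iUnion (fun i => tvars (t i)) i).trans
        (Set.subset_union_right.trans Set.subset_union_right)
    · exact (Set.subset_iUnion (fun i => tvars (s i)) i).trans
        (Set.subset_union_left.trans Set.subset_union_right)
  refine ⟨δ.toFun, ?_⟩
  rw [PS.app_eq_sub, PS.sub_sub, ← PS.app_ofFun θ f hV Set.subset_union_left, hδ]
  rfl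

end Unification

end PrologCut

namespace PrologCut

/-! ### Universal properties of the operations on program substitutions. -/

section Extension

variable {L : FirstOrder.Language.{u, v}} {SV : Type w} {C : Canon L SV}

open FirstOrder.Language (Term)

/-- `r` is the least instance of `θ` the restriction of which along `e` is an instance of `θi`,
and this restriction is equal to `θi`. -/
def CPS.IsExt {n m : ℕ} (e : Fin m → Fin n) (θ : CPS C n) (θi : CPS C m) (r : CPS C n) : Prop :=
  θ ≤ r ∧ r.restr e = θi ∧ ∀ x, θ ≤ x → θi ≤ CPS.restr e x → r ≤ x

namespace CPS

variable {n m k : ℕ}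

theorem IsExt.unique {e : Fin m → Fin n} {θ : CPS C n} {θi : CPS C m} {r r' : CPS C n}
    (h : IsExt e θ θi r) (h' : IsExt e θ θi r') : r = r' :=
  le_antisymm (h.2.2 _ h'.1 h'.2.1.ge) (h'.2.2 _ h.1 h.2.1.ge)

theorem isExt_id (θ : CPS C n) {θi : CPS C n} (h : θ ≤ θi) : IsExt id θ θi θi :=
  ⟨h, restr_id _, fun x _ hx => by rwa [restr_id] at hx⟩

/-- Extensions along composite maps of indices. -/
theorem IsExt.of_comp {e : Fin m → Fin n} {a : Fin k → Fin m} {θ : CPS C n} {θi : CPS C m}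
    {r : CPS C n} {θj : CPS C k} {r' : CPS C n} (h : IsExt e θ θi r)
    (h' : IsExt (e ∘ a) r θj r') : IsExt a θi θj (r'.restr e) ∧ IsExt e θ (r'.restr e) r' := by
  have hθi : θi ≤ r'.restr e := h.2.1 ▸ restr_mono e h'.1
  refine ⟨⟨hθi, by rw [restr_restr, h'.2.1], fun x hx hxa => ?_⟩,
    h.1.trans h'.1, rfl, fun x hx hxe => ?_⟩
  · rw [← h.2.1] at hx
    -- The competitor `x` is lifted to an instance of the larger context, where the minimality of
    -- `r'` can be used.
    obtain ⟨X, hX, rfl⟩ := restr_le_iff.1 hx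
    rw [restr_restr] at hxa
    exact restr_mono e (h'.2.2 X hX hxa)
  · refine h'.2.2 x (h.2.2 x hx (hθi.trans hxe)) ?_
    rw [← restr_restr, ← h'.2.1, ← restr_restr]
    exact restr_mono a hxe

end CPS

theorem exists_injOn_avoiding [Infinite SV] {Z F : Set SV} (hZ : Z.Finite) (hF : F.Finite) :
    ∃ y : SV → SV, Set.InjOn y Z ∧ ∀ z, y z ∉ F := by
  obtain ⟨g, hg⟩ := Set.countable_iff_exists_injOn.1 hZ.countable
  have hinf : Fᶜ.Infinite := hF.infinite_compl
  let h := hinf.natEmbedding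
  refine ⟨fun z => h (g z), fun z hz z' hz' hzz' => hg hz hz' ?_, fun z => (h (g z)).2⟩
  exact h.injective (Subtype.ext hzz')

theorem exists_embedding_avoiding [Infinite SV] (n : ℕ) {F : Set SV} (hF : F.Finite) :
    ∃ y : Fin n ↪ SV, ∀ j, y j ∉ F := by
  have hinf : Fᶜ.Infinite := hF.infinite_compl
  let h := hinf.natEmbedding
  refine ⟨⟨fun j => h j, fun i j hij => ?_⟩, fun j => (h j).2⟩
  exact Fin.ext (h.injective (Subtype.ext hij))

/-- Infinitely many standard variables are available, so the finite set `Z` can be exchanged with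
fresh variables; `ρ` is this involution. -/
theorem exists_isExtG [Infinite SV] {m r : ℕ} (a : Fin r ↪ Fin m) (θ : PS L SV m)
    (θi : PS L SV r) {f : SV → L.Term SV} (h : PS.sub (fun j => θ (a j)) f = θi) :
    ∃ res, IsExtG a θ θi res := by
  classical
  let θ' : PS L SV r := fun j => θ (a j)
  let σ : StdSubst L SV := .ofFun f θ'.finite_codom
  let Z := θ.codom \ θ'.codom
  have hZ : Z.Finite := θ.finite_codom.subset Set.sdiff_subset
  have hσ : σ.codom.Finite := Set.Finite.biUnion σ.finite_dom fun y _ => finite_tvars _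
  obtain ⟨y, hy, hyF⟩ := exists_injOn_avoiding hZ (θ.finite_codom.union hσ)
  have hdisj : ∀ z ∈ Z, z ∉ y '' Z := by
    rintro z hz ⟨z', hz', rfl⟩
    exact hyF z' (Or.inl hz.1)
  let ρ : StdSubst L SV :=
    { toFun := fun z => if z ∈ Z then .var (y z) else
        if h : z ∈ y '' Z then .var h.choose else .var z
      finite_dom := (hZ.union (hZ.image y)).subset fun z hz => by
        by_contra hz'
        simp only [Set.mem_union, not_or] at hz'
        exact hz (by rw [if_neg hz'.1, dif_neg hz'.2]) }
  refine ⟨(θ.app ρ).app σ, θ', Z, σ, ρ, y, rfl, rfl, StdSubst.dom_ofFun f _, ?_, hy,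
    fun z _ => hyF z, fun z hz => ⟨if_pos hz, ?_⟩, fun z hz hz' => ?_, rfl⟩
  · rw [← h, PS.app_ofFun _ _ _ subset_rfl]
  · have hyz : y z ∉ Z := fun h => hyF z (Or.inl h.1)
    have hyz' : y z ∈ y '' Z := ⟨z, hz, rfl⟩
    change (if y z ∈ Z then _ else _) = _
    rw [if_neg hyz, dif_pos hyz', hy hyz'.choose_spec.1 hz hyz'.choose_spec.2]
  · change (if z ∈ Z then _ else _) = _
    rw [if_neg hz, dif_neg hz']

/-- The renaming fixes the variables of the restriction, so restricting the result gives `θi`. The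
other variables of `θ` become fresh ones, on which `σ` is trivial and which `σ` does not produce.
Hence they can be instantiated independently of `θi`, which gives minimality. -/
theorem IsExtG.isExt {m r : ℕ} {a : Fin r ↪ Fin m} {θ : PS L SV m} {θi : PS L SV r}
    {res : PS L SV m} (h : IsExtG a θ θi res) :
    CPS.IsExt a (C.canon θ) (C.canon θi) (C.canon res) := by
  classical
  obtain ⟨θ', Z, σ, ρ, y, rfl, rfl, hσ, rfl, hy, hyF, hρ, hρ', rfl⟩ := h
  have hsub := PS.codom_comp_subset θ a
  have hfix : ∀ v ∈ PS.codom (fun j => θ (a j)), ρ.toFun v = .var v := fun v hv => by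
    refine hρ' v (fun h => h.2 hv) ?_
    rintro ⟨z, hz, rfl⟩
    exact hyF z hz (Or.inl (hsub hv))
  refine ⟨C.canon_le_canon_iff.2 ⟨_, (PS.sub_sub _ _ _).symm⟩, ?_, fun x hx hxe => ?_⟩
  · rw [CPS.restr_canon]
    congr 1
    change ((PS.sub (fun j => θ (a j)) ρ.toFun).sub σ.toFun) = PS.sub _ _
    rw [PS.sub_sub, PS.sub_eq_sub_iff]
    intro v hv
    rw [hfix v hv]
    rfl
  · obtain ⟨x, rfl⟩ : ∃ x', C.canon x' = x := ⟨x.1, C.canon_val x⟩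
    rw [CPS.restr_canon] at hxe
    rw [C.canon_le_canon_iff] at hx hxe ⊢
    obtain ⟨h, rfl⟩ := hx
    obtain ⟨k, hk⟩ := hxe
    have hk' : ∀ v ∈ PS.codom (fun j => θ (a j)), (σ.toFun v).subst k = h v := by
      rw [← PS.sub_eq_sub_iff, ← PS.sub_sub]
      exact hk
    -- On a fresh variable `y z` the map follows the given instance of `θ` at `z`; elsewhere it
    -- follows the given instance of `θi`.
    refine ⟨fun w => if hw : ∃ z, z ∈ θ.codom \ PS.codom (fun j => θ (a j)) ∧ y z = w then
      h hw.choose else k w, ?_⟩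
    rw [PS.app_eq_sub, PS.app_eq_sub, PS.sub_sub, PS.sub_sub, PS.sub_eq_sub_iff]
    intro v hv
    by_cases hvZ : v ∈ θ.codom \ PS.codom (fun j => θ (a j))
    · have hyv : σ.toFun (y v) = .var (y v) := by
        by_contra hne
        exact hyF v hvZ (Or.inl (hsub (hσ hne)))
      have hyv' : ∃ z, z ∈ θ.codom \ PS.codom (fun j => θ (a j)) ∧ y z = y v := ⟨v, hvZ, rfl⟩
      rw [(hρ v hvZ).1]
      simp only [Term.subst, hyv]
      rw [dif_pos hyv', hy hyv'.choose_spec.1 hvZ hyv'.choose_spec.2]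
    · have hv' : v ∈ PS.codom (fun j => θ (a j)) := by
        by_contra hv'
        exact hvZ ⟨hv, hv'⟩
      rw [hfix v hv', ← hk' v hv']
      change (σ.toFun v).subst _ = _
      rw [subst_eq_subst_iff]
      intro w hw
      refine dif_neg ?_
      rintro ⟨z, hz, rfl⟩
      refine hyF z hz ?_
      by_cases hvσ : v ∈ σ.dom
      · exact Or.inr (Set.mem_biUnion hvσ hw)
      · have : σ.toFun v = .var v := not_not.1 hvσ
        rw [this, mem_tvars_var] at hw
        exact Or.inl (hw ▸ hv)

/-- The extension of one element of the result of a call. -/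
noncomputable def CPS.ext [Nonempty SV] {m r : ℕ} (a : Fin r ↪ Fin m) (θ : CPS C m)
    (θi : CPS C r) : CPS C m := C.canon (Classical.epsilon (IsExtG a θ.1 θi.1))

theorem extG_eq [Nonempty SV] {m r : ℕ} (a : Fin r ↪ Fin m) (θ : CPS C m) (S : PSeq (CPS C r)) :
    extG C a θ S = S.map (CPS.ext a θ) := rfl

namespace CPS

variable [Infinite SV] {n m k : ℕ}

theorem isExt_ext (a : Fin m ↪ Fin n) {θ : CPS C n} {θi : CPS C m} (h : θ.restr a ≤ θi) :
    IsExt a θ θi (ext a θ θi) := by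
  rw [← C.canon_val θi, restr, C.canon_le_canon_iff] at h
  obtain ⟨f, hf⟩ := h
  have := (Classical.epsilon_spec (exists_isExtG a θ.1 θi.1 hf)).isExt (C := C)
  rwa [C.canon_val, C.canon_val] at this

/-- Any element with the universal property is the value of `ext`, so the choice made by `epsilon`
is irrelevant. -/
theorem ext_eq {a : Fin m ↪ Fin n} {θ : CPS C n} {θi : CPS C m} {r : CPS C n}
    (h : IsExt a θ θi r) : ext a θ θi = r := by
  refine (isExt_ext a ?_).unique h
  rw [← h.2.1]
  exact restr_mono a h.1

/-- Extending in the inner context and then outwards has the universal property of the direct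
extension. Locality of execution rests on this. -/
theorem ext_ext (e : Fin m ↪ Fin n) (a : Fin k ↪ Fin m) {θ : CPS C n} {θi : CPS C m}
    {θj : CPS C k} (h : θ.restr e ≤ θi) (h' : θi.restr a ≤ θj) :
    ext (a.trans e) (ext e θ θi) θj = ext e θ (ext a θi θj) := by
  have h₁ := isExt_ext e h
  have h₂ : IsExt (e ∘ a) (ext e θ θi) θj (ext (a.trans e) (ext e θ θi) θj) :=
    isExt_ext (a.trans e) (by
      rw [Function.Embedding.coe_trans, ← restr_restr, h₁.2.1]; exact h')
  obtain ⟨h₃, h₄⟩ := h₁.of_comp h₂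
  rw [ext_eq h₃, ext_eq h₄]

end CPS

/-! ### Clause entry and clause exit. -/

section Entry

variable {n m e : ℕ}

/-- `r` is the most general extension of `θ` to `e` more variables. -/
def CPS.IsUp (e : ℕ) (θ : CPS C n) (r : CPS C (n + e)) : Prop :=
  r.restr (Fin.castAdd e) = θ ∧ ∀ x, θ ≤ CPS.restr (Fin.castAdd e) x → r ≤ x

theorem CPS.IsUp.unique {θ : CPS C n} {r r' : CPS C (n + e)} (h : IsUp e θ r)
    (h' : IsUp e θ r') : r = r' :=
  le_antisymm (h.2 _ h'.1.ge) (h'.2 _ h.1.ge)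

theorem append_castAdd (θ : PS L SV n) (τ : PS L SV e) :
    (fun i => Fin.append θ τ (Fin.castAdd e i)) = θ := funext fun i => Fin.append_left _ _ i

/-- Fresh distinct variables can be sent to prescribed terms without affecting `θ`. -/
theorem isUp_append {θ : PS L SV n} {y : Fin e → SV} (hy : Function.Injective y)
    (hyθ : ∀ j, y j ∉ θ.codom) :
    CPS.IsUp e (C.canon θ) (C.canon (Fin.append θ fun j => .var (y j))) := by
  classical
  refine ⟨by rw [CPS.restr_canon, append_castAdd], fun x hx => ?_⟩
  obtain ⟨x, rfl⟩ : ∃ x', C.canon x' = x := ⟨x.1, C.canon_val x⟩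
  rw [CPS.restr_canon, C.canon_le_canon_iff] at hx
  obtain ⟨f, hf⟩ := hx
  rw [C.canon_le_canon_iff]
  refine ⟨fun v => if h : ∃ j, y j = v then x (Fin.natAdd n h.choose) else f v, ?_⟩
  funext i
  refine Fin.addCases (fun i => ?_) (fun j => ?_) i
  · rw [← congrFun hf i]
    simp only [PS.sub, Fin.append_left]
    rw [subst_eq_subst_iff]
    intro v hv
    refine dif_neg ?_
    rintro ⟨j, rfl⟩
    exact hyθ j (PS.mem_codom.2 ⟨i, hv⟩)
  · have h : ∃ j', y j' = y j := ⟨j, rfl⟩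
    simp only [PS.sub, Fin.append_right, Term.subst]
    rw [dif_pos h, hy h.choose_spec]

/-- The extension of a canonical program substitution at clause entry. -/
noncomputable def CPS.up [Nonempty SV] (e : ℕ) (θ : CPS C n) : CPS C (n + e) :=
  C.canon (Classical.epsilon (IsExtC e θ.1))

theorem extC_eq [Nonempty SV] (θ : CPS C n) : extC C e θ = (.fin [θ.up e], .nocut) := rfl

theorem CPS.isUp_up [Infinite SV] (θ : CPS C n) : IsUp e θ (θ.up e) := by
  obtain ⟨y, hy⟩ := exists_embedding_avoiding e θ.1.finite_codom
  have h : IsExtC e θ.1 (Classical.epsilon (IsExtC e θ.1)) :=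
    Classical.epsilon_spec (p := IsExtC e θ.1) ⟨_, y, hy, rfl⟩
  obtain ⟨y', hy', h⟩ := h
  rw [up, h]
  have := isUp_append (C := C) y'.injective hy'
  rwa [C.canon_val] at this

theorem CPS.up_canon [Infinite SV] {θ : PS L SV n} {y : Fin e → SV} (hy : Function.Injective y)
    (hyθ : ∀ j, y j ∉ θ.codom) :
    (C.canon θ).up e = C.canon (Fin.append θ fun j => .var (y j)) :=
  (isUp_up _).unique (isUp_append hy hyθ)

/-- The extension of an embedding of indices by the identity. -/
def liftEmb (e : ℕ) (a : Fin n ↪ Fin m) : Fin (n + e) ↪ Fin (m + e) where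
  toFun := Fin.addCases (fun i => Fin.castAdd e (a i)) fun j => Fin.natAdd m j
  inj' i j := by
    refine Fin.addCases (fun i => ?_) (fun i => ?_) i <;>
    refine Fin.addCases (fun j => ?_) (fun j => ?_) j
    · simp
    · simp only [Fin.addCases_left, Fin.addCases_right, Fin.ext_iff, Fin.val_castAdd,
        Fin.val_natAdd]
      have := (a i).2
      omega
    · simp only [Fin.addCases_left, Fin.addCases_right, Fin.ext_iff, Fin.val_castAdd,
        Fin.val_natAdd]
      have := (a j).2
      omega
    · simp

@[simp]
theorem liftEmb_castAdd (a : Fin n ↪ Fin m) (i : Fin n) :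
    liftEmb e a (Fin.castAdd e i) = Fin.castAdd e (a i) :=
  Fin.addCases_left (motive := fun _ => Fin (m + e)) (left := fun i => Fin.castAdd e (a i))
    (right := fun j => Fin.natAdd m j) i

@[simp]
theorem liftEmb_natAdd (a : Fin n ↪ Fin m) (j : Fin e) :
    liftEmb e a (Fin.natAdd n j) = Fin.natAdd m j :=
  Fin.addCases_right (motive := fun _ => Fin (m + e)) (left := fun i => Fin.castAdd e (a i))
    (right := fun j => Fin.natAdd m j) j

theorem append_liftEmb (a : Fin n ↪ Fin m) (θ : PS L SV m) (τ : PS L SV e) :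
    (fun i => Fin.append θ τ (liftEmb e a i)) = Fin.append (fun i => θ (a i)) τ := by
  funext i
  refine Fin.addCases (fun i => ?_) (fun j => ?_) i <;> simp

theorem CPS.restr_up [Infinite SV] (a : Fin n ↪ Fin m) (θ : CPS C m) :
    (θ.up e).restr (liftEmb e a) = (θ.restr a).up e := by
  obtain ⟨y, hy⟩ := exists_embedding_avoiding e θ.1.finite_codom
  conv_lhs => rw [← C.canon_val θ, up_canon y.injective hy, restr_canon, append_liftEmb]
  rw [restr, up_canon y.injective fun j h => hy j (PS.codom_comp_subset θ.1 a h)]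

/-- The two substitutions agree on the shared indices up to a renaming; that renaming is applied to
the extra components of `T` before they are appended to `x`. -/
theorem CPS.exists_amalgam (a : Fin n ↪ Fin m) {T : CPS C (n + e)} {x : CPS C m}
    (h : T.restr (Fin.castAdd e) = x.restr a) :
    ∃ X : CPS C (m + e), X.restr (Fin.castAdd e) = x ∧ X.restr (liftEmb e a) = T := by
  rw [restr, restr, C.canon_eq_iff] at h
  obtain ⟨ρ, hρ, h⟩ := h
  refine ⟨C.canon (Fin.append x.1 fun j => (T.1.app ρ) (Fin.natAdd n j)), ?_, ?_⟩
  · rw [restr_canon, append_castAdd, C.canon_val]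
  · rw [restr_canon, append_liftEmb, ← C.canon_val T, C.canon_eq_iff]
    refine PS.Equivalent.symm ⟨ρ, hρ, funext fun i => ?_⟩
    rw [C.canon_val]
    refine Fin.addCases (fun i => ?_) (fun j => ?_) i
    · rw [Fin.append_left]
      exact congrFun h i
    · rw [Fin.append_right]

/-- Restriction at clause exit is compatible with extension. -/
theorem CPS.IsExt.restr_castAdd [Infinite SV] {a : Fin n ↪ Fin m} {θ : CPS C m}
    {s : CPS C (n + e)} {r : CPS C (m + e)} (h : IsExt (liftEmb e a) (θ.up e) s r) :
    IsExt a θ (s.restr (Fin.castAdd e)) (r.restr (Fin.castAdd e)) := by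
  have hup := isUp_up (e := e) θ
  refine ⟨?_, ?_, fun x hx hxa => ?_⟩
  · conv_lhs => rw [← hup.1]
    exact restr_mono _ h.1
  · rw [← h.2.1, restr_restr, restr_restr]
    congr 1
    funext i
    simp
  · obtain ⟨T, hsT, hT⟩ := restr_le_iff.1 hxa
    obtain ⟨X, rfl, hX⟩ := exists_amalgam a hT
    exact restr_mono _ (h.2.2 X (hup.2 X hx) (hX ▸ hsT))

end Entry

/-! ### Equations as conditions on program substitutions. -/

section Equations

theorem term_subst_subst {α β γ : Type*} (t : L.Term α) (f : α → L.Term β)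
    (g : β → L.Term γ) : (t.subst f).subst g = t.subst fun y => (f y).subst g := by
  induction t with
  | var _ => rfl
  | func F ts ih => simp only [Term.subst, ih]

/-- The program substitution `θ` satisfies the equation `s = t` between terms over the indices. -/
def PS.Sat {n : ℕ} (s t : L.Term (Fin n)) (θ : PS L SV n) : Prop := s.subst θ = t.subst θ

theorem PS.sat_sub_iff {n : ℕ} {s t : L.Term (Fin n)} {θ : PS L SV n} {f : SV → L.Term SV} :
    (θ.sub f).Sat s t ↔ (s.subst θ).subst f = (t.subst θ).subst f := by
  rw [term_subst_subst, term_subst_subst]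
  rfl

theorem PS.Sat.sub {n : ℕ} {s t : L.Term (Fin n)} {θ : PS L SV n} (h : θ.Sat s t)
    (f : SV → L.Term SV) : (θ.sub f).Sat s t :=
  PS.sat_sub_iff.2 (congrArg (fun r => Term.subst r f) h)

theorem CPS.sat_canon {n : ℕ} {s t : L.Term (Fin n)} {θ : PS L SV n} :
    (C.canon θ).1.Sat s t ↔ θ.Sat s t := by
  constructor
  · intro h
    obtain ⟨f, hf⟩ := C.exists_canon_sub_eq θ
    exact hf ▸ h.sub f
  · intro h
    obtain ⟨f, hf⟩ := C.exists_sub_eq_canon θ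
    exact hf ▸ h.sub f

/-- `S` is the sequence that consists of the most general instance of `θ` satisfying `E`, if there
is one. -/
def CPS.IsSol {n : ℕ} (E : CPS C n → Prop) (θ : CPS C n) (S : PSeq (CPS C n)) : Prop :=
  (∃ r, S = .fin [r] ∧ IsLeast {x | θ ≤ x ∧ E x} r) ∨ (S = .fin [] ∧ ∀ x, θ ≤ x → ¬ E x)

/-- This describes the effect of any most general unifier by the order alone, so the unifiers chosen
by a tree and by the semantics give the same canonical result. -/
theorem CPS.isLeast_app_mgu {n : ℕ} {s t : L.Term (Fin n)} {θ : PS L SV n} {μ : StdSubst L SV}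
    (hμ : μ.IsMGU (fun _ : Unit => s.subst θ) (fun _ : Unit => t.subst θ)) :
    IsLeast {x | C.canon θ ≤ x ∧ x.1.Sat s t} (C.canon (θ.app μ)) := by
  refine ⟨⟨C.canon_le_canon_iff.2 ⟨_, rfl⟩, sat_canon.2 (PS.sat_sub_iff.2 (hμ.1 ()))⟩, ?_⟩
  rintro x ⟨hx, hs⟩
  obtain ⟨x, rfl⟩ : ∃ x', C.canon x' = x := ⟨x.1, C.canon_val x⟩
  rw [C.canon_le_canon_iff] at hx ⊢
  obtain ⟨f, rfl⟩ := hx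
  rw [sat_canon, PS.sat_sub_iff] at hs
  exact hμ.exists_sub_eq (fun _ => hs) θ

theorem CPS.isSol_unif {n : ℕ} (s t : L.Term (Fin n)) (θ : CPS C n) :
    IsSol (fun x => x.1.Sat s t) θ (unif C θ (s.subst θ.1) (t.subst θ.1)) := by
  rw [unif]
  split_ifs with h
  · obtain ⟨σ, hσ⟩ := h
    obtain ⟨μ, hμ⟩ := exists_isMGU (k := 1) (fun _ => hσ ())
    have := Classical.epsilon_spec (p := fun σ : StdSubst L SV =>
      σ.IsMGU (fun _ : Unit => s.subst θ.1) (fun _ : Unit => t.subst θ.1))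
      ⟨μ, isMGU_unit_iff.2 hμ⟩
    refine Or.inl ⟨_, rfl, ?_⟩
    have h := isLeast_app_mgu (C := C) this
    rwa [C.canon_val] at h
  · refine Or.inr ⟨rfl, ?_⟩
    rintro x ⟨f, hf⟩ hx
    rw [← hf, PS.sat_sub_iff] at hx
    obtain ⟨μ, hμ⟩ := exists_isMGU (k := 1) (fun _ => hx)
    exact h ⟨μ, fun _ => hμ.1 0⟩

/-- Solutions of equations are local. -/
theorem CPS.IsSol.extG_eq [Infinite SV] {n m : ℕ} {a : Fin m ↪ Fin n} {E : CPS C m → Prop}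
    {θ : CPS C n} {S : PSeq (CPS C m)} (h : IsSol E (θ.restr a) S) :
    IsSol (fun x => E (x.restr a)) θ (extG C a θ S) := by
  rcases h with ⟨r, rfl, ⟨hr, hEr⟩, hmin⟩ | ⟨rfl, h⟩
  · have hext := isExt_ext a hr
    refine Or.inl ⟨ext a θ r, rfl, ⟨hext.1, by rwa [← hext.2.1] at hEr⟩, ?_⟩
    rintro x ⟨hx, hEx⟩
    exact hext.2.2 x hx (hmin ⟨restr_mono a hx, hEx⟩)
  · exact Or.inr ⟨rfl, fun x hx hEx => h _ (restr_mono a hx) hEx⟩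

end Equations

end Extension

end PrologCut

namespace PrologCut

/-! ### Elements, compactness and elementwise images of sequences. -/

namespace PSeq

variable {α β γ : Type*}

theorem mem_elems_of_le {S : PSeq α} {l : List α} (h : inc l ≤ S) {a : α} (ha : a ∈ l) :
    a ∈ S.elems := by
  cases S with
  | fin l' => exact (inc_le_fin.1 h).subset ha
  | inc l' => exact (inc_le_inc.1 h).subset ha
  | inf s =>
    rw [← inc_le_inf.1 h] at ha
    obtain ⟨i, hi, rfl⟩ := List.mem_iff_getElem.1 ha
    refine ⟨i, ?_⟩
    have := Stream'.getElem?_take (s := s) (by simpa using hi)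
    rw [List.getElem?_eq_getElem hi] at this
    exact (Option.some.inj this).symm

theorem exists_inc_le_of_mem_elems {S : PSeq α} {a : α} (ha : a ∈ S.elems) :
    ∃ l, a ∈ l ∧ inc l ≤ S := by
  cases S with
  | fin l => exact ⟨l, ha, inc_le_fin.2 List.prefix_rfl⟩
  | inc l => exact ⟨l, ha, le_rfl⟩
  | inf s =>
    obtain ⟨i, rfl⟩ := ha
    refine ⟨s.take (i + 1), ?_, inc_take_le _ _⟩
    rw [Stream'.take_succ']
    exact List.mem_append_right _ (List.mem_singleton_self _)

theorem Lim.exists_mem_elems {c : ℕ → PSeq α} {S : PSeq α} (h : Lim c S) {a : α}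
    (ha : a ∈ S.elems) : ∃ n, a ∈ (c n).elems := by
  obtain ⟨l, hl, hlS⟩ := exists_inc_le_of_mem_elems ha
  obtain ⟨n, hn⟩ := h.2 (inc l) trivial hlS
  exact ⟨n, mem_elems_of_le (hn n le_rfl) hl⟩

/-- `S` is compact and all its elements satisfy `p`. -/
def AllC (p : α → Prop) (S : PSeq α) : Prop := S.IsCompact ∧ ∀ a ∈ S.elems, p a

theorem AllC.fin {p : α → Prop} {l : List α} (h : ∀ a ∈ l, p a) : AllC p (fin l) := ⟨trivial, h⟩

theorem AllC.inc {p : α → Prop} {l : List α} (h : ∀ a ∈ l, p a) : AllC p (inc l) := ⟨trivial, h⟩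

theorem AllC.imp {p q : α → Prop} {S : PSeq α} (h : AllC p S) (hpq : ∀ a, p a → q a) :
    AllC q S := ⟨h.1, fun a ha => hpq a (h.2 a ha)⟩

theorem AllC.box {p : α → Prop} {A B : PSeq α} (hA : AllC p A) (hB : AllC p B) :
    AllC p (A.box B) := by
  cases A with
  | inf s => exact hA.1.elim
  | inc l => exact hA
  | fin l =>
    cases B with
    | inf s => exact hB.1.elim
    | inc m =>
      exact ⟨trivial, fun a ha => (List.mem_append.1 ha).elim (hA.2 a) (hB.2 a)⟩
    | fin m =>
      exact ⟨trivial, fun a ha => (List.mem_append.1 ha).elim (hA.2 a) (hB.2 a)⟩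

theorem AllC.bind {p : α → Prop} {q : β → Prop} {S : PSeq α} {F : α → PSeq β} (hS : AllC p S)
    (hF : ∀ a, p a → AllC q (F a)) : AllC q (S.bind F) := by
  have key : ∀ l : List α, (∀ a ∈ l, p a) → AllC q ((PSeq.fin l).bind F) := fun l hl => by
    induction l with
    | nil => exact .fin (by simp)
    | cons a l ih =>
      rw [fin_cons_bind]
      exact (hF a (hl a (by simp))).box (ih fun b hb => hl b (by simp [hb]))
  cases S with
  | inf s => exact hS.1.elim
  | fin l => exact key l hS.2
  | inc l => exact (key l hS.2).box (.inc (by simp))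

theorem AllC.map {p : α → Prop} {q : β → Prop} {S : PSeq α} {f : α → β} (hS : AllC p S)
    (hf : ∀ a, p a → q (f a)) : AllC q (S.map f) := by
  cases S with
  | inf s => exact hS.1.elim
  | fin l =>
    refine ⟨trivial, fun b hb => ?_⟩
    obtain ⟨a, ha, rfl⟩ := List.mem_map.1 hb
    exact hf a (hS.2 a ha)
  | inc l =>
    refine ⟨trivial, fun b hb => ?_⟩
    obtain ⟨a, ha, rfl⟩ := List.mem_map.1 hb
    exact hf a (hS.2 a ha)

theorem map_map (S : PSeq α) (f : α → β) (g : β → γ) : (S.map f).map g = S.map (g ∘ f) := by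
  cases S with
  | fin l => simp [map]
  | inc l => simp [map]
  | inf s => simp [map, Stream'.map_map]

theorem map_congr {S : PSeq α} {f g : α → β} (h : ∀ a ∈ S.elems, f a = g a) :
    S.map f = S.map g := by
  cases S with
  | fin l => exact congrArg fin (List.map_congr_left h)
  | inc l => exact congrArg inc (List.map_congr_left h)
  | inf s => exact congrArg inf (Stream'.ext fun n => h _ ⟨n, rfl⟩)

theorem concat_map (l : List α) (S : PSeq α) (f : α → β) :
    (concat l S).map f = concat (l.map f) (S.map f) := by
  cases S <;> simp [concat, map, Stream'.map_append_stream]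

theorem box_map (A B : PSeq α) (f : α → β) : (A.box B).map f = (A.map f).box (B.map f) := by
  cases A with
  | fin l => exact concat_map l B f
  | inc l => rfl
  | inf s => rfl

/-- Elementwise images and `bind`, for compact sequences. -/
theorem map_bind_eq {p : α → Prop} {S : PSeq α} (hS : AllC p S) {f : α → β} {F : β → PSeq β}
    {G : α → PSeq α} (h : ∀ a, p a → F (f a) = (G a).map f) :
    (S.map f).bind F = (S.bind G).map f := by
  have key : ∀ l : List α, (∀ a ∈ l, p a) →
      (fin (l.map f)).bind F = ((fin l).bind G).map f := fun l hl => by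
    induction l with
    | nil => rfl
    | cons a l ih =>
      rw [List.map_cons, fin_cons_bind, fin_cons_bind, box_map, h a (hl a (by simp)),
        ih fun b hb => hl b (by simp [hb])]
  cases S with
  | inf s => exact hS.1.elim
  | fin l => exact key l hS.2
  | inc l =>
    change (inc (l.map f)).bind F = _
    rw [inc_bind, inc_bind, box_map, key l hS.2]
    rfl

theorem ne_fin_of_bind {S : PSeq α} {F : α → PSeq β} {l : List β} (h : S.bind F = fin l) :
    ∃ l', S = fin l' := by
  have hinc : ∀ l', (inc l').bind F ≠ fin l := fun l' h => by
    rw [inc_bind] at h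
    cases hA : (fin l').bind F <;> rw [hA] at h <;> simp [box, concat] at h
  cases S with
  | fin l' => exact ⟨l', rfl⟩
  | inc l' => exact (hinc _ h).elim
  | inf s =>
    obtain ⟨n, hn⟩ := (inf_bind s F).2 (fin l) trivial h.ge
    exact (hinc _ (eq_of_fin_le (hn n le_rfl))).elim

theorem eq_nil_or_head (S : PSeq α) : S = fin [] ∨ S = inc [] ∨ ∃ a, inc [a] ≤ S := by
  cases S with
  | fin l =>
    cases l with
    | nil => exact Or.inl rfl
    | cons a l => exact Or.inr (Or.inr ⟨a, inc_le_fin.2 (List.prefix_append [a] l)⟩)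
  | inc l =>
    cases l with
    | nil => exact Or.inr (Or.inl rfl)
    | cons a l => exact Or.inr (Or.inr ⟨a, inc_le_inc.2 (List.prefix_append [a] l)⟩)
  | inf s => exact Or.inr (Or.inr ⟨s.head, inc_le_inf.2 rfl⟩)

/-- What a cut can see of an approximation: either nothing yet, or already the final first element.
-/
theorem eq_inc_nil_or_head {S S' : PSeq α} (h : S ≤ S') {a : α} (ha : inc [a] ≤ S') :
    S = inc [] ∨ inc [a] ≤ S := by
  cases S with
  | fin l => exact Or.inr (eq_of_fin_le h ▸ ha)
  | inf s => exact Or.inr (eq_of_inf_le h ▸ ha)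
  | inc l =>
    cases l with
    | nil => exact Or.inl rfl
    | cons b l =>
      refine Or.inr ?_
      obtain ⟨T, rfl⟩ := inc_le_iff.1 h
      obtain ⟨T', hT'⟩ := inc_le_iff.1 ha
      have : b = a := by
        cases T <;> cases T' <;>
          simp only [concat, fin.injEq, inc.injEq, inf.injEq, reduceCtorEq, List.cons_append,
            List.cons.injEq, Stream'.cons_append_stream] at hT'
        · exact hT'.1
        · exact hT'.1
        · exact (Stream'.cons_injective2 hT').1
      rw [this]
      exact inc_le_inc.2 (List.prefix_append [a] l)

end PSeq

/-! ### Continuity of `tcb` and the least fixpoint. -/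

section Continuity

variable {L : FirstOrder.Language.{u, v}} {SV : Type w} {N : Type x} {ar : N → ℕ}
  {C : Canon L SV}

open PSeq

/-- The effect of a literal other than a cut on one program substitution. -/
noncomputable def litSem [Nonempty SV] (b : Behavior C ar) {m : ℕ} :
    Literal L ar m → CPS C m → PSeq (CPS C m)
  | .call p a => fun θ => extG C a θ (b p (restrG C a θ))
  | .eqVar a => fun θ => extG C a θ (unifVar C (restrG C a θ))
  | .eqFun f a => fun θ => extG C a θ (unifFunc C f (restrG C a θ))
  | .cut => fun θ => .fin [θ]

variable [Nonempty SV] {m : ℕ}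

theorem semLiteral_of_ne_cut (b : Behavior C ar) (V : PSeq (CPS C m) × CutFlag)
    {l : Literal L ar m} (hl : l ≠ .cut) :
    semLiteral b V l = (V.1.bind (litSem b l), V.2) := by
  obtain ⟨S, cf⟩ := V
  cases l with
  | cut => exact (hl rfl).elim
  | call p a => simp [semLiteral, litSem]
  | eqVar a => simp [semLiteral, litSem]
  | eqFun f a => simp [semLiteral, litSem]

theorem semLiteral_cut_of_head (b : Behavior C ar) {S : PSeq (CPS C m)} {θ : CPS C m}
    (h : inc [θ] ≤ S) (cf : CutFlag) :
    semLiteral b (S, cf) .cut = (.fin [θ], .cut) := by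
  cases S with
  | fin l => obtain ⟨l', rfl⟩ := inc_le_fin.1 h; rfl
  | inc l => obtain ⟨l', rfl⟩ := inc_le_inc.1 h; rfl
  | inf s =>
    have : s.head = θ := by
      have := inc_le_inf.1 h
      simpa [Stream'.take_succ] using this
    simp [semLiteral, this]

/-- `V'` is the limit of the pairs `V n`. -/
def LimP {α : Type*} (V : ℕ → PSeq α × CutFlag) (V' : PSeq α × CutFlag) : Prop :=
  Lim (fun n => (V n).1) V'.1 ∧ ∀ n l, (V n).1 = fin l → (V n).2 = V'.2

/-- The flag is read only if the first sequence is finite; otherwise that sequence absorbs what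
follows. So flags have to agree only at finite approximations. -/
theorem LimP.boxCut {α : Type*} {V : ℕ → PSeq α × CutFlag} {V' : PSeq α × CutFlag}
    (hV : LimP V V') {S : ℕ → PSeq α} {S' : PSeq α} (hS : Lim S S') :
    Lim (fun n => PrologCut.boxCut (V n) (S n)) (PrologCut.boxCut V' S') := by
  obtain ⟨S₁, cf⟩ := V'
  cases cf with
  | nocut =>
    have : (fun n => PrologCut.boxCut (V n) (S n)) = fun n => (V n).1.box (S n) := funext fun n => by
      have := hV.2 n
      rcases hVn : V n with ⟨A, cf⟩
      rw [hVn] at this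
      cases cf with
      | nocut => rfl
      | cut =>
        cases A with
        | fin l => exact absurd (this l rfl) (by simp)
        | inc l => rfl
        | inf l => rfl
    rw [this]
    exact hV.1.box hS
  | cut =>
    have : (fun n => PrologCut.boxCut (V n) (S n)) = fun n => (V n).1 := funext fun n => by
      have := hV.2 n
      rcases hVn : V n with ⟨A, cf⟩
      rw [hVn] at this
      cases cf with
      | cut => rfl
      | nocut =>
        cases A with
        | fin l => exact absurd (this l rfl) (by simp)
        | inc l => rfl
        | inf l => rfl
    rw [this]
    exact hV.1

theorem lim_litSem {b : ℕ → Behavior C ar} {b' : Behavior C ar}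
    (hb : ∀ p θ, Lim (fun n => b n p θ) (b' p θ)) (l : Literal L ar m) (θ : CPS C m) :
    Lim (fun n => litSem (b n) l θ) (litSem b' l θ) := by
  cases l with
  | call p a => exact (hb p _).map _
  | eqVar a => exact Lim.const _
  | eqFun f a => exact Lim.const _
  | cut => exact Lim.const _

/-- For a cut, only the first element counts. If the limit has none, neither has any approximation,
and the cut acts as the identity throughout. Otherwise the values are ⊥ until the first element
appears and constant afterwards. Other literals are binds; a bind that is finite has a finite
argument, so the flag condition is inherited. -/
theorem LimP.semLiteral {b : ℕ → Behavior C ar} {b' : Behavior C ar}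
    (hb : ∀ p θ, Lim (fun n => b n p θ) (b' p θ)) {V : ℕ → PSeq (CPS C m) × CutFlag}
    {V' : PSeq (CPS C m) × CutFlag} (hV : LimP V V') (l : Literal L ar m) :
    LimP (fun n => PrologCut.semLiteral (b n) (V n) l) (PrologCut.semLiteral b' V' l) := by
  by_cases hl : l = .cut
  · subst hl
    have hid : ∀ (b : Behavior C ar) (W : PSeq (CPS C m) × CutFlag),
        W.1 = fin [] ∨ W.1 = inc [] → PrologCut.semLiteral b W .cut = W := by
      rintro b ⟨A, cf⟩ (h | h) <;> (change A = _ at h; subst h; rfl)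
    have of_id : V'.1 = fin [] ∨ V'.1 = inc [] →
        LimP (fun n => PrologCut.semLiteral (b n) (V n) .cut)
          (PrologCut.semLiteral b' V' .cut) := fun h => by
      have h' : ∀ n, (V n).1 = fin [] ∨ (V n).1 = inc [] := fun n => by
        have hle := hV.1.1 n
        rcases h with h | h
        · rcases hVn : (V n).1 with l | l | s <;> simp only [h, hVn] at hle
          · cases eq_of_fin_le hle; exact Or.inl rfl
          · rw [inc_le_fin, List.prefix_nil] at hle; rw [hle]; exact Or.inr rfl
          · cases eq_of_inf_le hle
        · rcases hVn : (V n).1 with l | l | s <;> simp only [h, hVn] at hle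
          · cases eq_of_fin_le hle
          · rw [inc_le_inc, List.prefix_nil] at hle; rw [hle]; exact Or.inr rfl
          · cases eq_of_inf_le hle
      rw [hid _ _ h, funext fun n => hid (b n) (V n) (h' n)]
      exact hV
    rcases eq_nil_or_head V'.1 with h | h | ⟨θ, hθ⟩
    · exact of_id (Or.inl h)
    · exact of_id (Or.inr h)
    · have hV' : PrologCut.semLiteral b' V' .cut = (.fin [θ], .cut) :=
        semLiteral_cut_of_head b' hθ V'.2
      have hVn : ∀ n, inc [θ] ≤ (V n).1 →
          PrologCut.semLiteral (b n) (V n) .cut = (.fin [θ], .cut) :=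
        fun n h => semLiteral_cut_of_head (b n) h (V n).2
      have hcases : ∀ n, PrologCut.semLiteral (b n) (V n) .cut = (.fin [θ], .cut) ∨
          (PrologCut.semLiteral (b n) (V n) .cut).1 = inc [] := fun n => by
        rcases eq_inc_nil_or_head (hV.1.1 n) hθ with h | h
        · exact Or.inr (by rw [hid _ _ (Or.inr h)]; exact h)
        · exact Or.inl (hVn n h)
      obtain ⟨n₀, hn₀⟩ := hV.1.2 (inc [θ]) trivial hθ
      rw [hV']
      refine ⟨⟨fun n => ?_, fun X _ hX' => ⟨n₀, fun n hn => ?_⟩⟩, fun n l h => ?_⟩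
      · rcases hcases n with h | h
        · simp only [h]; exact le_rfl
        · simp only [h]; exact inc_nil_le _
      · simp only [hVn n (hn₀ n hn)]
        exact hX'
      · rcases hcases n with h' | h'
        · exact congrArg Prod.snd h'
        · exact absurd (h'.symm.trans h) (by simp)
  · simp only [semLiteral_of_ne_cut _ _ hl]
    refine ⟨hV.1.bind fun a => lim_litSem hb l a, fun n l' h => ?_⟩
    obtain ⟨l'', h'⟩ := ne_fin_of_bind h
    exact hV.2 n l'' h'

theorem LimP.foldl_semLiteral {b : ℕ → Behavior C ar} {b' : Behavior C ar}
    (hb : ∀ p θ, Lim (fun n => b n p θ) (b' p θ)) (g : List (Literal L ar m))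
    {V : ℕ → PSeq (CPS C m) × CutFlag} {V' : PSeq (CPS C m) × CutFlag} (hV : LimP V V') :
    LimP (fun n => g.foldl (PrologCut.semLiteral (b n)) (V n))
      (g.foldl (PrologCut.semLiteral b') V') := by
  induction g generalizing V V' with
  | nil => exact hV
  | cons l g ih => exact ih (hV.semLiteral hb l)

theorem lim_semClause {b : ℕ → Behavior C ar} {b' : Behavior C ar}
    (hb : ∀ p θ, Lim (fun n => b n p θ) (b' p θ)) (c : Clause L ar m) (θ : CPS C m) :
    LimP (fun n => semClause (b n) c θ) (semClause b' c θ) := by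
  have h := LimP.foldl_semLiteral hb c.body
    (V := fun _ => extC C c.extra θ) (V' := extC C c.extra θ) ⟨Lim.const _, fun _ _ _ => rfl⟩
  refine ⟨h.1.map _, fun n l hl => ?_⟩
  change PSeq.map _ (List.foldl (semLiteral (b n)) (extC C c.extra θ) c.body).1 = _ at hl
  cases hS : (List.foldl (semLiteral (b n)) (extC C c.extra θ) c.body).1 with
  | fin l' => exact h.2 n l' hS
  | inc l' => rw [hS] at hl; cases hl
  | inf l' => rw [hS] at hl; cases hl

theorem lim_semProcedure {b : ℕ → Behavior C ar} {b' : Behavior C ar}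
    (hb : ∀ p θ, Lim (fun n => b n p θ) (b' p θ)) (pr : Procedure L ar m) (θ : CPS C m) :
    Lim (fun n => semProcedure (b n) pr θ) (semProcedure b' pr θ) := by
  induction pr with
  | last c => exact (lim_semClause hb c θ).1
  | cons c pr ih => exact (lim_semClause hb c θ).boxCut ih

theorem tcb_mono (P : Program L ar) : Monotone (tcb (C := C) P) := by
  intro b b' h p θ
  -- Monotonicity is continuity for the chain `b, b', b', …`.
  have := lim_semProcedure (b := fun n => if n = 0 then b else b') (b' := b') (fun p θ => by
    refine ⟨fun n => ?_, fun X _ hX => ⟨1, fun n hn => ?_⟩⟩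
    · by_cases hn : n = 0
      · simp only [hn, if_true]; exact h p θ
      · simp only [hn, if_false]; exact le_rfl
    · simp only [show n ≠ 0 by omega, if_false]; exact hX) (P p) θ
  have h₀ : semProcedure b (P p) θ ≤ semProcedure b' (P p) θ := by simpa using this.1 0
  exact h₀

/-- The approximations of the concrete semantics. -/
noncomputable def approx (P : Program L ar) : ℕ → Behavior C ar
  | 0 => fun _ _ => .inc []
  | n + 1 => tcb P (approx P n)

theorem approx_mono (P : Program L ar) : Monotone (approx (C := C) P) := by
  refine monotone_nat_of_le_succ fun n => ?_
  induction n with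
  | zero => exact fun p θ => inc_nil_le _
  | succ n ih => exact tcb_mono P ih

/-- The limit of the approximations. -/
noncomputable def semantics (P : Program L ar) : Behavior C ar :=
  fun p θ => lub fun n => approx P n p θ

theorem lim_semantics (P : Program L ar) (p : N) (θ : CPS C (ar p)) :
    Lim (fun n => approx P n p θ) (semantics P p θ) :=
  lim_lub fun _ _ h => approx_mono P h p θ

theorem semantics_fixpoint (P : Program L ar) :
    (semantics P : Behavior C ar) = tcb P (semantics P) := by
  funext p θ
  exact (lim_semantics P p θ).succ.unique (lim_semProcedure (lim_semantics P) (P p) θ)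

theorem semantics_le (P : Program L ar) {b : Behavior C ar} (hb : b = tcb P b) :
    semantics P ≤ b := by
  have h : ∀ n, approx P n ≤ b := fun n => by
    induction n with
    | zero => exact fun p θ => inc_nil_le _
    | succ n ih => rw [hb]; exact tcb_mono P ih
  intro p θ
  refine (lim_semantics P p θ).isLUB.2 ?_
  rintro _ ⟨n, rfl⟩
  exact h n p θ

end Continuity

/-! ### Compactness of the approximations, and results as instances of arguments. -/

section Solutions

variable {L : FirstOrder.Language.{u, v}} {SV : Type w} {C : Canon L SV}

open PSeq

theorem CPS.IsSol.allC {m : ℕ} {E : CPS C m → Prop} {θ : CPS C m} {S : PSeq (CPS C m)}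
    (h : IsSol E θ S) : S.AllC (θ ≤ ·) := by
  rcases h with ⟨r, rfl, h⟩ | ⟨rfl, _⟩
  · exact .fin (by simpa using h.1.1)
  · exact .fin (by simp)

theorem allC_unifVar (θ : CPS C 2) : (unifVar C θ).AllC (θ ≤ ·) :=
  (CPS.isSol_unif (.var 0) (.var 1) θ).allC

theorem allC_unifFunc {k : ℕ} (f : L.Functions k) (θ : CPS C (k + 1)) :
    (unifFunc C f θ).AllC (θ ≤ ·) :=
  (CPS.isSol_unif (.var 0) (.func f fun j => .var j.succ) θ).allC

end Solutions

section Invariants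

variable {L : FirstOrder.Language.{u, v}} {SV : Type w} {N : Type x} {ar : N → ℕ}
  {C : Canon L SV} [Infinite SV] {m : ℕ}

open PSeq

/-- Concrete behaviors the values of which are compact. -/
def IsGood (b : Behavior C ar) : Prop := ∀ p θ, (b p θ).AllC (θ ≤ ·)

theorem allC_extG {n : ℕ} (a : Fin m ↪ Fin n) (θ : CPS C n) {S : PSeq (CPS C m)}
    (hS : S.AllC (θ.restr a ≤ ·)) : (extG C a θ S).AllC (θ ≤ ·) :=
  hS.map fun _ h => (CPS.isExt_ext a h).1

theorem allC_litSem {b : Behavior C ar} (hb : IsGood b) (l : Literal L ar m) (θ : CPS C m) :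
    (litSem b l θ).AllC (θ ≤ ·) := by
  cases l with
  | call p a => exact allC_extG a θ (hb p _)
  | eqVar a => exact allC_extG a θ (allC_unifVar _)
  | eqFun f a => exact allC_extG a θ (allC_unifFunc f _)
  | cut => exact .fin (by simp)

theorem allC_semLiteral {b : Behavior C ar} (hb : IsGood b) {V : PSeq (CPS C m) × CutFlag}
    {θ : CPS C m} (hV : V.1.AllC (θ ≤ ·)) (l : Literal L ar m) :
    (semLiteral b V l).1.AllC (θ ≤ ·) := by
  by_cases hl : l = .cut
  · subst hl
    obtain ⟨S, cf⟩ := V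
    rcases S with (_ | ⟨a, l⟩) | (_ | ⟨a, l⟩) | s
    · exact hV
    · exact .fin (by simpa using hV.2 a (List.mem_cons_self ..))
    · exact hV
    · exact .fin (by simpa using hV.2 a (List.mem_cons_self ..))
    · exact hV.1.elim
  · rw [semLiteral_of_ne_cut _ _ hl]
    exact hV.bind fun a ha => (allC_litSem hb l a).imp fun _ h => le_trans ha h

theorem allC_foldl_semLiteral {b : Behavior C ar} (hb : IsGood b) (g : List (Literal L ar m))
    {V : PSeq (CPS C m) × CutFlag} {θ : CPS C m} (hV : V.1.AllC (θ ≤ ·)) :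
    (g.foldl (semLiteral b) V).1.AllC (θ ≤ ·) := by
  induction g generalizing V with
  | nil => exact hV
  | cons l g ih => exact ih (allC_semLiteral hb hV l)

theorem allC_extC (e : ℕ) (θ : CPS C m) : (extC C e θ).1.AllC (θ.up e ≤ ·) := by
  rw [extC_eq]
  exact .fin (by simp)

theorem allC_semClause {b : Behavior C ar} (hb : IsGood b) (c : Clause L ar m) (θ : CPS C m) :
    (semClause b c θ).1.AllC (θ ≤ ·) := by
  refine (allC_foldl_semLiteral hb c.body (allC_extC c.extra θ)).map fun x hx => ?_
  have := CPS.restr_mono (Fin.castAdd c.extra) hx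
  rwa [(CPS.isUp_up θ).1] at this

theorem allC_semProcedure {b : Behavior C ar} (hb : IsGood b) (pr : Procedure L ar m)
    (θ : CPS C m) : (semProcedure b pr θ).AllC (θ ≤ ·) := by
  induction pr with
  | last c => exact allC_semClause hb c θ
  | cons c pr ih =>
    have h := allC_semClause hb c θ
    rw [semProcedure]
    revert h
    rcases semClause b c θ with ⟨S, _ | _⟩ <;> intro h
    · exact h
    · exact h.box ih

/-- Compactness allows list induction over all values of an approximation; infinite sequences occur
only in the limit. -/
theorem isGood_approx (P : Program L ar) (n : ℕ) : IsGood (approx (C := C) P n) := by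
  induction n with
  | zero => exact fun p θ => .inc (by simp)
  | succ n ih => exact fun p θ => allC_semProcedure ih (P p) θ

theorem isConcreteSemantics_semantics (P : Program L ar) :
    IsConcreteSemantics P (semantics P : Behavior C ar) := by
  refine ⟨⟨isConcreteBehavior_iff.2 fun p θ θ' h => ?_, semantics_fixpoint P⟩,
    fun b hb => semantics_le P hb.2⟩
  obtain ⟨n, hn⟩ := (lim_semantics P p θ).exists_mem_elems h
  exact (isGood_approx P n p θ).2 θ' hn

end Invariants

/-! ### Execution in a larger context. -/

section Locality

variable {L : FirstOrder.Language.{u, v}} {SV : Type w} {N : Type x} {ar : N → ℕ}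
  {C : Canon L SV} [Infinite SV] {m n : ℕ}

open PSeq

/-- Renaming of the program variables of a literal. -/
def Literal.lmap (e : Fin m ↪ Fin n) : Literal L ar m → Literal L ar n
  | .call p a => .call p (a.trans e)
  | .eqVar a => .eqVar (a.trans e)
  | .eqFun f a => .eqFun f (a.trans e)
  | .cut => .cut

theorem extG_ext (e : Fin m ↪ Fin n) {k : ℕ} (a : Fin k ↪ Fin m) {θ : CPS C n} {θi : CPS C m}
    (h : θ.restr e ≤ θi) {S : PSeq (CPS C k)} (hS : S.AllC (θi.restr a ≤ ·)) :
    extG C (a.trans e) (CPS.ext e θ θi) S = (extG C a θi S).map (CPS.ext e θ) := by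
  rw [extG_eq, extG_eq, map_map]
  exact map_congr fun θj hj => CPS.ext_ext e a h (hS.2 θj hj)

theorem restrG_ext (e : Fin m ↪ Fin n) {k : ℕ} (a : Fin k ↪ Fin m) {θ : CPS C n} {θi : CPS C m}
    (h : θ.restr e ≤ θi) : restrG C (a.trans e) (CPS.ext e θ θi) = restrG C a θi := by
  rw [restrG_eq, restrG_eq, Function.Embedding.coe_trans, ← CPS.restr_restr,
    (CPS.isExt_ext e h).2.1]

theorem litSem_lmap {b : Behavior C ar} (hb : IsGood b) (e : Fin m ↪ Fin n) (l : Literal L ar m)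
    {θ : CPS C n} {θi : CPS C m} (h : θ.restr e ≤ θi) :
    litSem b (l.lmap e) (CPS.ext e θ θi) = (litSem b l θi).map (CPS.ext e θ) := by
  cases l with
  | call p a =>
    simp only [litSem, Literal.lmap, restrG_ext e a h]
    exact extG_ext e a h (hb p _)
  | eqVar a =>
    simp only [litSem, Literal.lmap, restrG_ext e a h]
    exact extG_ext e a h (allC_unifVar _)
  | eqFun f a =>
    simp only [litSem, Literal.lmap, restrG_ext e a h]
    exact extG_ext e a h (allC_unifFunc f _)
  | cut => rfl

theorem Literal.lmap_eq_cut {e : Fin m ↪ Fin n} {l : Literal L ar m} :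
    l.lmap e = .cut ↔ l = .cut := by
  cases l <;> simp [lmap]

/-- Each literal commutes with the extension to the larger context by `CPS.ext_ext`, and a cut only
inspects the shape of the sequence; so whole bodies commute with it. -/
theorem foldl_semLiteral_lmap {b : Behavior C ar} (hb : IsGood b) (e : Fin m ↪ Fin n)
    (g : List (Literal L ar m)) {θ : CPS C n} {V : PSeq (CPS C m) × CutFlag}
    (hV : V.1.AllC (θ.restr e ≤ ·)) :
    (g.map (Literal.lmap e)).foldl (semLiteral b) (V.1.map (CPS.ext e θ), V.2) =
      ((g.foldl (semLiteral b) V).1.map (CPS.ext e θ), (g.foldl (semLiteral b) V).2) := by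
  induction g generalizing V with
  | nil => rfl
  | cons l g ih =>
    have : semLiteral b (V.1.map (CPS.ext e θ), V.2) (l.lmap e) =
        ((semLiteral b V l).1.map (CPS.ext e θ), (semLiteral b V l).2) := by
      by_cases hl : l = .cut
      · subst hl
        obtain ⟨S, cf⟩ := V
        rcases S with (_ | ⟨a, l⟩) | (_ | ⟨a, l⟩) | s
        · rfl
        · rfl
        · rfl
        · rfl
        · exact hV.1.elim
      · rw [semLiteral_of_ne_cut _ _ hl, semLiteral_of_ne_cut _ _ (mt Literal.lmap_eq_cut.1 hl)]
        exact Prod.ext (map_bind_eq hV fun a ha => litSem_lmap hb e l ha) rfl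
    rw [List.map_cons, List.foldl_cons, List.foldl_cons, this]
    exact ih (allC_semLiteral hb hV l)

/-- The value of a clause is determined by the execution of its body in a larger context. -/
theorem extG_semClause {b : Behavior C ar} (hb : IsGood b) (a : Fin m ↪ Fin n)
    (c : Clause L ar m) (θ : CPS C n) :
    (extG C a θ (semClause b c (restrG C a θ)).1, (semClause b c (restrG C a θ)).2) =
      restrC C ((c.body.map (Literal.lmap (liftEmb c.extra a))).foldl (semLiteral b)
        (.fin [θ.up c.extra], .nocut)) := by
  have hup : (θ.up c.extra).restr (liftEmb c.extra a) = (θ.restr a).up c.extra :=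
    CPS.restr_up a θ
  have hV := allC_extC c.extra (θ.restr a)
  have hV' : (extC C c.extra (θ.restr a)).1.AllC ((θ.up c.extra).restr (liftEmb c.extra a) ≤ ·) :=
    hup ▸ hV
  have h := foldl_semLiteral_lmap hb (liftEmb c.extra a) c.body hV'
  -- The context at clause entry is the extension of itself by its own restriction.
  have h₀ : (extC C c.extra (θ.restr a)).1.map (CPS.ext (liftEmb c.extra a) (θ.up c.extra)) =
      .fin [θ.up c.extra] := by
    rw [extC_eq]
    simp only [PSeq.map, List.map_cons, List.map_nil]
    rw [CPS.ext_eq (r := θ.up c.extra) ⟨le_rfl, hup, fun x hx _ => hx⟩]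
  have h₁ : (extC C c.extra (θ.restr a)).2 = CutFlag.nocut := rfl
  rw [h₀, h₁] at h
  rw [h]
  have hS := allC_foldl_semLiteral hb c.body hV'
  change (PSeq.map _ (PSeq.map _ _), _) = (PSeq.map _ (PSeq.map _ _), _)
  rw [map_map, map_map]
  refine Prod.ext (map_congr fun s hs => ?_) rfl
  exact CPS.ext_eq (CPS.IsExt.restr_castAdd (CPS.isExt_ext _ (hS.2 s hs)))

end Locality

end PrologCut

namespace PrologCut

/-! ### Representation of tree nodes by program substitutions. -/

section Goals

variable {L : FirstOrder.Language.{u, v}} {SV : Type w} {N : Type x} {ar : N → ℕ}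
  {C : Canon L SV} {m n : ℕ}

open FirstOrder.Language (Term)

/-- The instance of a literal under a program substitution, as a literal of a goal. -/
def Literal.instT (η : PS L SV m) (b : Addr) : Literal L ar m → GoalLit L SV ar
  | .call p a => .call p fun j => η (a j)
  | .eqVar a => .eq (η (a 0)) (η (a 1))
  | .eqFun f a => .eq (η (a 0)) (.func f fun j => η (a j.succ))
  | .cut => .cut b

theorem Literal.inst_eq_instT (y : Fin m ↪ SV) (b : Addr) (l : Literal L ar m) :
    l.inst y b = l.instT (fun j => .var (y j)) b := by
  cases l <;> rfl

theorem Literal.app_instT (η : PS L SV m) (b : Addr) (μ : StdSubst L SV) (l : Literal L ar m) :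
    (l.instT η b).app μ = l.instT (η.app μ) b := by
  cases l <;> rfl

theorem Literal.instT_lmap (η : PS L SV n) (b : Addr) (e : Fin m ↪ Fin n) (l : Literal L ar m) :
    (l.lmap e).instT η b = l.instT (fun j => η (e j)) b := by
  cases l <;> rfl

/-- The goal that is given by a list of literals, with the addresses of their parent goals, and by
a program substitution. -/
def instGoal (η : PS L SV m) (gl : List (Literal L ar m × Addr)) : List (GoalLit L SV ar) :=
  gl.map fun l => l.1.instT η l.2

theorem map_app_instGoal (η : PS L SV m) (μ : StdSubst L SV) (gl : List (Literal L ar m × Addr)) :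
    (instGoal η gl).map (GoalLit.app μ) = instGoal (η.app μ) gl := by
  simp [instGoal, Literal.app_instT]

/-- Renaming of the program variables of a list of literals. -/
def liftGoal (e : Fin m ↪ Fin n) (gl : List (Literal L ar m × Addr)) :
    List (Literal L ar n × Addr) :=
  gl.map fun l => (l.1.lmap e, l.2)

theorem instGoal_liftGoal (η : PS L SV n) (e : Fin m ↪ Fin n) (gl : List (Literal L ar m × Addr)) :
    instGoal η (liftGoal e gl) = instGoal (fun j => η (e j)) gl := by
  simp [instGoal, liftGoal, Literal.instT_lmap]

theorem cut_mem_liftGoal {e : Fin m ↪ Fin n} {gl : List (Literal L ar m × Addr)} {b : Addr} :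
    (Literal.cut, b) ∈ liftGoal e gl ↔ (Literal.cut, b) ∈ gl := by
  constructor
  · intro h
    obtain ⟨⟨l, b'⟩, hl, h⟩ := List.mem_map.1 h
    simp only [Prod.mk.injEq, Literal.lmap_eq_cut] at h
    rwa [h.1, h.2] at hl
  · exact fun h => List.mem_map.2 ⟨_, h, rfl⟩

/-- The node `ν` at address `a` is represented by the program substitution `η` and the literals
`gl`.  The variables of the query are bound to the components of `η` given by `q`. -/
structure Rep {k : ℕ} (t : PS L SV k) (q : Fin k → Fin m) (a : Addr) (ν : Node L SV ar)
    (η : PS L SV m) (gl : List (Literal L ar m × Addr)) : Prop where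
  goal : ν.goal = instGoal η gl
  ans : t.app ν.subst = fun i => η (q i)
  codom : η.codom ⊆ ν.used
  finite : ν.used.Finite
  parent : ∀ b, (Literal.cut, b) ∈ gl → b <+: a ∧ b ≠ a

theorem Rep.of_lift {k : ℕ} {t : PS L SV k} {q : Fin k → Fin m} {a : Addr} {ν : Node L SV ar}
    {e : Fin m ↪ Fin n} {η : PS L SV n} {gl : List (Literal L ar m × Addr)}
    (h : Rep t (e ∘ q) a ν η (liftGoal e gl)) : Rep t q a ν (fun j => η (e j)) gl where
  goal := by rw [h.goal, instGoal_liftGoal]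
  ans := h.ans
  codom := (PS.codom_comp_subset η e).trans h.codom
  finite := h.finite
  parent b hb := h.parent b (cut_mem_liftGoal.2 hb)

theorem StdSubst.finite_codom (μ : StdSubst L SV) : μ.codom.Finite :=
  Set.Finite.biUnion μ.finite_dom fun _ _ => finite_tvars _

theorem PS.codom_app_subset (η : PS L SV m) (μ : StdSubst L SV) :
    (η.app μ).codom ⊆ η.codom ∪ μ.dom ∪ μ.codom := fun v hv => by
  obtain ⟨x, hx, hvx⟩ := mem_codom_sub.1 hv
  by_cases hd : x ∈ μ.dom
  · exact Or.inr (Set.mem_biUnion hd hvx)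
  · rw [show μ.toFun x = .var x from not_not.1 hd, mem_tvars_var] at hvx
    exact Or.inl (Or.inl (hvx ▸ hx))

theorem strict_prefix_append {a b : Addr} (h : b <+: a) (i : ℕ) : b <+: a ++ [i] ∧ b ≠ a ++ [i] := by
  refine ⟨h.trans (List.prefix_append _ _), ?_⟩
  rintro rfl
  have := h.length_le
  simp at this

theorem Child.cut_inv {P : Program L ar} {a b : Addr} {G : List (GoalLit L SV ar)}
    {σ : StdSubst L SV} {U : Set SV} {i : ℕ} {ν' : Node L SV ar}
    (h : Child P a ⟨.cut b :: G, σ, U⟩ i ν') : ν' = ⟨G, σ, U⟩ := by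
  cases h
  rfl

theorem Child.eq_inv {P : Program L ar} {a : Addr} {s t : L.Term SV} {G : List (GoalLit L SV ar)}
    {σ : StdSubst L SV} {U : Set SV} {i : ℕ} {ν' : Node L SV ar}
    (h : Child P a ⟨.eq s t :: G, σ, U⟩ i ν') :
    ∃ μ : StdSubst L SV, μ.IsMGU (fun _ : Unit => s) (fun _ : Unit => t) ∧
      ν' = ⟨G.map (GoalLit.app μ), σ.comp μ, U ∪ μ.dom ∪ μ.codom⟩ := by
  cases h with
  | eq _ _ _ _ μ _ hμ => exact ⟨μ, hμ, rfl⟩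

theorem Child.call_inv {P : Program L ar} {a : Addr} {p : N} {t : Fin (ar p) → L.Term SV}
    {G : List (GoalLit L SV ar)} {σ : StdSubst L SV} {U : Set SV} {i : ℕ} {ν' : Node L SV ar}
    (h : Child P a ⟨.call p t :: G, σ, U⟩ i ν') :
    ∃ (c : Clause L ar (ar p)) (y : Fin (ar p + c.extra) ↪ SV) (μ : StdSubst L SV),
      (P p).clauses[i]? = some c ∧ (∀ j, y j ∉ U) ∧
      μ.IsMGU t (fun j => .var (y (Fin.castAdd c.extra j))) ∧
      ν' = ⟨(c.body.map (Literal.inst y a) ++ G).map (GoalLit.app μ), σ.comp μ,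
        U ∪ Set.range y ∪ μ.dom ∪ μ.codom⟩ := by
  cases h with
  | call _ _ _ _ μ _ _ c hc y hy hμ => exact ⟨c, y, μ, hc, hy, hμ, rfl⟩

/-- The simultaneous replacement of the variables `y j` with the terms `t j` solves the equations
between the components of a call and the head of a renamed clause. -/
theorem exists_head_unifier {e : ℕ} {t : PS L SV n} {y : Fin (n + e) ↪ SV} :
    ∃ f : SV → L.Term SV, (∀ j, f (y (Fin.castAdd e j)) = t j) ∧
      ∀ v, (∀ j, v ≠ y (Fin.castAdd e j)) → f v = .var v := by
  classical
  refine ⟨fun v => if h : ∃ j, y (Fin.castAdd e j) = v then t h.choose else .var v,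
    fun j => ?_, fun v hv => ?_⟩
  · have h : ∃ j', y (Fin.castAdd e j') = y (Fin.castAdd e j) := ⟨j, rfl⟩
    simp only [dif_pos h]
    congr 1
    exact Fin.castAdd_injective _ _ (y.injective h.choose_spec)
  · refine dif_neg ?_
    rintro ⟨j, hj⟩
    exact hv j hj.symm

theorem exists_head_mgu {e : ℕ} {t : PS L SV n} {y : Fin (n + e) ↪ SV} (hy : ∀ j, y j ∉ t.codom) :
    ∃ μ : StdSubst L SV, μ.IsMGU t (fun j => .var (y (Fin.castAdd e j))) := by
  obtain ⟨f, hf, hf'⟩ := exists_head_unifier (t := t) (y := y)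
  refine exists_isMGU (f := f) fun j => ?_
  simp only [Term.subst, hf]
  conv_rhs => rw [← subst_var (t j)]
  rw [subst_eq_subst_iff]
  intro v hv
  refine hf' v ?_
  rintro j' rfl
  exact hy _ (PS.mem_codom.2 ⟨j, hv⟩)

/-- The program substitution after the resolution of a call. -/
theorem canon_app_head_mgu [Infinite SV] {e : ℕ} {η : PS L SV m} {a : Fin n ↪ Fin m}
    {y : Fin (n + e) ↪ SV}
    (hy : ∀ j, y j ∉ η.codom) {μ : StdSubst L SV}
    (hμ : μ.IsMGU (fun j => η (a j)) (fun j => .var (y (Fin.castAdd e j)))) :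
    C.canon (PS.app (Fin.append η fun j => .var (y (Fin.natAdd n j))) μ) = (C.canon η).up e := by
  rw [CPS.up_canon (y := fun j => y (Fin.natAdd n j))
    (fun i j h => by simpa [Fin.ext_iff] using y.injective h) (fun j => hy _)]
  refine le_antisymm ?_ (C.canon_le_canon_iff.2 ⟨_, rfl⟩)
  obtain ⟨f, hf, hf'⟩ := exists_head_unifier (t := fun j => η (a j)) (y := y)
  have hη : ∀ v ∈ η.codom, f v = .var v := fun v hv => hf' v (by
    rintro j rfl
    exact hy _ hv)
  rw [C.canon_le_canon_iff]
  -- Binding the fresh head variables to the arguments is a unifier that fixes `η` and the remaining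
  -- clause variables. It factors through `μ`, so `μ` only renames these.
  obtain ⟨g, hg⟩ := hμ.exists_sub_eq (f := f) (fun j => by
    simp only [Term.subst, hf]
    conv_rhs => rw [← subst_var (η (a j))]
    rw [subst_eq_subst_iff]
    exact fun v hv => hη v (PS.mem_codom.2 ⟨_, hv⟩))
    (Fin.append η fun j => .var (y (Fin.natAdd n j)))
  refine ⟨g, hg.trans ?_⟩
  conv_rhs => rw [← PS.sub_var (Fin.append η fun j => .var (y (Fin.natAdd n j)))]
  rw [PS.sub_eq_sub_iff]
  intro v hv
  obtain ⟨i, hi⟩ := PS.mem_codom.1 hv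
  revert hi
  refine Fin.addCases (fun i => ?_) (fun j => ?_) i
  · rw [Fin.append_left]
    exact fun hi => hη v (PS.mem_codom.2 ⟨i, hi⟩)
  · rw [Fin.append_right, mem_tvars_var]
    rintro rfl
    refine hf' _ fun j' h => ?_
    have := congrArg Fin.val (y.injective h)
    simp only [Fin.val_natAdd, Fin.val_castAdd] at this
    omega

theorem Rep.cut_child {k : ℕ} {t : PS L SV k} {q : Fin k → Fin m} {a : Addr}
    {σ : StdSubst L SV} {U : Set SV} {G : List (GoalLit L SV ar)}
    {η : PS L SV m} {b : Addr} {gl : List (Literal L ar m × Addr)}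
    (h : Rep t q a ⟨.cut b :: G, σ, U⟩ η ((.cut, b) :: gl)) (i : ℕ) :
    Rep t q (a ++ [i]) ⟨G, σ, U⟩ η gl where
  goal := (List.cons.inj h.goal).2
  ans := h.ans
  codom := h.codom
  finite := h.finite
  parent b hb := strict_prefix_append (h.parent b (by simp [hb])).1 i

theorem Rep.eq_child {k : ℕ} {t : PS L SV k} {q : Fin k → Fin m} {a : Addr}
    {ν : Node L SV ar} {η : PS L SV m} {l : Literal L ar m × Addr}
    {gl : List (Literal L ar m × Addr)}
    (h : Rep t q a ν η (l :: gl)) (μ : StdSubst L SV) (i : ℕ) :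
    Rep t q (a ++ [i]) ⟨(instGoal η gl).map (GoalLit.app μ), ν.subst.comp μ,
      ν.used ∪ μ.dom ∪ μ.codom⟩ (η.app μ) gl where
  goal := map_app_instGoal η μ gl
  ans := by
    have := h.ans
    funext j
    change (t j).subst (fun y => (ν.subst.toFun y).subst μ.toFun) = _
    rw [← subst_subst]
    exact congrArg (fun s => Term.subst s μ.toFun) (congrFun this j)
  codom := (PS.codom_app_subset η μ).trans
    (Set.union_subset_union_left _ (Set.union_subset_union_left _ h.codom))
  finite := (h.finite.union μ.finite_dom).union μ.finite_codom
  parent b hb := strict_prefix_append (h.parent b (by simp [hb])).1 i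

/-- The literals of a clause body in the context of a call. -/
def bodyGoal {e : ℕ} (a : Fin n ↪ Fin m) (b : Addr) (body : List (Literal L ar (n + e))) :
    List (Literal L ar (m + e) × Addr) :=
  (body.map (Literal.lmap (liftEmb e a))).map fun l => (l, b)

/-- Only the `e` non-head variables of the clause are added to the context: after unification, the
head variables have the same values as the arguments of the call, so the body refers to those
through `liftEmb`. -/
theorem Rep.call_child {k : ℕ} {t : PS L SV k} {q : Fin k → Fin m} {a : Addr}
    {ν : Node L SV ar} {η : PS L SV m} {l : Literal L ar m × Addr}
    {gl : List (Literal L ar m × Addr)} (h : Rep t q a ν η (l :: gl)) {e : ℕ}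
    {a' : Fin n ↪ Fin m} {y : Fin (n + e) ↪ SV} {μ : StdSubst L SV}
    (hμ : μ.IsUnifier (fun j => η (a' j)) (fun j => .var (y (Fin.castAdd e j))))
    (body : List (Literal L ar (n + e))) (i : ℕ) :
    Rep t (Fin.castAddEmb e ∘ q) (a ++ [i])
      ⟨(body.map (Literal.inst y a) ++ instGoal η gl).map (GoalLit.app μ), ν.subst.comp μ,
        ν.used ∪ Set.range y ∪ μ.dom ∪ μ.codom⟩
      (PS.app (Fin.append η fun j => .var (y (Fin.natAdd n j))) μ)
      (bodyGoal a' a body ++ liftGoal (Fin.castAddEmb e) gl) where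
  goal := by
    have h₁ : (fun i => (PS.app (Fin.append η fun j => .var (y (Fin.natAdd n j))) μ)
        (Fin.castAddEmb e i)) = η.app μ := funext fun i => by
      simp [PS.app]
    have h₂ : (fun i => (PS.app (Fin.append η fun j => .var (y (Fin.natAdd n j))) μ)
        (liftEmb e a' i)) = PS.app (fun j => .var (y j)) μ := funext fun i => by
      refine Fin.addCases (fun i => ?_) (fun j => ?_) i
      · simp only [PS.app, liftEmb_castAdd, Fin.append_left]
        exact hμ i
      · simp only [PS.app, liftEmb_natAdd, Fin.append_right]
    simp only [List.map_append, map_app_instGoal]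
    rw [show ∀ (η : PS L SV (m + e)) (g g' : List (Literal L ar (m + e) × Addr)),
      instGoal η (g ++ g') = instGoal η g ++ instGoal η g' from fun _ _ _ => List.map_append,
      instGoal_liftGoal, h₁]
    congr 1
    simp only [bodyGoal, instGoal, List.map_map, Function.comp_def, Literal.instT_lmap, h₂,
      Literal.inst_eq_instT, Literal.app_instT]
  ans := by
    have := h.ans
    funext j
    change (t j).subst (fun y => (ν.subst.toFun y).subst μ.toFun) = _
    rw [← subst_subst]
    have h' : (t j).subst ν.subst.toFun = η (q j) := congrFun this j
    simp [h', PS.app]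
  codom := by
    refine (PS.codom_app_subset _ μ).trans
      (Set.union_subset_union_left _ (Set.union_subset_union_left _ fun v hv => ?_))
    obtain ⟨i, hi⟩ := PS.mem_codom.1 hv
    revert hi
    refine Fin.addCases (fun i => ?_) (fun j => ?_) i
    · rw [Fin.append_left]
      exact fun hi => Or.inl (h.codom (PS.mem_codom.2 ⟨i, hi⟩))
    · rw [Fin.append_right, mem_tvars_var]
      rintro rfl
      exact Or.inr ⟨_, rfl⟩
  finite := ((h.finite.union (Set.finite_range y)).union μ.finite_dom).union μ.finite_codom
  parent b hb := by
    refine strict_prefix_append ?_ i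
    rcases List.mem_append.1 hb with hb | hb
    · obtain ⟨l, _, hl⟩ := List.mem_map.1 hb
      rw [← (Prod.mk.inj hl).2]
    · exact (h.parent b (by simp [cut_mem_liftGoal.1 hb])).1

end Goals

/-! ### Outcomes of subtrees and their sequential composition. -/

section Outcomes

open PSeq

/-- The outcome of the traversal of a subtree: it ends with the given answers, possibly after a cut
that prunes the subtrees below a node above, or it reaches a point after the given answers at which
no more is known. -/
inductive Outcome (A : Type*)
  | done (l : List A) (sg : Option Addr)
  | stuck (l : List A)

namespace Outcome

variable {A B B' : Type*}

/-- Prefixing of answers. -/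
def prepend (l : List A) : Outcome A → Outcome A
  | done l' sg => done (l ++ l') sg
  | stuck l' => stuck (l ++ l')

/-- Sequential composition. -/
def seq : Outcome A → Outcome A → Outcome A
  | done l none, o => o.prepend l
  | done l (some b), _ => done l (some b)
  | stuck l, _ => stuck l

@[simp]
theorem done_nil_seq (o : Outcome A) : (done [] none).seq o = o := by
  cases o <;> rfl

@[simp]
theorem seq_done_nil (o : Outcome A) : o.seq (done [] none) = o := by
  rcases o with ⟨l, _ | b⟩ | l <;> simp [seq, prepend]

theorem seq_assoc (o₁ o₂ o₃ : Outcome A) : (o₁.seq o₂).seq o₃ = o₁.seq (o₂.seq o₃) := by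
  rcases o₁ with ⟨l, _ | b⟩ | l
  · rcases o₂ with ⟨l', _ | b'⟩ | l'
    · rcases o₃ with ⟨l'', b''⟩ | l'' <;> simp [seq, prepend]
    · rfl
    · rfl
  · rfl
  · rfl

/-- The outcome for the elements of a sequence, one after another, and then `z`. -/
def run (K : B → Outcome A) : PSeq B → Outcome A → Outcome A
  | .fin l, z => l.foldr (fun θ o => (K θ).seq o) z
  | .inc l, _ => l.foldr (fun θ o => (K θ).seq o) (stuck [])
  -- A default value; only compact sequences are run in what follows.
  | .inf _, _ => stuck []

theorem run_seq (K : B → Outcome A) {S : PSeq B} (z z' : Outcome A) :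
    (run K S z).seq z' = run K S (z.seq z') := by
  have key : ∀ (l : List B) (z : Outcome A), (l.foldr (fun θ o => (K θ).seq o) z).seq z' =
      l.foldr (fun θ o => (K θ).seq o) (z.seq z') := fun l z => by
    induction l with
    | nil => rfl
    | cons a l ih => rw [List.foldr_cons, List.foldr_cons, seq_assoc, ih]
  cases S with
  | fin l => exact key l z
  | inc l => exact key l _
  | inf s => rfl

theorem run_box (K : B → Outcome A) (S S' : PSeq B) (z : Outcome A) (hS' : S'.IsCompact) :
    run K (S.box S') z = run K S (run K S' z) := by
  cases S with
  | fin l =>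
    cases S' with
    | fin l' => exact List.foldr_append
    | inc l' => exact List.foldr_append
    | inf s => exact hS'.elim
  | inc l => rfl
  | inf s => rfl

/-- The semantics composes literals by `bind`, the traversal by continuations; this law translates
one into the other. -/
theorem run_bind (K : B → Outcome A) {S : PSeq B'} (hS : S.IsCompact) {F : B' → PSeq B}
    (hF : ∀ θ, (F θ).IsCompact) (z : Outcome A) :
    run K (S.bind F) z = run (fun θ => run K (F θ) (done [] none)) S z := by
  have hc : ∀ l : List B', ((PSeq.fin l).bind F).IsCompact := fun l =>
    (AllC.bind (p := fun _ => True) (q := fun _ => True) (.fin fun _ _ => trivial)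
      fun a _ => ⟨hF a, fun _ _ => trivial⟩).1
  have key : ∀ (l : List B') (z : Outcome A), run K ((PSeq.fin l).bind F) z =
      run (fun θ => run K (F θ) (done [] none)) (.fin l) z := fun l z => by
    induction l with
    | nil => rfl
    | cons a l ih =>
      rw [fin_cons_bind, run_box _ _ _ _ (hc l), ih]
      change _ = (run K (F a) _).seq (run _ (.fin l) z)
      rw [run_seq, done_nil_seq]
  cases S with
  | fin l => exact key l z
  | inc l =>
    rw [inc_bind, run_box _ _ (.inc []) _ trivial, key]
    rfl
  | inf s => exact hS.elim

theorem run_map (K : B → Outcome A) (f : B' → B) (S : PSeq B') (z : Outcome A) :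
    run K (S.map f) z = run (fun θ => K (f θ)) S z := by
  cases S with
  | fin l => exact List.foldr_map
  | inc l => exact List.foldr_map
  | inf s => rfl

open Classical in
/-- The outcome after the effect of cuts with parent `a` is confined to the subtree. -/
noncomputable def clear (a : Addr) : Outcome A → Outcome A
  | done l sg => done l (if sg = some a then none else sg)
  | stuck l => stuck l

theorem clear_seq {a : Addr} {o : Outcome A} (ho : ∀ l, o ≠ done l (some a)) (o' : Outcome A) :
    (o.seq o').clear a = o.seq (o'.clear a) := by
  rcases o with ⟨l, _ | b⟩ | l
  · rcases o' with ⟨l', b'⟩ | l' <;> rfl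
  · have : b ≠ a := fun h => ho l (by rw [h])
    simp [seq, clear, this]
  · rfl

/-- As no `K θ` signals a cut with parent `a`, such a signal can only come from the final outcome.
-/
theorem clear_run {a : Addr} {K : B → Outcome A} (hK : ∀ θ l, K θ ≠ done l (some a))
    (S : PSeq B) (z : Outcome A) : (run K S z).clear a = run K S (z.clear a) := by
  have key : ∀ (l : List B) (z : Outcome A), (l.foldr (fun θ o => (K θ).seq o) z).clear a =
      l.foldr (fun θ o => (K θ).seq o) (z.clear a) := fun l z => by
    induction l with
    | nil => rfl
    | cons b l ih => rw [List.foldr_cons, List.foldr_cons, clear_seq (hK b), ih]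
  cases S with
  | fin l => exact key l z
  | inc l => exact key l _
  | inf s => rfl

theorem run_eq_done_some {K : B → Outcome A} {S : PSeq B} {z : Outcome A} {l : List A} {b : Addr}
    (h : run K S z = done l (some b)) :
    (∃ θ l', K θ = done l' (some b)) ∨ ∃ l', z = done l' (some b) := by
  have key : ∀ (m : List B) (z : Outcome A) (l : List A),
      m.foldr (fun θ o => (K θ).seq o) z = done l (some b) →
      (∃ θ l', K θ = done l' (some b)) ∨ ∃ l', z = done l' (some b) := fun m z => by
    induction m with
    | nil => exact fun l h => Or.inr ⟨l, h⟩
    | cons a m ih =>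
      intro l h
      rw [List.foldr_cons] at h
      rcases hK : K a with ⟨l', _ | b'⟩ | l' <;> rw [hK] at h
      · rcases ho : m.foldr (fun θ o => (K θ).seq o) z with ⟨l'', sg⟩ | l'' <;> rw [ho] at h
        · simp only [seq, prepend, done.injEq] at h
          exact ih l'' (by rw [ho, h.2])
        · simp [seq, prepend] at h
      · simp only [seq, done.injEq, Option.some.injEq] at h
        exact Or.inl ⟨a, l', by rw [hK, h.2]⟩
      · simp [seq] at h
  cases S with
  | fin m => exact key m z l h
  | inc m => exact (key m _ l h).imp id (by simp)
  | inf s => simp [run] at h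

/-- The outcome at the end of a clause body. -/
def ofFlag (A : Type*) (a : Addr) : CutFlag → Outcome A
  | .nocut => done [] none
  | .cut => done [] (some a)

end Outcome

end Outcomes

end PrologCut

namespace PrologCut

/-! ### Goals, cuts and equations in the traversal. -/

section Traversal

variable {L : FirstOrder.Language.{u, v}} {SV : Type w} {N : Type x} {ar : N → ℕ}
  {C : Canon L SV} {P : Program L ar} {T : Addr → Option (Node L SV ar)}

open PSeq

/-- The effect of a cut on the list of the unvisited subtrees. -/
def prune : Option Addr → List Addr → List Addr
  | none, rest => rest
  | some b, rest => rest.filter fun a' => ¬ b <+: a'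

theorem prune_eq_self {a : Addr} {rest : List Addr} (h : ∀ a' ∈ rest, ¬ a <+: a') :
    prune (some a) rest = rest := by
  refine List.filter_eq_self.2 fun a' ha' => ?_
  simpa using h a' ha'

theorem prune_append_of_prefix {b : Addr} {seg rest : List Addr} (h : ∀ a' ∈ seg, b <+: a') :
    prune (some b) (seg ++ rest) = prune (some b) rest := by
  have : seg.filter (fun a' => ¬ b <+: a') = [] := by
    refine List.filter_eq_nil_iff.2 fun a' ha' => ?_
    simpa using h a' ha'
  simp only [prune, List.filter_append, this, List.nil_append]

theorem prune_prune {a b : Addr} (h : b <+: a) (rest : List Addr) :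
    prune (some b) (prune (some a) rest) = prune (some b) rest := by
  simp only [prune, List.filter_filter]
  refine List.filter_congr fun a' _ => ?_
  by_cases hb : b <+: a'
  · simp [hb]
  · have : ¬ a <+: a' := fun ha => hb (h.trans ha)
    simp [hb, this]

theorem mem_prune {sg : Option Addr} {a : Addr} {rest : List Addr} (h : a ∈ prune sg rest) :
    a ∈ rest := by
  cases sg with
  | none => exact h
  | some b => exact List.mem_of_mem_filter h

variable (C P T) in
/-- The traversal of `T` has, for the unvisited subtrees `seg`, the given outcome. -/
def Reaches {k : ℕ} (t : PS L SV k) (n : ℕ) (seg rest : List Addr) (out : List (StdSubst L SV)) :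
    Outcome (CPS C k) → Prop
  | .done l sg => ∃ j l', l'.map (fun σ => C.canon (t.app σ)) = l ∧
      (visit P T t.codom)^[j] (seg ++ rest, out) = (prune sg rest, out ++ l')
  -- The bound `n ≤ j` makes approximation `n` cover at least `n` steps. No bound is needed for a
  -- subtree that has been finished.
  | .stuck l => ∃ j ≥ n, ∃ l' pend, l'.map (fun σ => C.canon (t.app σ)) = l ∧ pend ≠ [] ∧
      (visit P T t.codom)^[j] (seg ++ rest, out) = (pend, out ++ l')

variable {k : ℕ} {t : PS L SV k} {n : ℕ}

theorem Reaches.mono {seg rest : List Addr} {out : List (StdSubst L SV)} {o : Outcome (CPS C k)}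
    (h : Reaches C P T t n seg rest out o) {n' : ℕ} (hn : n' ≤ n) :
    Reaches C P T t n' seg rest out o := by
  cases o with
  | done l sg => exact h
  | stuck l =>
    obtain ⟨j, hj, h⟩ := h
    exact ⟨j, hn.trans hj, h⟩

theorem Reaches.of_visit {seg seg' rest : List Addr} {out : List (StdSubst L SV)}
    {o : Outcome (CPS C k)} (h : Reaches C P T t n seg' rest out o)
    (hv : visit P T t.codom (seg ++ rest, out) = (seg' ++ rest, out)) :
    Reaches C P T t (n + 1) seg rest out o := by
  cases o with
  | done l sg =>
    obtain ⟨j, l', hl, hj⟩ := h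
    exact ⟨j + 1, l', hl, by rw [Function.iterate_succ_apply, hv, hj]⟩
  | stuck l =>
    obtain ⟨j, hjn, l', pend, hl, hp, hj⟩ := h
    exact ⟨j + 1, by omega, l', pend, hl, hp, by rw [Function.iterate_succ_apply, hv, hj]⟩

/-- The unvisited part may change from `rest` to `rest'` on the way, provided that the final pruning
erases the difference. This serves the case of a cut. -/
theorem Reaches.prepend {seg₁ seg₂ rest rest' : List Addr} {out l : List (StdSubst L SV)}
    {o : Outcome (CPS C k)} {j : ℕ}
    (hj : (visit P T t.codom)^[j] (seg₁ ++ rest, out) = (seg₂ ++ rest', out ++ l))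
    (h : Reaches C P T t n seg₂ rest' (out ++ l) o)
    (hr : ∀ l sg, o = .done l sg → prune sg rest' = prune sg rest) :
    Reaches C P T t n seg₁ rest out (o.prepend (l.map fun σ => C.canon (t.app σ))) := by
  cases o with
  | done l₂ sg =>
    obtain ⟨j', l', hl, hj'⟩ := h
    refine ⟨j' + j, l ++ l', by rw [List.map_append, hl], ?_⟩
    rw [Function.iterate_add_apply, hj, hj', hr _ _ rfl, List.append_assoc]
  | stuck l₂ =>
    obtain ⟨j', hjn, l', pend, hl, hp, hj'⟩ := h
    refine ⟨j' + j, by omega, l ++ l', pend, by rw [List.map_append, hl], hp, ?_⟩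
    rw [Function.iterate_add_apply, hj, hj', List.append_assoc]

/-- A pruning signal from the first segment has to remove the whole second segment; hence `hb`. -/
theorem Reaches.seq {seg₁ seg₂ rest : List Addr} {out : List (StdSubst L SV)}
    {o₁ o₂ : Outcome (CPS C k)} (h₁ : Reaches C P T t n seg₁ (seg₂ ++ rest) out o₁)
    (h₂ : ∀ out, Reaches C P T t n seg₂ rest out o₂)
    (hb : ∀ l b, o₁ = .done l (some b) → ∀ a' ∈ seg₂, b <+: a') :
    Reaches C P T t n (seg₁ ++ seg₂) rest out (o₁.seq o₂) := by
  rcases o₁ with ⟨l, _ | b⟩ | l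
  · obtain ⟨j, l', rfl, hj⟩ := h₁
    rw [← List.append_assoc] at hj
    exact Reaches.prepend hj (h₂ _) fun _ _ _ => rfl
  · obtain ⟨j, l', hl, hj⟩ := h₁
    refine ⟨j, l', hl, ?_⟩
    rw [List.append_assoc, hj, prune_append_of_prefix (hb _ _ rfl)]
  · obtain ⟨j, hjn, l', pend, hl, hp, hj⟩ := h₁
    refine ⟨j, hjn, l', pend, hl, hp, ?_⟩
    rw [List.append_assoc, hj]

/-- Pruning below `a` changes nothing once no unvisited address lies below `a`. -/
theorem Reaches.clear {seg rest : List Addr} {out : List (StdSubst L SV)} {o : Outcome (CPS C k)}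
    (h : Reaches C P T t n seg rest out o) {a : Addr} (ha : ∀ a' ∈ rest, ¬ a <+: a') :
    Reaches C P T t n seg rest out (o.clear a) := by
  cases o with
  | stuck l => exact h
  | done l sg =>
    rw [Outcome.clear]
    split_ifs with hs
    · subst hs
      obtain ⟨j, l', hl, hj⟩ := h
      exact ⟨j, l', hl, by rw [hj, prune_eq_self ha]; rfl⟩
    · exact h

theorem visit_call {V : Set SV} {a : Addr} {p : N} {s : Fin (ar p) → L.Term SV}
    {G : List (GoalLit L SV ar)} {σ : StdSubst L SV} {U : Set SV}
    (h : T a = some ⟨.call p s :: G, σ, U⟩) (rest : List Addr) (out : List (StdSubst L SV)) :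
    visit P T V (a :: rest, out) = (children P T a (.call p s :: G) ++ rest, out) := by
  simp only [visit, h]

theorem visit_eq {V : Set SV} {a : Addr} {s s' : L.Term SV} {G : List (GoalLit L SV ar)}
    {σ : StdSubst L SV} {U : Set SV}
    (h : T a = some ⟨.eq s s' :: G, σ, U⟩) (rest : List Addr) (out : List (StdSubst L SV)) :
    visit P T V (a :: rest, out) = (children P T a (.eq s s' :: G) ++ rest, out) := by
  simp only [visit, h]

theorem visit_cut {V : Set SV} {a b : Addr} {G : List (GoalLit L SV ar)}
    {σ : StdSubst L SV} {U : Set SV}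
    (h : T a = some ⟨.cut b :: G, σ, U⟩) (rest : List Addr) (out : List (StdSubst L SV)) :
    visit P T V (a :: rest, out) =
      (children P T a (.cut b :: G) ++ prune (some b) rest, out) := by
  simp only [visit, h]
  rfl

theorem visit_nil {V : Set SV} {a : Addr} {σ : StdSubst L SV} {U : Set SV}
    (h : T a = some ⟨[], σ, U⟩) (rest : List Addr) (out : List (StdSubst L SV)) :
    visit P T V (a :: rest, out) = (rest, out ++ [σ.restrict V]) := by
  simp only [visit, h]

theorem children_of_degree_one {a : Addr} {G : List (GoalLit L SV ar)} (hG : degree P G = 1) :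
    children P T a G = if (T (a ++ [0])).isSome then [a ++ [0]] else [] := by
  rw [children, hG]
  simp [List.filter_cons]

theorem PS.app_restrict (t : PS L SV k) (σ : StdSubst L SV) :
    t.app (σ.restrict t.codom) = t.app σ :=
  PS.sub_eq_sub_iff.2 fun _ hy => if_pos hy

theorem not_prefix_child {a : Addr} {rest : List Addr} (h : ∀ a' ∈ rest, ¬ a <+: a') (i : ℕ) :
    ∀ a' ∈ rest, ¬ a ++ [i] <+: a' :=
  fun a' ha' hp => h a' ha' ((List.prefix_append _ _).trans hp)

variable (C P T) in
/-- The nodes represented by the literals `gl` have the outcome given by `K`. -/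
structure Sat (t : PS L SV k) (n : ℕ) {m : ℕ} (q : Fin k → Fin m)
    (gl : List (Literal L ar m × Addr)) (K : CPS C m → Outcome (CPS C k)) : Prop where
  reaches : ∀ a ν η, T a = some ν → Rep t q a ν η gl → ∀ rest out, (∀ a' ∈ rest, ¬ a <+: a') →
    Reaches C P T t n [a] rest out (K (C.canon η))
  signal : ∀ θ l b, K θ = .done l (some b) → (.cut, b) ∈ gl

variable {m : ℕ} {q : Fin k → Fin m}

theorem Sat.mono {gl : List (Literal L ar m × Addr)} {K : CPS C m → Outcome (CPS C k)}
    (h : Sat C P T t n q gl K) {n' : ℕ} (hn : n' ≤ n) : Sat C P T t n' q gl K :=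
  ⟨fun a ν η hν hr rest out hrest => (h.reaches a ν η hν hr rest out hrest).mono hn, h.signal⟩

/-- The continuation of the caller ignores the variables added by a clause. -/
theorem Sat.lift {m' : ℕ} {gl : List (Literal L ar m × Addr)} {K : CPS C m → Outcome (CPS C k)}
    (h : Sat C P T t n q gl K) (e : Fin m ↪ Fin m') :
    Sat C P T t n (e ∘ q) (liftGoal e gl) fun θ => K (θ.restr e) := by
  refine ⟨fun a ν η hν hr rest out hrest => ?_,
    fun θ l b hb => cut_mem_liftGoal.2 (h.signal _ l b hb)⟩
  rw [CPS.restr_canon]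
  exact h.reaches a ν _ hν hr.of_lift rest out hrest

theorem sat_nil : Sat C P T t n q [] fun θ => .done [θ.restr q] none := by
  refine ⟨fun a ν η hν hr rest out _ => ⟨1, [ν.subst.restrict t.codom], ?_, ?_⟩, by simp⟩
  · rw [CPS.restr_canon, List.map_singleton, PS.app_restrict, hr.ans]
  · obtain ⟨G, σ, U⟩ := ν
    obtain rfl : G = [] := hr.goal
    exact visit_nil hν rest out

/-- The traversal prunes when the cut is reached, whereas the outcome records the pruning after the
rest of the goal. The result is the same: if the rest ends with a cut of its own, `hpa` places that
parent above `pa`, and its pruning subsumes the earlier one. -/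
theorem Sat.cut {p : N} {t : PS L SV (ar p)} {q : Fin (ar p) → Fin m} (hT : IsOLDTree P p t T)
    {gl : List (Literal L ar m × Addr)} {K : CPS C m → Outcome (CPS C (ar p))}
    (h : Sat C P T t n q gl K) {pa : Addr} (hpa : ∀ b, (Literal.cut, b) ∈ gl → b <+: pa) :
    Sat C P T t n q ((.cut, pa) :: gl) fun θ => (K θ).seq (.done [] (some pa)) := by
  refine ⟨fun a ν η hν hr rest out hrest => ?_, fun θ l b hb => ?_⟩
  · obtain ⟨G', σ, U⟩ := ν
    obtain ⟨G, rfl⟩ : ∃ G, G' = .cut pa :: G := ⟨_, hr.goal⟩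
    have hsome := hT.complete a 0 _ _ hν (.cut pa G σ U)
    obtain ⟨ν', hν'⟩ := Option.isSome_iff_exists.1 hsome
    have hν'' := (hT.child a 0 _ _ hν hν').cut_inv
    subst hν''
    have hv : (visit P T t.codom)^[1] ([a] ++ rest, out) =
        ([a ++ [0]] ++ prune (some pa) rest, out ++ []) := by
      rw [Function.iterate_one, List.append_nil, List.singleton_append, visit_cut hν,
        children_of_degree_one rfl, if_pos hsome]
    have hrest' := not_prefix_child (i := 0) fun a' ha' => hrest a' (mem_prune (sg := some pa) ha')
    have hK := h.reaches _ _ η hν' (hr.cut_child 0) (prune (some pa) rest) out hrest'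
    rcases hKη : K (C.canon η) with ⟨l, _ | b⟩ | l <;> rw [hKη] at hK
    · obtain ⟨j, l', hl, hj⟩ := hK
      refine ⟨j + 1, l', by rw [hl, List.append_nil], ?_⟩
      rw [Function.iterate_add_apply, hv, List.append_nil, hj]
      rfl
    · have hb : b <+: pa := hpa b (h.signal _ _ _ hKη)
      have := Reaches.prepend hv (by rwa [List.append_nil]) (o := .done l (some b)) (n := n)
        fun l' sg hsg => by
          simp only [Outcome.done.injEq] at hsg
          rw [← hsg.2, prune_prune hb]
      exact this
    · have := Reaches.prepend hv (by rwa [List.append_nil]) (o := .stuck l) (n := n)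
        fun l' sg hsg => by simp at hsg
      exact this
  · rcases hK : K θ with ⟨l', _ | b'⟩ | l' <;> rw [hK] at hb
    · simp only [Outcome.seq, Outcome.prepend, Outcome.done.injEq, Option.some.injEq] at hb
      simp [hb.2]
    · simp only [Outcome.seq, Outcome.done.injEq, Option.some.injEq] at hb
      exact List.mem_cons_of_mem _ (h.signal _ _ _ (hb.2 ▸ hK))
    · simp [Outcome.seq] at hb

theorem term_subst_relabel {α β γ : Type*} (s : L.Term α) (e : α → β) (f : β → L.Term γ) :
    (s.relabel e).subst f = s.subst fun i => f (e i) := by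
  induction s with
  | var _ => rfl
  | func F ts ih => simp only [FirstOrder.Language.Term.relabel,
      FirstOrder.Language.Term.subst, ih]

variable [Infinite SV]

/-- The child exists exactly if the equation has a solution below `η`, and then both the tree and
the semantics produce the least one. -/
theorem Sat.equation {p : N} {t : PS L SV (ar p)} {q : Fin (ar p) → Fin m}
    (hT : IsOLDTree P p t T) {gl : List (Literal L ar m × Addr)}
    {K : CPS C m → Outcome (CPS C (ar p))} (h : Sat C P T t n q gl K) {l : Literal L ar m}
    (b₀ : Addr) {r : ℕ} (s₁ s₂ : L.Term (Fin r)) (e : Fin r ↪ Fin m)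
    (hl : ∀ η : PS L SV m, l.instT η b₀ =
      .eq (s₁.subst fun i => η (e i)) (s₂.subst fun i => η (e i))) (b : Behavior C ar)
    (hsem : ∀ θ : CPS C m, litSem b l θ =
      extG C e θ (unif C (restrG C e θ) (s₁.subst (restrG C e θ).1)
        (s₂.subst (restrG C e θ).1))) :
    Sat C P T t n q ((l, b₀) :: gl) fun θ => .run K (litSem b l θ) (.done [] none) := by
  have hsol : ∀ θ, CPS.IsSol (fun x => (CPS.restr e x).1.Sat s₁ s₂) θ (litSem b l θ) := fun θ => by
    rw [hsem]
    exact (CPS.isSol_unif s₁ s₂ _).extG_eq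
  refine ⟨fun a ν η hν hr rest out hrest => ?_, fun θ l' b' hb => ?_⟩
  · obtain ⟨G', σ, U⟩ := ν
    have hG : G' = .eq (s₁.subst fun i => η (e i)) (s₂.subst fun i => η (e i)) ::
        instGoal η gl := by
      rw [← hl]; exact hr.goal
    subst hG
    have hset : ∀ x : CPS C m, (CPS.restr e x).1.Sat s₁ s₂ ↔
        x.1.Sat (s₁.relabel e) (s₂.relabel e) := fun x => by
      rw [CPS.restr, CPS.sat_canon, PS.Sat, PS.Sat, term_subst_relabel, term_subst_relabel]
    by_cases hs : (T (a ++ [0])).isSome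
    · obtain ⟨ν', hν'⟩ := Option.isSome_iff_exists.1 hs
      obtain ⟨μ, hμ, hν''⟩ := (hT.child a 0 _ _ hν hν').eq_inv
      subst hν''
      have hK := h.reaches _ _ _ hν' (hr.eq_child μ 0) rest out (not_prefix_child hrest 0)
      have hleast : IsLeast {x : CPS C m | C.canon η ≤ x ∧ (CPS.restr e x).1.Sat s₁ s₂}
          (C.canon (η.app μ)) := by
        simp only [hset]
        refine CPS.isLeast_app_mgu ?_
        rwa [term_subst_relabel, term_subst_relabel]
      have hlit : litSem b l (C.canon η) = .fin [C.canon (η.app μ)] := by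
        rcases hsol (C.canon η) with ⟨x, hx, hx'⟩ | ⟨_, hx⟩
        · rw [hx, hx'.unique hleast]
        · exact (hx _ hleast.1.1 hleast.1.2).elim
      rw [hlit]
      simp only [Outcome.run, List.foldr_cons, List.foldr_nil, Outcome.seq_done_nil]
      refine (hK.of_visit ?_).mono (Nat.le_succ n)
      rw [List.singleton_append, visit_eq hν, children_of_degree_one rfl, if_pos hs]
    · have hlit : litSem b l (C.canon η) = .fin [] := by
        rcases hsol (C.canon η) with ⟨x, _, hx⟩ | ⟨hx, _⟩
        · exfalso
          obtain ⟨hx₁, hx₂⟩ := hx.1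
          rw [hset, ← CPS.sat_canon (C := C), C.canon_val] at hx₂
          rw [← C.canon_val x, C.canon_le_canon_iff] at hx₁
          obtain ⟨f, hf⟩ := hx₁
          rw [← hf, PS.sat_sub_iff, term_subst_relabel, term_subst_relabel] at hx₂
          obtain ⟨μ, hμ⟩ := exists_isMGU (k := 1) (fun _ => hx₂)
          exact hs (hT.complete a 0 _ _ hν (.eq _ _ _ σ μ U (isMGU_unit_iff.2 hμ)))
        · exact hx
      rw [hlit]
      refine ⟨1, [], rfl, ?_⟩
      rw [Function.iterate_one, List.singleton_append, visit_eq hν, children_of_degree_one rfl,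
        if_neg hs, List.append_nil]
      rfl
  · rcases Outcome.run_eq_done_some hb with ⟨θ', l'', h'⟩ | ⟨l'', h'⟩
    · exact List.mem_cons_of_mem _ (h.signal _ _ _ h')
    · simp at h'

/-- The outcome of a goal the first literals of which belong to one clause body. -/
theorem Sat.body {p : N} {t : PS L SV (ar p)} (hT : IsOLDTree P p t T) {b : Behavior C ar}
    (hb : IsGood b)
    (hcall : ∀ {m : ℕ} {q : Fin (ar p) → Fin m} {gl : List (Literal L ar m × Addr)}
      {K : CPS C m → Outcome (CPS C (ar p))} (p' : N) (e : Fin (ar p') ↪ Fin m) (b₀ : Addr),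
      Sat C P T t n q gl K → Sat C P T t n q ((.call p' e, b₀) :: gl)
        fun θ => .run K (litSem b (.call p' e) θ) (.done [] none))
    (g : List (Literal L ar m)) {q : Fin (ar p) → Fin m} {pa : Addr} :
    ∀ {gl : List (Literal L ar m × Addr)} {K : CPS C m → Outcome (CPS C (ar p))},
    Sat C P T t n q gl K → (∀ b, (Literal.cut, b) ∈ gl → b <+: pa) →
    Sat C P T t n q (g.map (fun l => (l, pa)) ++ gl) fun θ =>
      .run K (g.foldl (semLiteral b) (.fin [θ], .nocut)).1
        (.ofFlag _ pa (g.foldl (semLiteral b) (.fin [θ], .nocut)).2) := by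
  -- The semantics folds from the left, while continuations grow from the right: the last literal of
  -- `g` is moved into the continuation.
  induction g using List.reverseRecOn with
  | nil =>
    intro gl K h _
    simpa [Outcome.run, Outcome.ofFlag] using h
  | append_singleton g l ih =>
    intro gl K h hpa
    rw [List.map_append, List.append_assoc]
    change Sat C P T t n q (_ ++ ((l, pa) :: gl)) _
    have hgood : ∀ θ : CPS C m, (g.foldl (semLiteral b) (.fin [θ], .nocut)).1.IsCompact := fun θ =>
      (allC_foldl_semLiteral (θ := θ) hb g (.fin (by simp))).1
    have regular : l ≠ .cut →
        (Sat C P T t n q ((l, pa) :: gl) fun θ => .run K (litSem b l θ) (.done [] none)) →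
        Sat C P T t n q (g.map (fun l => (l, pa)) ++ ((l, pa) :: gl)) fun θ =>
          .run K ((g ++ [l]).foldl (semLiteral b) (.fin [θ], .nocut)).1
          (.ofFlag _ pa ((g ++ [l]).foldl (semLiteral b) (.fin [θ], .nocut)).2) :=
      fun hl h' => by
        have h'' := ih h' (fun b hb => hpa b (by simpa [hl.symm] using hb))
        convert h'' using 2 with θ
        rw [List.foldl_append, List.foldl_cons, List.foldl_nil, semLiteral_of_ne_cut _ _ hl,
          Outcome.run_bind K (hgood θ) fun θ' => (allC_litSem hb l θ').1]
    cases l with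
    | call p' e => exact regular (by simp) (hcall p' e pa h)
    | eqVar e =>
      exact regular (by simp) (h.equation hT pa (.var 0) (.var 1) e (fun _ => rfl) b fun _ => rfl)
    | eqFun f e =>
      exact regular (by simp) (h.equation hT pa (.var 0) (.func f fun j => .var j.succ) e
        (fun _ => rfl) b fun _ => rfl)
    | cut =>
      have h'' := ih (h.cut hT hpa) (fun b hb => by
        simp only [List.mem_cons, Prod.mk.injEq, true_and] at hb
        rcases hb with rfl | hb
        · exact List.prefix_rfl
        · exact hpa b hb)
      convert h'' using 2 with θ
      rw [List.foldl_append, List.foldl_cons, List.foldl_nil]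
      have hc := hgood θ
      generalize g.foldl (semLiteral b) (.fin [θ], .nocut) = V at hc ⊢
      obtain ⟨S, cf⟩ := V
      -- If `S` has a first element, the signal after it absorbs all later elements and the old
      -- flag; if not, both sides coincide.
      rcases S with (_ | ⟨x, l⟩) | (_ | ⟨x, l⟩) | s
      · rfl
      · simp only [semLiteral, Outcome.run, List.foldr_cons, List.foldr_nil, Outcome.seq_assoc,
          Outcome.ofFlag]
        rfl
      · rfl
      · simp only [semLiteral, Outcome.run, List.foldr_cons, List.foldr_nil, Outcome.seq_assoc,
          Outcome.ofFlag]
        rfl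
      · exact hc.elim

end Traversal

end PrologCut

namespace PrologCut

/-! ### Procedure calls and the query. -/

section Calls

variable {L : FirstOrder.Language.{u, v}} {SV : Type w} {N : Type x} {ar : N → ℕ}
  {C : Canon L SV} {P : Program L ar} {T : Addr → Option (Node L SV ar)} [Infinite SV]
  {k : ℕ} {t : PS L SV k} {n m : ℕ}

open PSeq

theorem clear_ofFlag {A : Type*} (a : Addr) (cf : CutFlag) :
    (Outcome.ofFlag A a cf).clear a = .done [] none := by
  cases cf <;> simp [Outcome.ofFlag, Outcome.clear]

/-- Induction over the clauses still to be tried, which belong to the children from `i₀` on. A cut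
of the clause itself signals `a`, removes the remaining siblings and is then cleared; a cut from the
continuation has its parent above `a`, so it removes the siblings and is passed on. -/
theorem reaches_procedure {r : ℕ} {K : CPS C m → Outcome (CPS C k)} {a : Addr}
    (hK : ∀ θ l, K θ ≠ .done l (some a)) {b : Behavior C ar} (hb : IsGood b) (e : Fin r ↪ Fin m)
    (θ : CPS C m) (pr : Procedure L ar r) : ∀ (i₀ : ℕ)
    (_ : ∀ j c, pr.clauses[j]? = some c → ∀ rest out, (∀ a' ∈ rest, ¬ a ++ [i₀ + j] <+: a') →
      Reaches C P T t n [a ++ [i₀ + j]] rest out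
        (.run K (extG C e θ (semClause b c (restrG C e θ)).1)
          (.ofFlag _ a (semClause b c (restrG C e θ)).2)))
    (_ : ∀ c ∈ pr.clauses, ∀ l b', Outcome.run K (extG C e θ (semClause b c (restrG C e θ)).1)
      (.ofFlag _ a (semClause b c (restrG C e θ)).2) = .done l (some b') → b' <+: a)
    (rest : List Addr) (out : List (StdSubst L SV)), (∀ a' ∈ rest, ¬ a <+: a') →
    Reaches C P T t n ((List.range' i₀ pr.clauses.length).map fun i => a ++ [i]) rest out
      (.run K (extG C e θ (semProcedure b pr (restrG C e θ))) (.done [] none)) := by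
  induction pr with
  | last c =>
    intro i₀ hW _ rest out hrest
    have := (hW 0 c rfl rest out (not_prefix_child hrest _)).clear hrest
    rwa [Outcome.clear_run hK, clear_ofFlag] at this
  | cons c pr ih =>
    intro i₀ hW hsig rest out hrest
    have h₂ := ih (i₀ + 1) (fun j c' hc' rest out hr => by
      have := hW (j + 1) c' hc' rest out
      rw [show i₀ + (j + 1) = i₀ + 1 + j by omega] at this
      exact this hr) (fun c' hc' => hsig c' (List.mem_cons_of_mem _ hc')) rest
    have h₁ := hW 0 c rfl
      ((List.range' (i₀ + 1) pr.clauses.length).map (fun i => a ++ [i]) ++ rest) out (by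
        intro a' ha' hp
        rcases List.mem_append.1 ha' with ha' | ha'
        · obtain ⟨i, hi, rfl⟩ := List.mem_map.1 ha'
          have := hp.eq_of_length (by simp)
          simp only [List.append_cancel_left_eq, List.cons.injEq, and_true] at this
          have := (List.mem_range'_1.1 hi).1
          omega
        · exact not_prefix_child hrest _ a' ha' hp)
    have h := (Reaches.seq h₁ (fun out => h₂ out hrest) fun l b' hl a' ha' => by
      obtain ⟨i, _, rfl⟩ := List.mem_map.1 ha'
      exact (hsig c (List.mem_cons_self ..) l b' hl).trans (List.prefix_append _ _)).clear hrest
    change Reaches C P T t n ([a ++ [i₀ + 0]] ++ _) rest out _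
    convert h using 1
    -- What remains is a case distinction on the flag of the first clause: `cut` discards the
    -- outcome of the later clauses, `nocut` lets them follow, as in `boxCut`.
    rw [Outcome.run_seq, Outcome.clear_run hK, semProcedure]
    have hc : (extG C e θ (semProcedure b pr (restrG C e θ))).IsCompact :=
      (allC_extG e θ (allC_semProcedure hb pr _)).1
    rcases semClause b c (restrG C e θ) with ⟨S, _ | _⟩
    · simp [boxCut, Outcome.ofFlag, Outcome.seq, Outcome.clear]
    · simp only [boxCut, Outcome.ofFlag, Outcome.done_nil_seq]
      rw [Outcome.clear_run hK, extG_eq, box_map, ← extG_eq, ← extG_eq, Outcome.run_box _ _ _ _ hc]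
      simp [Outcome.clear]

/-- Visiting the call costs one step, which pays for the passage from `approx P n` to `approx P (n +
1)`. Below the call, `Sat.body` handles every clause body in the context of the caller, with the
induction hypothesis for inner calls. -/
theorem Sat.call {p : N} {t : PS L SV (ar p)} (hT : IsOLDTree P p t T) :
    ∀ {m : ℕ} {q : Fin (ar p) → Fin m} {gl : List (Literal L ar m × Addr)}
      {K : CPS C m → Outcome (CPS C (ar p))} (p' : N) (e : Fin (ar p') ↪ Fin m) (b₀ : Addr),
      Sat C P T t n q gl K → Sat C P T t n q ((.call p' e, b₀) :: gl)
        fun θ => .run K (litSem (approx P n) (.call p' e) θ) (.done [] none) := by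
  induction n with
  | zero =>
    intro m q gl K p' e b₀ h
    refine ⟨fun a ν η hν hr rest out hrest => ?_, fun θ l b hb => ?_⟩
    -- `approx P 0` is ⊥: nothing is claimed beyond the fact that the call is still pending.
    · exact ⟨0, le_rfl, [], a :: rest, rfl, by simp, by simp⟩
    · exact absurd hb (by simp [litSem, approx, extG, PSeq.map, Outcome.run])
  | succ n ih =>
    intro m q gl K p' e b₀ h
    refine ⟨fun a ν η hν hr rest out hrest => ?_, fun θ l b hb => ?_⟩
    · have hstrict : ∀ b, (Literal.cut, b) ∈ gl → b <+: a ∧ b ≠ a := fun b hb =>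
        hr.parent b (List.mem_cons_of_mem _ hb)
      obtain ⟨G', σ, U⟩ := ν
      obtain rfl : G' = .call p' (fun j => η (e j)) :: instGoal η gl := hr.goal
      have hU : U.Finite := hr.finite
      have hηU : η.codom ⊆ U := hr.codom
      have hbody : ∀ c : Clause L ar (ar p'), Sat C P T t n (Fin.castAddEmb c.extra ∘ q)
          (bodyGoal e a c.body ++ liftGoal (Fin.castAddEmb c.extra) gl) fun θ =>
          .run (fun θ => K (θ.restr (Fin.castAddEmb c.extra)))
            ((c.body.map (Literal.lmap (liftEmb c.extra e))).foldl (semLiteral (approx P n))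
              (.fin [θ], .nocut)).1
            (.ofFlag _ a ((c.body.map (Literal.lmap (liftEmb c.extra e))).foldl
              (semLiteral (approx P n)) (.fin [θ], .nocut)).2) := fun c =>
        ((h.mono (Nat.le_succ n)).lift (Fin.castAddEmb c.extra)).body hT (isGood_approx P n) ih _
          fun b hb => (hstrict b (cut_mem_liftGoal.1 hb)).1
      -- By `extG_semClause`, the body run in the context of the caller gives the value of the
      -- clause, extended.
      have hW : ∀ c : Clause L ar (ar p'),
          Outcome.run (fun θ => K (θ.restr (Fin.castAddEmb c.extra)))
            ((c.body.map (Literal.lmap (liftEmb c.extra e))).foldl (semLiteral (approx P n))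
              (.fin [(C.canon η).up c.extra], .nocut)).1
            (.ofFlag _ a ((c.body.map (Literal.lmap (liftEmb c.extra e))).foldl
              (semLiteral (approx P n)) (.fin [(C.canon η).up c.extra], .nocut)).2) =
          .run K (extG C e (C.canon η) (semClause (approx P n) c (restrG C e (C.canon η))).1)
            (.ofFlag _ a (semClause (approx P n) c (restrG C e (C.canon η))).2) := fun c => by
        have hc := extG_semClause (isGood_approx P n) e c (C.canon η)
        have hc₁ := congrArg Prod.fst hc
        have hc₂ := congrArg Prod.snd hc
        simp only at hc₁ hc₂
        rw [hc₁, hc₂]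
        exact (Outcome.run_map K _ _ _).symm
      have hsome : ∀ i c, (P p').clauses[i]? = some c → (T (a ++ [i])).isSome := fun i c hc => by
        obtain ⟨y, hy⟩ := exists_embedding_avoiding (ar p' + c.extra) hU
        obtain ⟨μ, hμ⟩ := exists_head_mgu (e := c.extra) (t := fun j => η (e j)) (y := y)
          fun j hj => hy j (hηU (PS.codom_comp_subset η e hj))
        exact hT.complete a i _ _ hν (.call p' _ _ σ μ U i c hc y hy hμ)
      have hchild : ∀ i c, (P p').clauses[i]? = some c → ∀ rest out,
          (∀ a' ∈ rest, ¬ a ++ [i] <+: a') → Reaches C P T t n [a ++ [i]] rest out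
            (.run K (extG C e (C.canon η) (semClause (approx P n) c (restrG C e (C.canon η))).1)
            (.ofFlag _ a (semClause (approx P n) c (restrG C e (C.canon η))).2)) := by
        intro i c hc rest out hrest
        obtain ⟨ν', hν'⟩ := Option.isSome_iff_exists.1 (hsome i c hc)
        obtain ⟨c', y, μ, hc', hy, hμ, hν''⟩ := (hT.child a i _ _ hν hν').call_inv
        obtain rfl : c = c' := Option.some.inj (hc.symm.trans hc')
        subst hν''
        have := (hbody c).reaches _ _ _ hν' (hr.call_child hμ.1 c.body i) rest out hrest
        rwa [canon_app_head_mgu (fun j hj => hy j (hηU hj)) hμ, hW] at this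
      have hsig : ∀ c ∈ (P p').clauses, ∀ l b', Outcome.run K (extG C e (C.canon η)
          (semClause (approx P n) c (restrG C e (C.canon η))).1)
          (.ofFlag _ a (semClause (approx P n) c (restrG C e (C.canon η))).2) =
            .done l (some b') → b' <+: a := by
        intro c _ l b' hl
        rw [← hW] at hl
        have := (hbody c).signal _ _ _ hl
        rcases List.mem_append.1 this with h' | h'
        · obtain ⟨_, _, h'⟩ := List.mem_map.1 h'
          rw [← (Prod.mk.inj h').2]
        · exact (hstrict b' (cut_mem_liftGoal.1 h')).1
      -- Cuts in the continuation have parents strictly above `a`, so the continuation never signals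
      -- `a`.
      have hmain := reaches_procedure (P := P) (T := T) (t := t) (n := n)
        (K := K) (a := a) (fun θ l hl => (hstrict a (h.signal _ _ _ hl)).2 rfl)
        (isGood_approx P n) e (C.canon η) (P p') 0
        (by simpa only [Nat.zero_add] using hchild) hsig rest out hrest
      refine hmain.of_visit ?_
      rw [List.singleton_append, visit_call hν, children, List.range_eq_range']
      congr 2
      refine List.filter_eq_self.2 fun a' ha' => ?_
      obtain ⟨i, hi, rfl⟩ := List.mem_map.1 ha'
      have hi' : i < (P p').clauses.length := by
        have := (List.mem_range'_1.1 hi).2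
        rwa [Nat.zero_add] at this
      exact hsome i _ (List.getElem?_eq_getElem hi')
    · rcases Outcome.run_eq_done_some hb with ⟨θ', l'', h'⟩ | ⟨l'', h'⟩
      · exact List.mem_cons_of_mem _ (h.signal _ _ _ h')
      · simp at h'

/-- The root is the call of `p` on all variables of the context `t`; here extending the result is
the identity. -/
theorem reaches_query {p : N} {t : PS L SV (ar p)} (hT : IsOLDTree P p t T) :
    Reaches C P T t n [[]] [] [] (.run (fun θ => .done [θ] none) (approx P n p (C.canon t))
      (.done [] none)) := by
  have h := (Sat.call (n := n) hT p (.refl _) [] (sat_nil (C := C) (q := id))).reaches [] _ t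
    hT.root ⟨rfl, t.sub_var, subset_rfl, t.finite_codom, by simp⟩ [] [] (by simp)
  have h₁ : restrG C (.refl _) (C.canon t) = C.canon t := CPS.restr_id _
  have h₂ : litSem (approx P n) (.call (L := L) p (.refl _)) (C.canon t) =
      approx P n p (C.canon t) := by
    simp only [litSem]
    rw [h₁, extG_eq]
    conv_rhs => rw [show approx P n p (C.canon t) = (approx P n p (C.canon t)).map id by
      cases approx P n p (C.canon t) <;> simp [PSeq.map, Stream'.map_id]]
    exact map_congr fun θ hθ => CPS.ext_eq
      (CPS.isExt_id _ ((isGood_approx P n p (C.canon t)).2 θ hθ))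
  rw [h₂] at h
  simpa only [CPS.restr_id] using h

theorem run_single_fin {A : Type*} (l : List A) :
    Outcome.run (fun θ => .done [θ] none) (.fin l) (.done [] none) = .done l none := by
  induction l with
  | nil => rfl
  | cons a l ih =>
    rw [Outcome.run] at ih ⊢
    rw [List.foldr_cons, ih]
    rfl

theorem run_single_inc {A : Type*} (l : List A) (z : Outcome A) :
    Outcome.run (fun θ => .done [θ] none) (.inc l) z = .stuck l := by
  induction l with
  | nil => rfl
  | cons a l ih =>
    rw [Outcome.run] at ih ⊢
    rw [List.foldr_cons, ih]
    rfl

end Calls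

end PrologCut

namespace PrologCut

/-! ### Answer sequences as limits of the stages of a traversal. -/

section AnswerSequences

variable {L : FirstOrder.Language.{u, v}} {SV : Type w} {N : Type x} {ar : N → ℕ}
  {P : Program L ar} {T : Addr → Option (Node L SV ar)} {V : Set SV}

open PSeq

theorem visit_snd (st : List Addr × List (StdSubst L SV)) :
    (visit P T V st).2 = st.2 ∨ ∃ σ : StdSubst L SV, (visit P T V st).2 = st.2 ++ [σ.restrict V] := by
  rcases st with ⟨_ | ⟨a, rest⟩, out⟩
  · exact Or.inl rfl
  · rcases hT : T a with _ | ⟨G, σ, U⟩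
    · exact Or.inl (by simp [visit, hT])
    · rcases G with _ | ⟨l | l | l, G⟩
      · exact Or.inr ⟨σ, by rw [visit_nil hT]⟩
      · exact Or.inl (by rw [visit_call hT])
      · exact Or.inl (by rw [visit_eq hT])
      · exact Or.inl (by rw [visit_cut hT])

theorem traversal_succ (k : ℕ) :
    traversal P T V (k + 1) = visit P T V (traversal P T V k) :=
  Function.iterate_succ_apply' _ _ _

theorem traversal_snd_mono {j k : ℕ} (h : j ≤ k) :
    (traversal P T V j).2 <+: (traversal P T V k).2 := by
  induction h with
  | refl => exact List.prefix_rfl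
  | step _ ih =>
    refine ih.trans ?_
    rw [traversal_succ]
    rcases visit_snd (P := P) (T := T) (V := V) (traversal P T V _) with h | ⟨σ, h⟩ <;> rw [h]
    exact List.prefix_append _ _

theorem traversal_eq_of_nil {j k : ℕ} (h : j ≤ k) (hj : (traversal P T V j).1 = []) :
    traversal P T V k = traversal P T V j := by
  induction h with
  | refl => rfl
  | step _ ih =>
    rw [traversal_succ, ih]
    rcases hs : traversal P T V j with ⟨pend, out⟩
    rw [hs] at hj
    simp only at hj
    subst hj
    rfl

/-- Each step adds at most one answer, so no length is skipped. The definition of an infinite answer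
sequence asks for every prefix exactly. -/
theorem exists_traversal_snd_eq_take (k n : ℕ) (h : n ≤ (traversal P T V k).2.length) :
    ∃ j, (traversal P T V j).2 = (traversal P T V k).2.take n := by
  induction k with
  | zero =>
    refine ⟨0, ?_⟩
    simp [traversal]
  | succ k ih =>
    by_cases hn : n ≤ (traversal P T V k).2.length
    · obtain ⟨j, hj⟩ := ih hn
      refine ⟨j, ?_⟩
      obtain ⟨m, hm⟩ := traversal_snd_mono (P := P) (T := T) (V := V) (Nat.le_succ k)
      rw [hj, ← hm, List.take_append_of_le_length hn]
    · refine ⟨k + 1, ?_⟩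
      rw [List.take_of_length_le]
      rw [traversal_succ] at h ⊢
      rcases visit_snd (P := P) (T := T) (V := V) (traversal P T V k) with h' | ⟨σ, h'⟩ <;>
        rw [h'] at h ⊢
      · omega
      · rw [List.length_append, List.length_singleton] at h ⊢
        omega

theorem dom_of_mem_traversal {k : ℕ} {σ : StdSubst L SV} (h : σ ∈ (traversal P T V k).2) :
    σ.dom ⊆ V := by
  induction k with
  | zero => simp [traversal] at h
  | succ k ih =>
    rw [traversal_succ] at h
    rcases visit_snd (P := P) (T := T) (V := V) (traversal P T V k) with h' | ⟨τ, h'⟩ <;>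
      rw [h'] at h
    · exact ih h
    · rcases List.mem_append.1 h with h | h
      · exact ih h
      · rw [List.mem_singleton.1 h]
        intro y hy
        by_contra hyV
        exact hy (if_neg hyV)

open Classical in
variable (P T V) in
/-- The answers found in `k` steps of the traversal, followed by `⊥` if it is not finished. -/
noncomputable def outSeq (k : ℕ) : PSeq (StdSubst L SV) :=
  if (traversal P T V k).1 = [] then .fin (traversal P T V k).2 else .inc (traversal P T V k).2

theorem outSeq_eq_fin_iff {k : ℕ} {l : List (StdSubst L SV)} :
    outSeq P T V k = .fin l ↔ traversal P T V k = ([], l) := by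
  rw [outSeq]
  split_ifs with h <;> simp [Prod.ext_iff, h]

theorem outSeq_eq_inc_iff {k : ℕ} {l : List (StdSubst L SV)} :
    outSeq P T V k = .inc l ↔ (traversal P T V k).1 ≠ [] ∧ (traversal P T V k).2 = l := by
  rw [outSeq]
  split_ifs with h <;> simp [h]

theorem inc_le_outSeq {k : ℕ} : .inc (traversal P T V k).2 ≤ outSeq P T V k := by
  rw [outSeq]
  split_ifs
  · exact inc_le_fin.2 List.prefix_rfl
  · exact le_rfl

theorem outSeq_mono : Monotone (outSeq P T V) := by
  intro j k h
  by_cases hj : (traversal P T V j).1 = []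
  · rw [outSeq, outSeq, traversal_eq_of_nil h hj]
  · have : outSeq P T V j = .inc (traversal P T V j).2 := if_neg hj
    rw [this]
    exact (inc_le_inc.2 (traversal_snd_mono h)).trans inc_le_outSeq

theorem PSeq.lim_of_eventually_eq {α : Type*} {c : ℕ → PSeq α} (hc : Monotone c) {S : PSeq α}
    {n₀ : ℕ} (h : ∀ n ≥ n₀, c n = S) : Lim c S :=
  ⟨fun n => (hc (le_max_left n n₀)).trans (h _ (le_max_right _ _)).le,
    fun _ _ hX => ⟨n₀, fun n hn => by rwa [h n hn]⟩⟩

/-- With answer sequences expressed as limits, existence and uniqueness for a given tree follow from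
the order theory. -/
theorem isAnswerSeq_iff {S : PSeq (StdSubst L SV)} :
    IsAnswerSeq P T V S ↔ Lim (outSeq P T V) S := by
  constructor
  · intro h
    cases S with
    | fin l =>
      obtain ⟨k, hk⟩ := h
      refine lim_of_eventually_eq outSeq_mono (n₀ := k) fun n hn => ?_
      rw [outSeq_eq_fin_iff, traversal_eq_of_nil hn (by rw [hk]), hk]
    | inc l =>
      obtain ⟨h₁, k₀, hk₀⟩ := h
      exact lim_of_eventually_eq outSeq_mono (n₀ := k₀)
        fun n hn => outSeq_eq_inc_iff.2 ⟨h₁ n, hk₀ n hn⟩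
    | inf s =>
      have hlen : ∀ n, ∃ k, (traversal P T V k).2 = s.take n := h
      -- There is always a later stage with one more answer, so the traversal never ends.
      have key : ∀ k, ∃ k' ≥ k, (traversal P T V k').2 =
          s.take ((traversal P T V k).2.length + 1) := fun k => by
        obtain ⟨k', hk'⟩ := hlen ((traversal P T V k).2.length + 1)
        refine ⟨k', ?_, hk'⟩
        by_contra hlt
        have := (traversal_snd_mono (P := P) (T := T) (V := V)
          (show k' ≤ k by omega)).length_le
        rw [hk', Stream'.length_take] at this
        omega
      refine ⟨fun k => ?_, fun X hX hXS => ?_⟩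
      · obtain ⟨k', hkk', hk'⟩ := key k
        have hne : (traversal P T V k).1 ≠ [] := fun hnil => by
          rw [traversal_eq_of_nil hkk' hnil] at hk'
          have := congrArg List.length hk'
          rw [Stream'.length_take] at this
          omega
        rw [outSeq_eq_inc_iff.2 ⟨hne, rfl⟩]
        refine (inc_le_inc.2 (traversal_snd_mono hkk')).trans ?_
        rw [hk']
        exact inc_take_le _ _
      · cases X with
        | fin m => cases eq_of_fin_le hXS
        | inf m => exact hX.elim
        | inc m =>
          obtain ⟨k, hk⟩ := hlen m.length
          rw [inc_le_inf.1 hXS] at hk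
          refine ⟨k, fun n hn => ?_⟩
          rw [← hk]
          exact (inc_le_inc.2 (traversal_snd_mono hn)).trans inc_le_outSeq
  · intro h
    cases S with
    | fin l =>
      obtain ⟨k, hk⟩ := h.2 (.fin l) trivial le_rfl
      exact ⟨k, outSeq_eq_fin_iff.1 (eq_of_fin_le (hk k le_rfl))⟩
    | inc l =>
      refine ⟨fun k hk => ?_, ?_⟩
      · have := h.1 k
        rw [outSeq, if_pos hk] at this
        cases eq_of_fin_le this
      · obtain ⟨k, hk⟩ := h.2 (.inc l) trivial le_rfl
        exact ⟨k, fun n hn => (outSeq_eq_inc_iff.1 (le_antisymm (h.1 n) (hk n hn))).2⟩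
    | inf s =>
      intro n
      obtain ⟨k, hk⟩ := h.2 (.inc (s.take n)) trivial (inc_take_le s n)
      have h₁ := hk k le_rfl
      have h₂ : s.take n <+: (traversal P T V k).2 := by
        rw [outSeq] at h₁
        split_ifs at h₁
        · exact inc_le_fin.1 h₁
        · exact inc_le_inc.1 h₁
      obtain ⟨j, hj⟩ := exists_traversal_snd_eq_take (P := P) (T := T) (V := V) k n
        (by simpa using h₂.length_le)
      refine ⟨j, ?_⟩
      rw [hj]
      conv_rhs => rw [List.prefix_iff_eq_take.1 h₂, Stream'.length_take]

theorem exists_isAnswerSeq : ∃ S, IsAnswerSeq P T V S :=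
  (exists_lim outSeq_mono).imp fun _ => isAnswerSeq_iff.2

theorem IsAnswerSeq.dom_subset {S : PSeq (StdSubst L SV)} (h : IsAnswerSeq P T V S) :
    ∀ σ ∈ S.elems, σ.dom ⊆ V := by
  intro σ hσ
  obtain ⟨k, hk⟩ := (isAnswerSeq_iff.1 h).exists_mem_elems hσ
  refine dom_of_mem_traversal (P := P) (T := T) (k := k) ?_
  rw [outSeq] at hk
  split_ifs at hk <;> exact hk

/-- Every approximation is the image of a stage `j n ≥ n`. Although `j` need not be monotone, `j n ≥
n` suffices for the approximations to inherit the limit of the stages. -/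
theorem IsOLDTree.semantics_eq [Infinite SV] {C : Canon L SV} {p : N} {t : PS L SV (ar p)}
    (hT : IsOLDTree P p t T) {S : PSeq (StdSubst L SV)} (hS : IsAnswerSeq P T t.codom S) :
    semantics P p (C.canon t) = S.map fun σ => C.canon (t.app σ) := by
  have key : ∀ n, ∃ j ≥ n, approx P n p (C.canon t) =
      (outSeq P T t.codom j).map fun σ => C.canon (t.app σ) := fun n => by
    have h := reaches_query (C := C) (n := n) hT
    have hc := (isGood_approx P n p (C.canon t)).1
    generalize approx P n p (C.canon t) = D at h hc ⊢
    rcases D with l | l | s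
    · rw [run_single_fin] at h
      obtain ⟨j, l', rfl, hj⟩ := h
      have hj' : traversal P T t.codom j = ([], l') := hj
      -- A finished traversal is stationary, so the stage can be postponed beyond `n`.
      refine ⟨max n j, le_max_left _ _, ?_⟩
      have hj'' : traversal P T t.codom (max n j) = ([], l') := by
        rw [traversal_eq_of_nil (le_max_right n j) (by rw [hj']), hj']
      rw [outSeq_eq_fin_iff.2 hj'']
      rfl
    · rw [run_single_inc] at h
      obtain ⟨j, hjn, l', pend, rfl, hp, hj⟩ := h
      have hj' : traversal P T t.codom j = (pend, l') := hj
      refine ⟨j, hjn, ?_⟩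
      rw [outSeq_eq_inc_iff.2 ⟨by rw [hj']; exact hp, by rw [hj']⟩]
      rfl
    · exact hc.elim
  choose j hj hj' using key
  have h₁ := (isAnswerSeq_iff.1 hS).map fun σ => C.canon (t.app σ)
  have h₂ : Lim (fun n => approx P n p (C.canon t)) (S.map fun σ => C.canon (t.app σ)) := by
    simp only [hj']
    refine ⟨fun n => h₁.1 _, fun X hX hXS => ?_⟩
    obtain ⟨n₀, hn₀⟩ := h₁.2 X hX hXS
    exact ⟨n₀, fun n hn => hn₀ _ (hn.trans (hj n))⟩
  exact (lim_semantics P p (C.canon t)).unique h₂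

end AnswerSequences

/-! ### Construction and modification of OLD-trees. -/

section Trees

variable {L : FirstOrder.Language.{u, v}} {SV : Type w} {N : Type x} {ar : N → ℕ}

open Classical in
/-- The tree that is obtained from a root by choosing children that satisfy `Q`, for reversed
addresses. -/
noncomputable def buildTree (P : Program L ar) (root : Node L SV ar)
    (Q : Addr → Node L SV ar → Prop) : Addr → Option (Node L SV ar)
  | [] => some root
  | i :: r =>
    match buildTree P root Q r with
    | none => none
    | some ν =>
      if h : ∃ ν', Child P r.reverse ν i ν' ∧ Q (r.reverse ++ [i]) ν' then some h.choose else none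

/-- OLD-trees all nodes of which satisfy an invariant. -/
theorem exists_isOLDTree {P : Program L ar} {p : N} {t : PS L SV (ar p)}
    {Q : Addr → Node L SV ar → Prop} (h₀ : Q [] ⟨[.call p t], .id, t.codom⟩)
    (hQ : ∀ a ν i ν', Q a ν → Child P a ν i ν' → ∃ ν', Child P a ν i ν' ∧ Q (a ++ [i]) ν') :
    ∃ T, IsOLDTree P p t T ∧ ∀ a ν, T a = some ν → Q a ν := by
  let root : Node L SV ar := ⟨[.call p t], .id, t.codom⟩
  let B := buildTree P root Q
  have hnone : ∀ r i, B r = none → B (i :: r) = none := fun r i h => by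
    simp only [B] at h ⊢
    rw [buildTree, h]
  have hsome : ∀ r i ν ν', B r = some ν → B (i :: r) = some ν' →
      Child P r.reverse ν i ν' ∧ Q (r.reverse ++ [i]) ν' := fun r i ν ν' h h' => by
    simp only [B] at h h'
    simp only [buildTree, h] at h'
    split_ifs at h' with hex
    · rw [← Option.some.inj h']
      exact hex.choose_spec
  have hB : ∀ r ν, B r = some ν → Q r.reverse ν := fun r => by
    induction r with
    | nil =>
      intro ν h
      rw [← Option.some.inj h]
      exact h₀
    | cons i r ih =>
      intro ν' h'
      rcases h : B r with _ | ν
      · rw [hnone r i h] at h'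
        cases h'
      · rw [List.reverse_cons]
        exact (hsome r i ν ν' h h').2
  refine ⟨fun a => B a.reverse, ⟨rfl, fun a i h => ?_, fun a i ν ν' h h' => ?_,
    fun a i ν ν' h h' => ?_⟩, fun a ν h => ?_⟩
  · rw [List.reverse_concat]
    exact hnone _ _ h
  · rw [List.reverse_concat] at h'
    have := (hsome _ _ _ _ h h').1
    rwa [List.reverse_reverse] at this
  · rw [List.reverse_concat]
    have hq := hB _ _ h
    rw [List.reverse_reverse] at hq
    have hex : ∃ ν', Child P a.reverse.reverse ν i ν' ∧ Q (a.reverse.reverse ++ [i]) ν' := by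
      rw [List.reverse_reverse]
      exact hQ a ν i ν' hq h'
    simp only [B] at h ⊢
    simp only [buildTree, h, dif_pos hex]
    rfl
  · have := hB _ _ h
    rwa [List.reverse_reverse] at this

/-- Goals that consist of cuts only. -/
def AllCut (G : List (GoalLit L SV ar)) : Prop := ∀ l ∈ G, ∃ b, l = .cut b

theorem AllCut.of_map_app {μ : StdSubst L SV} {G : List (GoalLit L SV ar)}
    (h : AllCut (G.map (GoalLit.app μ))) : AllCut G := fun l hl => by
  obtain ⟨b, hb⟩ := h _ (List.mem_map.2 ⟨l, hl, rfl⟩)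
  cases l with
  | call p t => cases hb
  | eq s t => cases hb
  | cut b => exact ⟨b, rfl⟩

theorem AllCut.map_app {G : List (GoalLit L SV ar)} (h : AllCut G) (μ : StdSubst L SV) :
    G.map (GoalLit.app μ) = G := by
  conv_rhs => rw [← List.map_id G]
  refine List.map_congr_left fun l hl => ?_
  obtain ⟨b, rfl⟩ := h l hl
  rfl

theorem StdSubst.comp_assoc (σ τ υ : StdSubst L SV) :
    (σ.comp τ).comp υ = σ.comp (τ.comp υ) :=
  StdSubst.ext fun y => subst_subst (σ.toFun y) τ.toFun υ.toFun

/-- The inverse renaming is absorbed into the substitution through which another unifier factors. -/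
theorem StdSubst.IsMGU.comp_renaming {ι : Type*} {μ : StdSubst L SV} {s t : ι → L.Term SV}
    (h : μ.IsMGU s t) {ρ : StdSubst L SV} (hρ : ρ.IsRenaming) : (μ.comp ρ).IsMGU s t := by
  obtain ⟨e, he⟩ := hρ
  refine ⟨fun i => ?_, fun τ hτ => ?_⟩
  · change (s i).subst (fun y => (μ.toFun y).subst ρ.toFun) = (t i).subst _
    rw [← subst_subst, h.1 i, subst_subst]
    rfl
  · obtain ⟨δ, rfl⟩ := h.2 τ hτ
    let ρ' : StdSubst L SV := ⟨fun y => .var (e.symm y), by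
      refine ρ.finite_dom.subset fun y hy h => hy ?_
      rw [he] at h
      simp only [FirstOrder.Language.Term.var.injEq] at h ⊢
      rw [Equiv.symm_apply_eq, h]⟩
    have hρρ' : ρ.comp ρ' = .id := StdSubst.ext fun y => by
      simp [StdSubst.comp, he, ρ', FirstOrder.Language.Term.subst, StdSubst.id]
    refine ⟨ρ'.comp δ, ?_⟩
    rw [comp_assoc, ← comp_assoc ρ, hρρ']
    rfl

/-- `ν'` differs from the node `ν` of a tree by a renaming of the last unifier on its branch, which
is determined by the address of the leaf reached by cuts only. -/
def Modified (T : Addr → Option (Node L SV ar)) (ρ : Addr → StdSubst L SV) (a : Addr)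
    (ν' : Node L SV ar) : Prop :=
  ∃ ν, T a = some ν ∧ ν'.goal = ν.goal ∧ (¬ AllCut ν.goal → ν' = ν) ∧
    -- A goal of `r` cuts leads along `r` children numbered `0` to a single leaf; the renaming
    -- attached to that leaf is used.
    (AllCut ν.goal → ν'.subst = ν.subst.comp (ρ (a ++ List.replicate ν.goal.length 0)))

/-- As long as the goal contains a call or an equation, nothing is modified. When a step turns it
into cuts only, this step is the last unification on the branch, and its unifier is composed with
the renaming; cuts are not affected by it. Below that point the renaming is carried along. -/
theorem Modified.child {P : Program L ar} {p : N} {t : PS L SV (ar p)}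
    {T : Addr → Option (Node L SV ar)} (hT : IsOLDTree P p t T) {ρ : Addr → StdSubst L SV}
    (hρ : ∀ a, (ρ a).IsRenaming) {a : Addr} {ν ν₁ : Node L SV ar} {i : ℕ}
    (h : Modified T ρ a ν) (h₁ : Child P a ν i ν₁) :
    ∃ ν', Child P a ν i ν' ∧ Modified T ρ (a ++ [i]) ν' := by
  obtain ⟨ν₀, hν₀, hgoal, hne, hall⟩ := h
  by_cases hc : AllCut ν₀.goal
  · have hsub := hall hc
    obtain ⟨G, σ, U⟩ := ν
    obtain ⟨G₀, σ₀, U₀⟩ := ν₀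
    simp only at hgoal hsub hc
    subst hgoal hsub
    cases h₁ with
    | eq s t G _ μ _ hμ => obtain ⟨b, hb⟩ := hc (.eq s t) (by simp); cases hb
    | call p t G _ μ _ _ c hci y hy hμ => obtain ⟨b, hb⟩ := hc (.call p t) (by simp); cases hb
    | cut b G =>
      have hchild : Child P a ⟨.cut b :: G, σ₀, U₀⟩ 0 ⟨G, σ₀, U₀⟩ := .cut b G σ₀ U₀
      obtain ⟨ν', hν'⟩ := Option.isSome_iff_exists.1 (hT.complete a 0 _ _ hν₀ hchild)
      have hν'' := (hT.child a 0 _ _ hν₀ hν').cut_inv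
      subst hν''
      have hG : AllCut G := fun l hl => hc l (by simp [hl])
      refine ⟨_, .cut b G _ U, _, hν', rfl, fun h => (h hG).elim, fun _ => ?_⟩
      simp [List.replicate_succ]
  · obtain rfl := hne hc
    obtain ⟨ν', hν'⟩ := Option.isSome_iff_exists.1 (hT.complete a i _ _ hν₀ h₁)
    have hch := hT.child a i _ _ hν₀ hν'
    by_cases hc' : AllCut ν'.goal
    · have hren := hρ ((a ++ [i]) ++ List.replicate ν'.goal.length 0)
      obtain ⟨ν'', h₂, h₃, h₄⟩ : ∃ ν'', Child P a ν i ν'' ∧ ν''.goal = ν'.goal ∧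
          ν''.subst = ν'.subst.comp (ρ ((a ++ [i]) ++ List.replicate ν'.goal.length 0)) := by
        cases hch with
        | cut b G σ U =>
          refine (hc fun l hl => ?_).elim
          rcases List.mem_cons.1 hl with rfl | hl
          · exact ⟨b, rfl⟩
          · exact hc' l hl
        | eq s t G σ μ U hμ =>
          refine ⟨_, .eq s t G σ _ U (hμ.comp_renaming hren), ?_,
            (StdSubst.comp_assoc _ _ _).symm⟩
          have := hc'.of_map_app
          simp only [this.map_app]
        | call p t G σ μ U i c hci y hy hμ =>
          refine ⟨_, .call p t G σ _ U i c hci y hy (hμ.comp_renaming hren), ?_,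
            (StdSubst.comp_assoc _ _ _).symm⟩
          have := hc'.of_map_app
          simp only [this.map_app]
      exact ⟨ν'', h₂, ν', hν', h₃, fun h => (h hc').elim, fun _ => h₄⟩
    · exact ⟨ν', hch, ν', hν', rfl, fun _ => rfl, fun h => (hc' h).elim⟩

/-- An OLD-tree that differs from a given one only in renamings of the computed answers. -/
theorem exists_modified_tree {P : Program L ar} {p : N} {t : PS L SV (ar p)}
    {T : Addr → Option (Node L SV ar)} (hT : IsOLDTree P p t T) {ρ : Addr → StdSubst L SV}
    (hρ : ∀ a, (ρ a).IsRenaming) :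
    ∃ T', IsOLDTree P p t T' ∧ ∀ a, (T a = none ∧ T' a = none) ∨
      ∃ ν ν', T a = some ν ∧ T' a = some ν' ∧ ν'.goal = ν.goal ∧
        (ν.goal = [] → ν'.subst = ν.subst.comp (ρ a)) := by
  obtain ⟨T', hT', hmod⟩ := exists_isOLDTree (P := P) (p := p) (t := t) (Q := Modified T ρ)
    ⟨_, hT.root, rfl, fun _ => rfl, fun h => by
      obtain ⟨b, hb⟩ := h (.call p t) (by simp)
      cases hb⟩ fun a ν i ν' h h' => h.child hT hρ h'
  refine ⟨T', hT', fun a => ?_⟩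
  -- The modified tree has no fewer nodes: from modified nodes only cuts are selected, and these
  -- always succeed.
  have hsome : ∀ a, (T a).isSome → (T' a).isSome := fun a => by
    induction a using List.reverseRecOn with
    | nil => intro _; rw [hT'.root]; rfl
    | append_singleton a i ih =>
      intro h
      obtain ⟨ν₁, hν₁⟩ := Option.isSome_iff_exists.1 h
      rcases hTa : T a with _ | ν
      · rw [hT.outside a i hTa] at hν₁
        cases hν₁
      · obtain ⟨ν', hν'⟩ := Option.isSome_iff_exists.1 (ih (by rw [hTa]; rfl))
        have hch := hT.child a i _ _ hTa hν₁
        obtain ⟨ν₀, hν₀, hgoal, hne, _⟩ := hmod a ν' hν'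
        obtain rfl : ν = ν₀ := Option.some.inj (hTa.symm.trans hν₀)
        by_cases hc : AllCut ν.goal
        · cases hch with
          | eq s t => obtain ⟨b, hb⟩ := hc (.eq s t) (by simp); cases hb
          | call p t => obtain ⟨b, hb⟩ := hc (.call p t) (by simp); cases hb
          | cut b G σ U =>
            obtain ⟨G', σ', U'⟩ := ν'
            simp only at hgoal
            subst hgoal
            exact hT'.complete a 0 _ _ hν' (.cut b G σ' U')
        · rw [hne hc] at hν'
          exact hT'.complete a i _ _ hν' hch
  rcases hTa : T a with _ | ν
  · refine Or.inl ⟨rfl, ?_⟩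
    rcases hTa' : T' a with _ | ν'
    · rfl
    · obtain ⟨ν₀, hν₀, _⟩ := hmod a ν' hTa'
      rw [hTa] at hν₀
      cases hν₀
  · obtain ⟨ν', hν'⟩ := Option.isSome_iff_exists.1 (hsome a (by rw [hTa]; rfl))
    obtain ⟨ν₀, hν₀, hgoal, _, hall⟩ := hmod a ν' hν'
    obtain rfl : ν = ν₀ := Option.some.inj (hTa.symm.trans hν₀)
    refine Or.inr ⟨ν, ν', rfl, hν', hgoal, fun h => ?_⟩
    have := hall (by rw [h]; intro l hl; cases hl)
    simpa [h] using this

end Trees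

end PrologCut

namespace PrologCut

/-! ### From a prescribed sequence to an OLD-tree. -/

section Backward

variable {L : FirstOrder.Language.{u, v}} {SV : Type w} {N : Type x} {ar : N → ℕ}
  {P : Program L ar} {T : Addr → Option (Node L SV ar)} {V : Set SV}

/-- Neither of two addresses lies below the other. -/
def Incomparable (a b : Addr) : Prop := ¬ a <+: b ∧ ¬ b <+: a

theorem children_shape (a : Addr) (G : List (GoalLit L SV ar)) :
    (children P T a G).Pairwise Incomparable ∧ ∀ b ∈ children P T a G, ∃ i, b = a ++ [i] := by
  constructor
  · refine List.Pairwise.filter _ (List.pairwise_map.2 (List.nodup_range.imp ?_))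
    intro i j hij
    refine ⟨fun h => hij ?_, fun h => hij ?_⟩ <;> have := h.eq_of_length (by simp) <;>
      simp_all
  · intro b hb
    obtain ⟨i, -, rfl⟩ := List.mem_map.1 (List.mem_filter.1 hb).1
    exact ⟨i, rfl⟩

theorem visit_shape (a : Addr) (rest : List Addr) (out : List (StdSubst L SV)) :
    ∃ ch rest', (visit P T V (a :: rest, out)).1 = ch ++ rest' ∧ rest'.Sublist rest ∧
      ch.Pairwise Incomparable ∧ ∀ b ∈ ch, ∃ i, b = a ++ [i] := by
  rcases hT : T a with _ | ⟨G, σ, U⟩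
  · exact ⟨[], rest, by simp [visit, hT], List.Sublist.refl _, .nil, by simp⟩
  · rcases G with _ | ⟨l | l | l, G⟩
    · exact ⟨[], rest, by rw [visit_nil hT]; rfl, List.Sublist.refl _, .nil, by simp⟩
    · exact ⟨_, rest, by rw [visit_call hT], List.Sublist.refl _, children_shape _ _⟩
    · exact ⟨_, rest, by rw [visit_eq hT], List.Sublist.refl _, children_shape _ _⟩
    · exact ⟨_, prune (some l) rest, by rw [visit_cut hT], List.filter_sublist, children_shape _ _⟩

/-- A step replaces the first pending address by pairwise incomparable children of it and possibly
drops others. -/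
theorem pairwise_incomparable_traversal (k : ℕ) :
    (traversal P T V k).1.Pairwise Incomparable := by
  induction k with
  | zero => simp [traversal]
  | succ k ih =>
    rw [traversal_succ]
    generalize traversal P T V k = st at ih ⊢
    rcases st with ⟨_ | ⟨a, rest⟩, out⟩
    · exact ih
    · obtain ⟨ch, rest', h, hr, hch, hc⟩ := visit_shape (P := P) (T := T) (V := V) a rest out
      rw [h]
      obtain ⟨h₁, h₂⟩ := List.pairwise_cons.1 ih
      refine List.pairwise_append.2 ⟨hch, h₂.sublist hr, fun b hb c hcr => ?_⟩
      obtain ⟨i, rfl⟩ := hc b hb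
      obtain ⟨h₃, h₄⟩ := h₁ c (hr.subset hcr)
      refine ⟨fun h => h₃ ((List.prefix_append _ _).trans h), fun h => ?_⟩
      rcases List.prefix_concat_iff.1 h with h | h
      · exact h₃ (h ▸ List.prefix_append _ _)
      · exact h₄ h

/-- Directly after the visit of `a`, the pending addresses are children of `a` or incomparable with
it. Later ones extend pending ones, so they cannot be prefixes of `a` either. -/
theorem not_prefix_of_visited {j k : ℕ} {a : Addr} (h : j < k)
    (ha : (traversal P T V j).1.head? = some a) : ∀ b ∈ (traversal P T V k).1, ¬ b <+: a := by
  induction h with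
  | refl =>
    have hp := pairwise_incomparable_traversal (P := P) (T := T) (V := V) j
    rw [traversal_succ]
    rcases hs : traversal P T V j with ⟨_ | ⟨a', rest⟩, out⟩ <;> rw [hs] at ha hp
    · cases ha
    · obtain rfl : a' = a := Option.some.inj ha
      obtain ⟨ch, rest', h, hr, -, hc⟩ := visit_shape (P := P) (T := T) (V := V) a' rest out
      rw [h]
      intro b hb
      rcases List.mem_append.1 hb with hb | hb
      · obtain ⟨i, rfl⟩ := hc b hb
        intro h
        have := h.length_le
        simp at this
      · exact ((List.pairwise_cons.1 hp).1 b (hr.subset hb)).2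
  | @step k _ ih =>
    rw [traversal_succ]
    rcases hs : traversal P T V k with ⟨_ | ⟨a', rest⟩, out⟩ <;> rw [hs] at ih
    · exact ih
    · obtain ⟨ch, rest', h, hr, -, hc⟩ := visit_shape (P := P) (T := T) (V := V) a' rest out
      rw [h]
      intro b hb
      rcases List.mem_append.1 hb with hb | hb
      · obtain ⟨i, rfl⟩ := hc b hb
        exact fun h => ih a' (by simp) ((List.prefix_append _ _).trans h)
      · exact ih b (List.mem_cons_of_mem _ (hr.subset hb))

/-- No address is visited twice. -/
theorem visited_injective {j k : ℕ} {a : Addr} (hj : (traversal P T V j).1.head? = some a)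
    (hk : (traversal P T V k).1.head? = some a) : j = k := by
  rcases lt_trichotomy j k with h | h | h
  · exact (not_prefix_of_visited h hj a (List.mem_of_mem_head? hk) List.prefix_rfl).elim
  · exact h
  · exact (not_prefix_of_visited h hk a (List.mem_of_mem_head? hj) List.prefix_rfl).elim

/-- The elements of a sequence, with a default value beyond its end. -/
def PSeq.getD {α : Type*} (S : PSeq α) (j : ℕ) (d : α) : α :=
  match S with
  | fin l => l.getD j d
  | inc l => l.getD j d
  | inf s => s.get j

theorem PSeq.map_getD {α β : Type*} (f : α → β) (S : PSeq α) (j : ℕ) (d : α) :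
    (S.map f).getD j (f d) = f (S.getD j d) := by
  cases S with
  | fin l => exact List.getD_map _ _ f
  | inc l => exact List.getD_map _ _ f
  | inf s => rfl

theorem PSeq.getD_mem {α : Type*} (S : PSeq α) (j : ℕ) (d : α) :
    S.getD j d ∈ S.elems ∨ S.getD j d = d := by
  have key : ∀ l : List α, l.getD j d ∈ l ∨ l.getD j d = d := fun l => by
    by_cases h : j < l.length
    · rw [List.getD_eq_getElem _ _ h]
      exact Or.inl (List.getElem_mem h)
    · exact Or.inr (List.getD_eq_default _ _ (by omega))
  cases S with
  | fin l => exact key l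
  | inc l => exact key l
  | inf s => exact Or.inl ⟨j, rfl⟩

theorem PSeq.getD_of_inc_le {α : Type*} {l : List α} {S : PSeq α} (h : .inc l ≤ S) {j : ℕ}
    (hj : j < l.length) (d : α) : S.getD j d = l[j] := by
  have key : ∀ m : List α, l <+: m → m.getD j d = l[j] := by
    rintro _ ⟨m, rfl⟩
    rw [List.getD_append _ _ _ _ hj, List.getD_eq_getElem _ _ hj]
  cases S with
  | fin m => exact key m (inc_le_fin.1 h)
  | inc m => exact key m (inc_le_inc.1 h)
  | inf s =>
    have := inc_le_inf.1 h
    simp only [PSeq.getD]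
    have h₂ : l[j]? = (s.take l.length)[j]? := by rw [this]
    rw [List.getElem?_eq_getElem hj, Stream'.getElem?_take hj] at h₂
    exact (Option.some.inj h₂).symm

/-- The traversals of two trees with the same goals run in parallel. -/
theorem traversal_congr {T' : Addr → Option (Node L SV ar)} {f : ℕ → StdSubst L SV}
    (h : ∀ a, (T a = none ∧ T' a = none) ∨ ∃ ν ν', T a = some ν ∧ T' a = some ν' ∧
      ν'.goal = ν.goal)
    (hf : ∀ k a ν', (traversal P T V k).1.head? = some a → T' a = some ν' → ν'.goal = [] →
      ν'.subst.restrict V = f (traversal P T V k).2.length) (k : ℕ) :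
    (traversal P T' V k).1 = (traversal P T V k).1 ∧
      (traversal P T' V k).2 = (List.range (traversal P T V k).2.length).map f := by
  have hch : ∀ a G, children P T' a G = children P T a G := fun a G => by
    refine List.filter_congr fun b _ => ?_
    rcases h b with ⟨h₁, h₂⟩ | ⟨ν, ν', h₁, h₂, -⟩ <;> rw [h₁, h₂]
    rfl
  induction k with
  | zero => exact ⟨rfl, rfl⟩
  | succ k ih =>
    have hfk := hf k
    rw [traversal_succ, traversal_succ]
    generalize traversal P T' V k = st' at ih ⊢
    obtain ⟨pend', out'⟩ := st'
    generalize traversal P T V k = st at ih hfk ⊢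
    obtain ⟨pend, out⟩ := st
    simp only at ih
    obtain ⟨h₁, h₂⟩ := ih
    subst h₁ h₂
    rcases pend' with _ | ⟨a, rest⟩
    · exact ⟨rfl, rfl⟩
    · rcases h a with ⟨h₁, h₂⟩ | ⟨⟨G, σ, U⟩, ⟨G', σ', U'⟩, h₁, h₂, hG⟩
      · simp [visit, h₁, h₂]
      · simp only at hG
        subst hG
        rcases G' with _ | ⟨l | l | l, G⟩
        · have := hfk a _ rfl h₂ rfl
          simp only at this
          rw [visit_nil h₁, visit_nil h₂, this]
          simp [List.range_succ]
        · rw [visit_call h₁, visit_call h₂, hch]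
          exact ⟨rfl, rfl⟩
        · rw [visit_eq h₁, visit_eq h₂, hch]
          exact ⟨rfl, rfl⟩
        · rw [visit_cut h₁, visit_cut h₂, hch]
          exact ⟨rfl, rfl⟩

theorem List.map_range_getD {α : Type*} (l : List α) (d : α) :
    (List.range l.length).map (fun j => l.getD j d) = l := by
  refine List.ext_getElem (by simp) fun i h₁ h₂ => ?_
  rw [List.getElem_map, List.getElem_range, List.getD_eq_getElem _ _ h₂]

/-- An answer sequence of a tree is transferred to a tree that is traversed in parallel. -/
theorem IsAnswerSeq.congr {α : Type*} {T' : Addr → Option (Node L SV ar)}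
    {S S' : PSeq (StdSubst L SV)} {d : StdSubst L SV} (hS : IsAnswerSeq P T V S)
    {f g : StdSubst L SV → α} (hSS' : S.map f = S'.map g)
    (h : ∀ k, (traversal P T' V k).1 = (traversal P T V k).1 ∧
      (traversal P T' V k).2 =
        (List.range (traversal P T V k).2.length).map fun j => S'.getD j d) :
    IsAnswerSeq P T' V S' := by
  cases S with
  | fin l =>
    cases S' with
    | fin l' =>
      obtain ⟨k, hk⟩ := hS
      have hl : l.length = l'.length := by
        simpa using congrArg List.length (PSeq.fin.inj hSS')
      refine ⟨k, Prod.ext (by rw [(h k).1, hk]) ?_⟩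
      rw [(h k).2, hk]
      simp only [hl]
      exact List.map_range_getD l' d
    | inc _ => cases hSS'
    | inf _ => cases hSS'
  | inc l =>
    cases S' with
    | inc l' =>
      obtain ⟨hk, k₀, hk₀⟩ := hS
      have hl : l.length = l'.length := by
        simpa using congrArg List.length (PSeq.inc.inj hSS')
      refine ⟨fun k => by rw [(h k).1]; exact hk k, k₀, fun k hkk => ?_⟩
      rw [(h k).2, hk₀ k hkk, hl]
      exact List.map_range_getD l' d
    | fin _ => cases hSS'
    | inf _ => cases hSS'
  | inf s =>
    cases S' with
    | inf s' =>
      intro n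
      obtain ⟨k, hk⟩ := hS n
      refine ⟨k, ?_⟩
      rw [(h k).2, hk, Stream'.length_take]
      refine List.ext_getElem (by simp) fun i h₁ h₂ => ?_
      simp [PSeq.getD]
    | fin _ => cases hSS'
    | inc _ => cases hSS'

/-- An arbitrary tree yields some answer sequence `S₀` with the same image as `S`. The answers are
then corrected one by one, by renamings placed at the leaves. -/
theorem isOLDAnswerSeq_of_map_eq [Infinite SV] {C : Canon L SV} {p : N} {t : PS L SV (ar p)}
    {S : PSeq (StdSubst L SV)} (hdom : ∀ σ ∈ S.elems, σ.dom ⊆ t.codom)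
    (hS : semantics P p (C.canon t) = S.map fun σ => C.canon (t.app σ)) :
    IsOLDAnswerSeq P p t S := by
  obtain ⟨T, hT, -⟩ := exists_isOLDTree (P := P) (p := p) (t := t) (Q := fun _ _ => True)
    trivial fun _ _ _ ν' _ h => ⟨ν', h, trivial⟩
  obtain ⟨S₀, hS₀⟩ := exists_isAnswerSeq (P := P) (T := T) (V := t.codom)
  have hmap := (hT.semantics_eq (C := C) hS₀).symm.trans hS
  -- Beyond the end of the sequences both entries are the identity, so a renaming exists for every
  -- `j`.
  have hrep : ∀ j, ∃ ρ : StdSubst L SV, ρ.IsRenaming ∧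
      (t.app (S₀.getD j .id)).app ρ = t.app (S.getD j .id) := fun j => by
    have h := PSeq.map_getD (fun σ => C.canon (t.app σ)) S₀ j .id
    rw [hmap, PSeq.map_getD] at h
    exact C.canon_eq_iff.1 h.symm
  choose ρ hρ hρt using hrep
  have hdomj : ∀ j, (S.getD j .id).dom ⊆ t.codom := fun j => by
    rcases S.getD_mem j .id with h | h
    · exact hdom _ h
    · rw [h]
      exact fun y hy => (hy rfl).elim
  classical
  -- The number of answers found before `a` is visited, which for a leaf is the position of its own
  -- answer. The value `0` at addresses never visited plays no role.
  let idx : Addr → ℕ := fun a =>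
    if h : ∃ k, (traversal P T t.codom k).1.head? = some a then
      (traversal P T t.codom h.choose).2.length else 0
  have hidx : ∀ k a, (traversal P T t.codom k).1.head? = some a →
      idx a = (traversal P T t.codom k).2.length := fun k a h => by
    have hex : ∃ k, (traversal P T t.codom k).1.head? = some a := ⟨k, h⟩
    simp only [idx, dif_pos hex]
    rw [visited_injective hex.choose_spec h]
  obtain ⟨T', hT', hTT'⟩ := exists_modified_tree hT (ρ := fun a => ρ (idx a)) fun a => hρ _
  refine ⟨T', hT', hS₀.congr (d := .id) hmap (traversal_congr ?_ ?_)⟩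
  · exact fun a => (hTT' a).imp id fun ⟨ν, ν', h₁, h₂, h₃, _⟩ => ⟨ν, ν', h₁, h₂, h₃⟩
  · intro k a ν' hk hν' hG
    rcases hTT' a with ⟨-, h⟩ | ⟨ν, ν'', hν, hν'', hG', hsub⟩
    · rw [h] at hν'
      cases hν'
    · obtain rfl : ν'' = ν' := Option.some.inj (hν''.symm.trans hν')
      have hG₀ : ν.goal = [] := hG'.symm.trans hG
      rw [hsub hG₀, hidx k a hk]
      set j := (traversal P T t.codom k).2.length with hj
      have hget : S₀.getD j .id = ν.subst.restrict t.codom := by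
        have hstep : (traversal P T t.codom (k + 1)).2 =
            (traversal P T t.codom k).2 ++ [ν.subst.restrict t.codom] := by
          rw [traversal_succ]
          rcases hs : traversal P T t.codom k with ⟨_ | ⟨a', rest⟩, out⟩ <;> rw [hs] at hk
          · cases hk
          · obtain rfl : a' = a := Option.some.inj hk
            obtain ⟨G, σ, U⟩ := ν
            simp only at hG₀
            subst hG₀
            rw [visit_nil hν]
        have hle : PSeq.inc (traversal P T t.codom (k + 1)).2 ≤ S₀ :=
          inc_le_outSeq.trans ((isAnswerSeq_iff.1 hS₀).1 (k + 1))
        rw [PSeq.getD_of_inc_le hle (j := j) (by rw [hstep]; simp [hj])]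
        simp [hstep, hj]
      have hval := hρt j
      rw [hget, PS.app_restrict] at hval
      have hval' : t.sub (ν.subst.comp (ρ j)).toFun = t.sub (S.getD j .id).toFun := by
        rw [← PS.app_eq_sub _ (S.getD j .id), ← hval, PS.app_eq_sub, PS.app_eq_sub, PS.sub_sub]
        rfl
      -- On the query variables the substitutions agree because they give the same instance of `t`;
      -- elsewhere both are the identity, one by restriction and the other by `hdom`.
      refine StdSubst.ext fun y => ?_
      by_cases hy : y ∈ t.codom
      · exact (if_pos hy).trans (PS.sub_eq_sub_iff.1 hval' y hy)
      · refine (if_neg hy).trans ?_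
        by_contra hne
        exact hy (hdomj j fun h => hne h.symm)

end Backward

end PrologCut

/-! ### The main theorem. -/

theorem mainTheorem10 {L : FirstOrder.Language.{u, v}} {SV : Type w} [Infinite SV]
    {N : Type x} {ar : N → ℕ} (C : PrologCut.Canon L SV) (P : PrologCut.Program L ar) :
    ∃ b : PrologCut.Behavior C ar, PrologCut.IsConcreteSemantics P b ∧
      ∀ (p : N) (t : PrologCut.PS L SV (ar p)) (S : PrologCut.PSeq (PrologCut.StdSubst L SV)),
        PrologCut.IsOLDAnswerSeq P p t S ↔
          (∀ σ ∈ S.elems, σ.dom ⊆ t.codom) ∧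
            b p (C.canon t) = S.map (fun σ => C.canon (t.app σ)) :=
  ⟨PrologCut.semantics P, PrologCut.isConcreteSemantics_semantics P, fun _ _ _ =>
    ⟨fun ⟨_, hT, hS⟩ => ⟨hS.dom_subset, hT.semantics_eq hS⟩,
      fun h => PrologCut.isOLDAnswerSeq_of_map_eq h.1 h.2⟩⟩
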